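/- **Setting.** Equip $\mathbb R^4$ with $x\cdot y=x^0y^0-x^1y^1-x^2y^2-x^3y^3$ and write $x^2=x\cdot x$. For $X,Y\subseteq\mathbb R^4$ write $X\perp Y$ if $(x-y)^2<0$ for all $x\in X$, $y\in Y$. Let $\mathscr P^\uparrow_+$ be the restricted Poincaré group of pairs $P=(x,L)$ acting by $Py=x+Ly$, put $f_P=f\circ P^{-1}$ and $f_L=f_{(0,L)}$, and let $K$ be the set of open double cones. *Quantum electromagnetic field.* Let $\mathcal H$ be a Hilbert space with a unitary representation $U$ of $\mathscr P^\uparrow_+$ satisfying the spectrum condition and having, up to a factor, a unique invariant unit vector $\Omega$. For every real $f\in\mathcal S(\mathbb R^4)$ and $\mu,\nu\in\{0,\dots,3\}$ let $F_{\mu\nu}(f)$ be an operator on a fixed dense domain $\mathcal D\ni\Omega$ with $F_{\mu\nu}(f)\mathcal D\subseteq\mathcal D$ and $U(P)\mathcal D\subseteq\mathcal D$, whose matrix elements $(\phi,F_{\mu\nu}(f)\psi)$, $\phi,\psi\in\mathcal D$, are real-linear and continuous in $f\in\mathcal S(\mathbb R^4)$. The operators $F_{\mu\nu}(f)$, $\sum_\nu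 F_{\mu\nu}(h^\nu)$ and $\sum_{\mu,\nu}F_{\mu\nu}(h^{\mu\nu})$ ($f,h^\nu,h^{\mu\nu}$ real Schwartz functions) are essentially self-adjoint on $\mathcal D$; closures are denoted by the same symbols. Moreover, with ${L_\mu}^\alpha=g_{\mu\rho}{L^\rho}_\sigma g^{\sigma\alpha}$: * covariance: $U(P)F_{\mu\nu}(f)U(P)^*={L^{-1}{}_\mu}^\alpha\,{L^{-1}{}_\nu}^\beta\,F_{\alpha\beta}(f_P)$ for $P=(x,L)$; * (strong) causality: if $\operatorname{supp}f\perp\operatorname{supp}g$, then $[F_{\mu\nu}(f),F_{\alpha\beta}(g)]=0$ on $\mathcal D$ and $[\exp(iF_{\mu\nu}(f)),\exp(iF_{\alpha\beta}(g))]=0$; * $F_{\mu\nu}=-F_{\nu\mu}$, and $\partial_\sigma F_{\mu\nu}+\partial_\mu F_{\nu\sigma}+\partial_\nu F_{\sigma\mu}=0$, where $\partial_\sigma F_{\mu\nu}(f):=-F_{\mu\nu}(\partial_\sigma f)$. *Simplices.* An affine smearing $n$-simplex $s=(s_0,\dots,s_n;f)$, also written $(\varphi_s,f)$, consists of points $s_i\in\mathbb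 R^4$ and a real $f\in\mathcal S(\mathbb R^4)$ with $0\in\operatorname{supp}f$; $\varphi_s(t)=s_0+\sum_it_i(s_i-s_0)$ on $\Delta_n=\{t\in\mathbb R^n: t_i\ge 0,\ \sum_i t_i\le 1\}$. The set of these is $\Sigma_n$, and $\Sigma_n^a$ is the set of those with the same smearing function as $a\in\Sigma_0$. The group acts by $Ps=(Ps_0,\dots,Ps_n;f_L)$; the face $\partial_is$ omits $s_i$; $s$ is degenerate if two of its vertices coincide. The opposite of $b=(b_0,b_1;f)$ is $\bar b=(b_1,b_0;f)$, that of $c=(c_0,c_1,c_2;f)$ is $\bar c=(c_0,c_2,c_1;f)$. With the Jacobian $\varphi_s^{\alpha_1\cdots\alpha_n}=\det(\partial\varphi_s^{\alpha_i}/\partial t_j)$ the form of $s$ is $$\varphi_s[f]^{\alpha_1\cdots\alpha_n}(x)=\int_{\Delta_n}f(x-\varphi_s(t))\,\varphi_s^{\alpha_1\cdots\alpha_n}\,d^nt ;$$ forms of finite formal integer combinations (chains) are defined linearly, and the support $|\cdot|$ of a simplex or chain is the support of its form. For $a=(a_0;f)\in\Sigma_0$ and $s\in\Sigma^a_n$ the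 cone is $h^a(s)=(a_0,s_0,\dots,s_n;f)$, extended linearly to chains, and $\partial c=\partial_0c-\partial_1c+\partial_2c$ for $c\in\Sigma_2$. *Net of causal loops.* Let $\mathrm F$ be the group generated by $\Sigma_1$ with relations $b\bar b=1$ and $e_a=1$, where $e_a=(a_0,a_0;f)$ for $a=(a_0;f)\in\Sigma_0$. The support of $w\in\mathrm F$ is the union of the supports of the letters of its reduced word (no degenerate letters, no consecutive $b\bar b$). A loop over $a$ is a word $p=b_n\cdots b_1$ with $\partial_1b_1=a=\partial_0b_n$ and $\partial_1b_{i+1}=\partial_0b_i$. Let $\mathrm L\subseteq\mathrm F$ be the subgroup generated by all loops, $\mathrm L_o=\{w\in\mathrm L:|w|\subseteq o\}$ for $o\in K$, and $\widehat{\mathrm L}$ the quotient of $\mathrm L$ by the relations $w_1w_2=w_2w_1$ for $w_i\in\mathrm L_{o_i}$, $o_1\perp o_2$ in $K$. The net of causal loops $(\mathcal A,\alpha)_K$ is given by $\mathcal A(\mathbb R^4)=C^*(\widehat{\mathrm L})$ (full group $C^*$-algebra of the discrete group), $\mathcal A_o\subseteq\mathcal A(\mathbb R^4)$ the $C^*$-subalgebra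 generated by the image of $\mathrm L_o$, and the action $\alpha$ of $\mathscr P^\uparrow_+$ induced by the one on words. A covariant representation is a pair $(\pi,U)$ of a unital $*$-representation $\pi$ of $\mathcal A(\mathbb R^4)$ and a unitary representation $U$ of $\mathscr P^\uparrow_+$ with $U(P)\pi(A)U(P)^*=\pi(\alpha_P(A))$. **Theorem.** For $c=(\sigma_c,f)\in\Sigma_2$ put $F\langle\sigma_c,f\rangle=\tfrac12\sum_{\mu,\nu}F_{\mu\nu}(\sigma_c[f]^{\mu\nu})$. This operator is essentially self-adjoint on $\mathcal D$; let $\mathrm w^{em}(c)=\exp(iF\langle\sigma_c,f\rangle)$. Then: 1. $(\mathrm w^{em},U)$ is a causal and covariant 2-cochain: $\mathrm w^{em}(c)^*=\mathrm w^{em}(\bar c)$; $\mathrm w^{em}(c)=1$ if $c$ is degenerate; $[\mathrm w^{em}(c_1),\mathrm w^{em}(c_2)]=0$ if $|c_1|\perp|c_2|$; and $U(P)\mathrm w^{em}(c)U(P)^*=\mathrm w^{em}(Pc)$ for all $P\in\mathscr P^\uparrow_+$. 2. It defines a covariant representation $(\pi,U)$ of $(\mathcal A,\alpha)_K$: there is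 exactly one covariant representation $(\pi,U)$ on $\mathcal H$ such that $\pi(p)=\mathrm w^{em}(h^a(b_n))\cdots\mathrm w^{em}(h^a(b_1))$ for every $a\in\Sigma_0$ and every loop $p=b_n\cdots b_1$ over $a$. 3. If $a,a'\in\Sigma_0$, $c\in\Sigma_2^a$, $c'\in\Sigma_2^{a'}$ and $|h^a(\partial c)|\perp|h^{a'}(\partial c')|$, then $[\mathrm w^{em}(c),\mathrm w^{em}(c')]=0$. -/

import Mathlib

namespace CausalLoops
open scoped ComplexConjugate SchwartzMap ContDiff
open MeasureTheory UniformSpace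
noncomputable section

/-! ### Minkowski space-time and the Poincaré group -/

/-- `ℝ⁴`, with coordinates `x⁰, x¹, x², x³`. -/
abbrev Spacetime : Type := Fin 4 → ℝ

/-- The Minkowski inner product `x⁰y⁰ - x¹y¹ - x²y² - x³y³`. -/
def mink (x y : Spacetime) : ℝ := x 0 * y 0 - x 1 * y 1 - x 2 * y 2 - x 3 * y 3

/-- The metric tensor `diag(1,-1,-1,-1)`. -/
def metric : Matrix (Fin 4) (Fin 4) ℝ := Matrix.diagonal ![1, -1, -1, -1]

/-- Causal disjointness `X ⟂ Y`: all pairs of points are spacelike separated. -/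
def CausallyDisjoint (X Y : Set Spacetime) : Prop := ∀ x ∈ X, ∀ y ∈ Y, mink (x - y) (x - y) < 0

/-- The open forward light cone. -/
def forwardCone : Set Spacetime := {v | 0 < mink v v ∧ 0 < v 0}

/-- The closed forward light cone. -/
def closedForwardCone : Set Spacetime := {v | 0 ≤ mink v v ∧ 0 ≤ v 0}

/-- Open double cones: the intersection of the future of a point `p` and the past of a point `q`
in the future of `p`. -/
def IsDoubleCone (o : Set Spacetime) : Prop :=
  ∃ p q : Spacetime, q - p ∈ forwardCone ∧ o = {x | x - p ∈ forwardCone ∧ q - x ∈ forwardCone}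

lemma mink_eq (x y : Spacetime) : mink x y = x ⬝ᵥ metric.mulVec y := by
  simp [mink, metric, Matrix.mulVec_diagonal, dotProduct, Fin.sum_univ_four]
  ring

/-- The defining properties of a restricted Lorentz transformation: `LᵀgL = g`, positive
determinant and `L⁰₀ ≥ 1`. -/
def IsRestrictedLorentz (L : Matrix (Fin 4) (Fin 4) ℝ) : Prop :=
  L.transpose * metric * L = metric ∧ 0 < L.det ∧ 1 ≤ L 0 0

lemma metric_mul_metric : metric * metric = 1 := by
  rw [metric, Matrix.diagonal_mul_diagonal, ← Matrix.diagonal_one]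
  congr 1
  ext i; fin_cases i <;> simp

namespace IsRestrictedLorentz

variable {L L' : Matrix (Fin 4) (Fin 4) ℝ}

lemma mink_mulVec (h : IsRestrictedLorentz L) (x y : Spacetime) :
    mink (L.mulVec x) (L.mulVec y) = mink x y := by
  rw [mink_eq, mink_eq, Matrix.mulVec_mulVec, ← Matrix.vecMul_transpose,
    ← Matrix.dotProduct_mulVec, Matrix.mulVec_mulVec, ← mul_assoc, h.1]

lemma inv_mul (h : IsRestrictedLorentz L) : metric * L.transpose * metric * L = 1 := by
  rw [mul_assoc, mul_assoc, ← mul_assoc L.transpose, h.1, metric_mul_metric]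

lemma mul_inv (h : IsRestrictedLorentz L) : L * (metric * L.transpose * metric) = 1 :=
  mul_eq_one_comm.1 h.inv_mul

lemma row (h : IsRestrictedLorentz L) : L 0 0 ^ 2 - L 0 1 ^ 2 - L 0 2 ^ 2 - L 0 3 ^ 2 = 1 := by
  have h1 := congrFun (congrFun h.mul_inv 0) 0
  simp [metric, Matrix.mul_apply, Fin.sum_univ_four, Matrix.diagonal_apply] at h1
  linarith

lemma mulVec_mem (h : IsRestrictedLorentz L) {v : Spacetime} (hv : v ∈ forwardCone) :
    L.mulVec v ∈ forwardCone := by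
  refine ⟨by rw [h.mink_mulVec]; exact hv.1, ?_⟩
  have hr := h.row
  have h0 := h.2.2
  obtain ⟨h1, h2⟩ := hv
  simp only [mink] at h1
  have e : L.mulVec v 0 = L 0 0 * v 0 + (L 0 1 * v 1 + L 0 2 * v 2 + L 0 3 * v 3) := by
    simp [Matrix.mulVec, dotProduct, Fin.sum_univ_four]; ring
  rw [e]
  have hcs : (L 0 1 * v 1 + L 0 2 * v 2 + L 0 3 * v 3) ^ 2 ≤
      (L 0 1 ^ 2 + L 0 2 ^ 2 + L 0 3 ^ 2) * (v 1 ^ 2 + v 2 ^ 2 + v 3 ^ 2) := by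
    nlinarith [sq_nonneg (L 0 1 * v 2 - L 0 2 * v 1), sq_nonneg (L 0 1 * v 3 - L 0 3 * v 1),
      sq_nonneg (L 0 2 * v 3 - L 0 3 * v 2)]
  have hlt : (L 0 1 * v 1 + L 0 2 * v 2 + L 0 3 * v 3) ^ 2 < (L 0 0 * v 0) ^ 2 := by
    have hA : L 0 1 ^ 2 + L 0 2 ^ 2 + L 0 3 ^ 2 = L 0 0 ^ 2 - 1 := by linarith
    have hB : v 1 ^ 2 + v 2 ^ 2 + v 3 ^ 2 < v 0 ^ 2 := by nlinarith
    rw [hA] at hcs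
    have : 0 ≤ L 0 0 ^ 2 - 1 := by nlinarith
    nlinarith [mul_le_mul_of_nonneg_left hB.le this, sq_nonneg (v 0), mul_pos h2 h2]
  have := abs_lt_of_sq_lt_sq hlt (by positivity)
  linarith [(abs_lt.1 this).1, this]

lemma one_zero (h : IsRestrictedLorentz L) : L.mulVec (Pi.single 0 1) ∈ forwardCone :=
  h.mulVec_mem (by simp [forwardCone, mink])

lemma one : IsRestrictedLorentz 1 := by simp [IsRestrictedLorentz]

lemma mul (h : IsRestrictedLorentz L) (h' : IsRestrictedLorentz L') :
    IsRestrictedLorentz (L * L') := by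
  refine ⟨?_, by rw [Matrix.det_mul]; exact mul_pos h.2.1 h'.2.1, ?_⟩
  · rw [Matrix.transpose_mul, mul_assoc, mul_assoc, ← mul_assoc metric, ← mul_assoc L.transpose,
      ← mul_assoc L.transpose, h.1, ← mul_assoc, h'.1]
  · have h1 : L.mulVec (L'.mulVec (Pi.single 0 1)) ∈ forwardCone := h.mulVec_mem h'.one_zero
    have h2 : mink (L.mulVec (L'.mulVec (Pi.single 0 1))) (L.mulVec (L'.mulVec (Pi.single 0 1)))
        = 1 := by
      rw [h.mink_mulVec, h'.mink_mulVec]; simp [mink]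
    have h3 : (L * L') 0 0 = L.mulVec (L'.mulVec (Pi.single 0 1)) 0 := by
      rw [Matrix.mulVec_mulVec]; simp
    rw [h3]
    set w := L.mulVec (L'.mulVec (Pi.single 0 1))
    have := h1.2
    simp only [mink] at h2
    nlinarith [sq_nonneg (w 1), sq_nonneg (w 2), sq_nonneg (w 3)]

lemma inv (h : IsRestrictedLorentz L) : IsRestrictedLorentz (metric * L.transpose * metric) := by
  have ht : metric.transpose = metric := Matrix.diagonal_transpose _
  have hd : (metric * L.transpose * metric).det * L.det = 1 := by
    rw [← Matrix.det_mul, h.inv_mul, Matrix.det_one]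
  refine ⟨?_, ?_, ?_⟩
  · have e : (metric * L.transpose * metric).transpose = metric * L * metric := by
      simp [Matrix.transpose_mul, ht, mul_assoc]
    have h2 : L * metric * L.transpose = metric := by
      have := congrArg (· * metric) h.mul_inv
      simpa [mul_assoc, metric_mul_metric] using this
    rw [e]
    calc metric * L * metric * metric * (metric * L.transpose * metric)
        = metric * L * (metric * metric) * metric * L.transpose * metric := by
          simp only [mul_assoc]
      _ = metric * (L * metric * L.transpose) * metric := by
          rw [metric_mul_metric]; simp only [mul_assoc, mul_one]
      _ = metric := by rw [h2, metric_mul_metric, one_mul]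
  · exact (pos_iff_pos_of_mul_pos (by rw [hd]; exact one_pos)).2 h.2.1
  · have : (metric * L.transpose * metric) 0 0 = L 0 0 := by
      simp [metric, Matrix.mul_apply, Matrix.diagonal_apply]
    rw [this]; exact h.2.2

end IsRestrictedLorentz

/-- The elements `(a, L)` of the restricted Poincaré group. -/
@[ext]
structure Poincare where
  /-- the translation -/
  trans : Spacetime
  /-- the Lorentz transformation -/
  lor : Matrix (Fin 4) (Fin 4) ℝ
  isLorentz : IsRestrictedLorentz lor

namespace Poincare

instance : Mul Poincare :=
  ⟨fun P Q => ⟨P.trans + P.lor.mulVec Q.trans, P.lor * Q.lor, P.isLorentz.mul Q.isLorentz⟩⟩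

instance : One Poincare := ⟨⟨0, 1, IsRestrictedLorentz.one⟩⟩

/-- `(a, L)⁻¹ = (-L⁻¹a, L⁻¹)`, where `L⁻¹ = gLᵀg`. -/
instance : Inv Poincare :=
  ⟨fun P => ⟨-(metric * P.lor.transpose * metric).mulVec P.trans,
    metric * P.lor.transpose * metric, P.isLorentz.inv⟩⟩

lemma mul_def (P Q : Poincare) :
    P * Q = ⟨P.trans + P.lor.mulVec Q.trans, P.lor * Q.lor, P.isLorentz.mul Q.isLorentz⟩ := rfl

@[simp] lemma mul_trans (P Q : Poincare) : (P * Q).trans = P.trans + P.lor.mulVec Q.trans := rfl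
@[simp] lemma mul_lor (P Q : Poincare) : (P * Q).lor = P.lor * Q.lor := rfl
@[simp] lemma one_trans : (1 : Poincare).trans = 0 := rfl
@[simp] lemma one_lor : (1 : Poincare).lor = 1 := rfl
lemma inv_trans (P : Poincare) :
    P⁻¹.trans = -(metric * P.lor.transpose * metric).mulVec P.trans := rfl
lemma inv_lor (P : Poincare) : P⁻¹.lor = metric * P.lor.transpose * metric := rfl

instance : Group Poincare :=
  Group.ofLeftAxioms
    (fun P Q R => by
      ext1
      · simp [Matrix.mulVec_add, Matrix.mulVec_mulVec, add_assoc]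
      · simp [mul_assoc])
    (fun P => by ext1 <;> simp)
    (fun P => by
      ext1
      · simp [inv_trans, inv_lor]
      · simp [inv_lor, P.isLorentz.inv_mul])

instance : MulAction Poincare Spacetime where
  smul P x := P.trans + P.lor.mulVec x
  one_smul x := by change (1 : Poincare).trans + (1 : Poincare).lor.mulVec x = x; simp
  mul_smul P Q x := by
    change (P * Q).trans + (P * Q).lor.mulVec x
      = P.trans + P.lor.mulVec (Q.trans + Q.lor.mulVec x)
    simp [Matrix.mulVec_add, Matrix.mulVec_mulVec, add_assoc]

lemma smul_def (P : Poincare) (x : Spacetime) : P • x = P.trans + P.lor.mulVec x := rfl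

/-- The translation by `a`. -/
def translation (a : Spacetime) : Poincare := ⟨a, 1, IsRestrictedLorentz.one⟩

/-- The Lorentz transformation `(0, L)` of `P = (a, L)`. -/
def linearPart (P : Poincare) : Poincare := ⟨0, P.lor, P.isLorentz⟩

lemma linearPart_one : (1 : Poincare).linearPart = 1 := rfl
lemma linearPart_mul (P Q : Poincare) : (P * Q).linearPart = P.linearPart * Q.linearPart := by
  ext1
  · simp [linearPart]
  · rfl

lemma linearPart_smul_zero (P : Poincare) : P.linearPart • (0 : Spacetime) = 0 := by
  simp [smul_def, linearPart]

lemma smul_sub_smul (P : Poincare) (x y : Spacetime) : P • x - P • y = P.lor.mulVec (x - y) := by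
  simp [smul_def, Matrix.mulVec_sub]

lemma mink_smul (P : Poincare) (x y : Spacetime) :
    mink (P • x - P • y) (P • x - P • y) = mink (x - y) (x - y) := by
  rw [smul_sub_smul, P.isLorentz.mink_mulVec]

lemma continuous_smul (P : Poincare) : Continuous (fun x : Spacetime => P • x) := by
  change Continuous fun x : Spacetime => P.trans + P.lor.mulVec x
  exact continuous_const.add (Continuous.matrix_mulVec continuous_const continuous_id)

/-- Poincaré transformations as homeomorphisms. -/
def homeo (P : Poincare) : Spacetime ≃ₜ Spacetime where
  toEquiv := MulAction.toPerm P
  continuous_toFun := continuous_smul P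
  continuous_invFun := continuous_smul P⁻¹

lemma smul_mem_forwardCone (P : Poincare) {x y : Spacetime} :
    P • x - P • y ∈ forwardCone ↔ x - y ∈ forwardCone := by
  constructor
  · intro h
    have := P⁻¹.isLorentz.mulVec_mem h
    rwa [← smul_sub_smul, inv_smul_smul, inv_smul_smul] at this
  · intro h
    rw [smul_sub_smul]; exact P.isLorentz.mulVec_mem h

end Poincare

lemma CausallyDisjoint.image {X Y : Set Spacetime} (h : CausallyDisjoint X Y) (P : Poincare) :
    CausallyDisjoint ((P • ·) '' X) ((P • ·) '' Y) := by
  rintro _ ⟨x, hx, rfl⟩ _ ⟨y, hy, rfl⟩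
  simpa only [P.mink_smul] using h x hx y hy

lemma IsDoubleCone.image {o : Set Spacetime} (h : IsDoubleCone o) (P : Poincare) :
    IsDoubleCone ((P • ·) '' o) := by
  obtain ⟨p, q, hpq, rfl⟩ := h
  refine ⟨P • p, P • q, P.smul_mem_forwardCone.2 hpq, ?_⟩
  ext x
  constructor
  · rintro ⟨y, hy, rfl⟩
    exact ⟨P.smul_mem_forwardCone.2 hy.1, P.smul_mem_forwardCone.2 hy.2⟩
  · intro hx
    refine ⟨P⁻¹ • x, ?_, smul_inv_smul P x⟩
    rw [← smul_inv_smul P x] at hx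
    exact ⟨P.smul_mem_forwardCone.1 hx.1, P.smul_mem_forwardCone.1 hx.2⟩

/-! ### Test functions -/

/-- Real test functions. -/
abbrev TestFunction : Type := 𝓢(Spacetime, ℝ)

/-- A restricted Lorentz transformation as a linear automorphism of `ℝ⁴`. -/
def Poincare.linearEquiv (P : Poincare) : Spacetime ≃L[ℝ] Spacetime :=
  LinearEquiv.toContinuousLinearEquiv
    { Matrix.mulVecLin P.lor with
      invFun := P⁻¹.lor.mulVec
      left_inv := fun x => by
        simp [Poincare.inv_lor, Matrix.mulVec_mulVec, P.isLorentz.inv_mul]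
      right_inv := fun x => by
        simp [Poincare.inv_lor, Matrix.mulVec_mulVec, P.isLorentz.mul_inv] }

/-- `f_P = f ∘ P⁻¹`. -/
def transform (P : Poincare) (f : TestFunction) : TestFunction :=
  (SchwartzMap.compCLMOfContinuousLinearEquiv ℝ P.linearEquiv.symm f).compSubConstCLM ℝ P.trans

lemma transform_apply (P : Poincare) (f : TestFunction) (x : Spacetime) :
    transform P f x = f (P⁻¹ • x) := by
  change f (P⁻¹.lor.mulVec (x - P.trans)) = _
  rw [Poincare.smul_def, Poincare.inv_trans, Poincare.inv_lor, Matrix.mulVec_sub, sub_eq_add_neg,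
    add_comm]

lemma transform_one (f : TestFunction) : transform 1 f = f := by
  ext x; simp [transform_apply]

lemma transform_mul (P Q : Poincare) (f : TestFunction) :
    transform (P * Q) f = transform P (transform Q f) := by
  ext x; simp [transform_apply, mul_smul]

lemma transform_fun (P : Poincare) (f : TestFunction) :
    (transform P f : Spacetime → ℝ) = f ∘ P.homeo.symm := by
  ext x; exact transform_apply P f x

lemma tsupport_transform (P : Poincare) (f : TestFunction) :
    tsupport (transform P f) = (P • ·) '' tsupport f := by
  rw [transform_fun, tsupport_comp_eq_preimage]
  exact (P.homeo.toEquiv.image_eq_preimage_symm _).symm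

section Average

variable {T : Type} [MeasurableSpace T] (μ : Measure T) [IsFiniteMeasure μ] {σ : T → Spacetime}

lemma integrable_schwartz_comp (hσ : Measurable σ) {V : Type} [NormedAddCommGroup V] [NormedSpace ℝ V]
    (f : 𝓢(Spacetime, V)) (x : Spacetime) : Integrable (fun t => f (x - σ t)) μ := by
  obtain ⟨C, hC⟩ := f.decay 0 0
  refine Integrable.of_bound (C := C)
    (f.continuous.comp_aestronglyMeasurable (by fun_prop)) (Filter.Eventually.of_forall fun t => ?_)
  simpa using hC.2 (x - σ t)

lemma hasFDerivAt_average (hσ : Measurable σ) {V : Type} [NormedAddCommGroup V] [NormedSpace ℝ V]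
    (f : 𝓢(Spacetime, V)) (x : Spacetime) :
    HasFDerivAt (fun x => ∫ t, f (x - σ t) ∂μ)
      (∫ t, SchwartzMap.fderivCLM ℝ Spacetime V f (x - σ t) ∂μ) x := by
  obtain ⟨C, hC⟩ := (SchwartzMap.fderivCLM ℝ Spacetime V f).decay 0 0
  refine hasFDerivAt_integral_of_dominated_of_fderiv_le (s := Set.univ) (bound := fun _ => C)
    (F' := fun x t => SchwartzMap.fderivCLM ℝ Spacetime V f (x - σ t)) Filter.univ_mem
    (Filter.Eventually.of_forall fun x => (integrable_schwartz_comp μ hσ f x).1)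
    (integrable_schwartz_comp μ hσ f x) (integrable_schwartz_comp μ hσ _ x).1
    (Filter.Eventually.of_forall fun t x _ => by simpa using hC.2 (x - σ t))
    (integrable_const C) (Filter.Eventually.of_forall fun t x _ => ?_)
  have h := (f.hasFDerivAt (x - σ t)).comp x ((hasFDerivAt_id x).sub_const (σ t))
  rwa [ContinuousLinearMap.comp_id] at h

lemma contDiff_average (hσ : Measurable σ) (n : ℕ) : ∀ {V : Type} [NormedAddCommGroup V] [NormedSpace ℝ V]
    (f : 𝓢(Spacetime, V)), ContDiff ℝ n (fun x => ∫ t, f (x - σ t) ∂μ) := by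
  induction n with
  | zero =>
    intro V _ _ f
    exact contDiff_zero.2 (continuous_iff_continuousAt.2 fun x =>
      (hasFDerivAt_average μ hσ f x).continuousAt)
  | succ n ih =>
    intro V _ _ f
    exact contDiff_succ_iff_hasFDerivAt.2
      ⟨_, ih (SchwartzMap.fderivCLM ℝ Spacetime V f), hasFDerivAt_average μ hσ f⟩

lemma decay_average (hσ : Measurable σ) {R : ℝ} (hR : ∀ᵐ t ∂μ, ‖σ t‖ ≤ R) (k n : ℕ) : ∀ {V : Type} [NormedAddCommGroup V] [NormedSpace ℝ V]
    (f : 𝓢(Spacetime, V)),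
    ∃ C, ∀ x, ‖x‖ ^ k * ‖iteratedFDeriv ℝ n (fun x => ∫ t, f (x - σ t) ∂μ) x‖ ≤ C := by
  induction n with
  | zero =>
    intro V _ _ f
    refine ⟨(1 + R) ^ k * (2 ^ k * (Finset.Iic (k, 0)).sup
      (fun m => SchwartzMap.seminorm ℝ m.1 m.2) f) * μ.real Set.univ, fun x => ?_⟩
    rw [norm_iteratedFDeriv_zero, ← Real.norm_of_nonneg (by positivity : 0 ≤ ‖x‖ ^ k),
      ← norm_smul, ← integral_smul]
    refine norm_integral_le_of_norm_le_const ?_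
    filter_upwards [hR] with t ht
    have h0 : 0 ≤ R := (norm_nonneg _).trans ht
    have h1 := SchwartzMap.one_add_le_sup_seminorm_apply (𝕜 := ℝ) (m := (k, 0)) le_rfl le_rfl f
      (x - σ t)
    rw [norm_iteratedFDeriv_zero] at h1
    have h2 : ‖x‖ ≤ (1 + R) * (1 + ‖x - σ t‖) := by
      have : ‖x‖ ≤ ‖x - σ t‖ + ‖σ t‖ := by simpa using norm_add_le (x - σ t) (σ t)
      nlinarith [norm_nonneg (x - σ t)]
    rw [norm_smul, Real.norm_of_nonneg (by positivity : 0 ≤ ‖x‖ ^ k)]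
    calc ‖x‖ ^ k * ‖f (x - σ t)‖ ≤ ((1 + R) * (1 + ‖x - σ t‖)) ^ k * ‖f (x - σ t)‖ := by gcongr
      _ = (1 + R) ^ k * ((1 + ‖x - σ t‖) ^ k * ‖f (x - σ t)‖) := by rw [mul_pow]; ring
      _ ≤ _ := by gcongr
  | succ n ih =>
    intro V _ _ f
    obtain ⟨C, hC⟩ := ih (SchwartzMap.fderivCLM ℝ Spacetime V f)
    refine ⟨C, fun x => ?_⟩
    rw [← norm_iteratedFDeriv_fderiv]
    have : fderiv ℝ (fun x => ∫ t, f (x - σ t) ∂μ)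
        = fun x => ∫ t, SchwartzMap.fderivCLM ℝ Spacetime V f (x - σ t) ∂μ :=
      funext fun x => (hasFDerivAt_average μ hσ f x).fderiv
    rw [this]; exact hC x

/-- The test function `x ↦ ∫ f(x - σ(t)) dμ(t)`, for a bounded map `σ` and a finite measure `μ`. -/
def average (hσ : Measurable σ) {R : ℝ} (hR : ∀ᵐ t ∂μ, ‖σ t‖ ≤ R) (f : TestFunction) : TestFunction where
  toFun x := ∫ t, f (x - σ t) ∂μ
  smooth' := contDiff_infty.2 fun n => contDiff_average μ hσ n f
  decay' k n := decay_average μ hσ hR k n f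

end Average

/-! ### The group C*-algebra of a discrete group -/

/-- The complex group algebra `ℂ[G]`, with the involution `(∑ a_g g)^* = ∑ conj(a_g) g⁻¹`. -/
def GroupRing (G : Type*) [Group G] : Type _ := MonoidAlgebra ℂ G

namespace GroupRing

variable {G : Type*} [Group G]

instance : Ring (GroupRing G) := inferInstanceAs (Ring (MonoidAlgebra ℂ G))
instance : Algebra ℂ (GroupRing G) := inferInstanceAs (Algebra ℂ (MonoidAlgebra ℂ G))

/-- The element `a g` of the group algebra. -/
def single (g : G) (a : ℂ) : GroupRing G := MonoidAlgebra.single g a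

lemma single_add (g : G) (a b : ℂ) : single g (a + b) = single g a + single g b :=
  MonoidAlgebra.single_add g a b

lemma single_mul_single (g h : G) (a b : ℂ) :
    single g a * single h b = single (g * h) (a * b) :=
  MonoidAlgebra.single_mul_single g h a b

lemma one_def : (1 : GroupRing G) = single 1 1 := rfl

lemma smul_single (c : ℂ) (g : G) (a : ℂ) : c • single g a = single g (c * a) :=
  MonoidAlgebra.smul_single' c g a

lemma induction_linear {motive : GroupRing G → Prop} (x : GroupRing G) (zero : motive 0)
    (add : ∀ x y, motive x → motive y → motive (x + y)) (single : ∀ g a, motive (single g a)) :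
    motive x :=
  MonoidAlgebra.induction_linear (motive := motive) x zero add single

/-- The involution of the group algebra, as an additive map. -/
def starHom : GroupRing G →+ GroupRing G where
  toFun x := (MonoidAlgebra.coeff x).sum fun g a => single g⁻¹ (conj a)
  map_zero' := by
    change (MonoidAlgebra.coeff (0 : MonoidAlgebra ℂ G)).sum _ = 0
    simp
  map_add' x y := by
    classical
    refine Finsupp.sum_add_index' (f := MonoidAlgebra.coeff (R := ℂ) (M := G) x)
      (g := MonoidAlgebra.coeff (R := ℂ) (M := G) y)
      (h := fun g a => (single g⁻¹ (conj a) : GroupRing G)) (fun g => ?_) (fun g a b => ?_)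
    · rw [map_zero]
      exact MonoidAlgebra.single_zero _
    · rw [map_add, single_add]

lemma starHom_single (g : G) (a : ℂ) : starHom (single g a) = single g⁻¹ (conj a) := by
  refine (Finsupp.sum_single_index (h := fun g a => (single g⁻¹ (conj a) : GroupRing G)) ?_)
  rw [map_zero]
  exact MonoidAlgebra.single_zero _

instance : StarRing (GroupRing G) where
  star := starHom
  star_involutive x := by
    induction x using induction_linear with
    | zero => simp
    | add x y hx hy => rw [map_add, map_add, hx, hy]
    | single g a => simp [starHom_single]
  star_mul x y := by
    change starHom (x * y) = starHom y * starHom x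
    induction x using induction_linear with
    | zero => simp
    | add x x' hx hx' => rw [add_mul, map_add, hx, hx', map_add, mul_add]
    | single g a =>
      induction y using induction_linear with
      | zero => simp
      | add y y' hy hy' => rw [mul_add, map_add, hy, hy', map_add, add_mul]
      | single h b => simp [starHom_single, single_mul_single, mul_comm]
  star_add x y := map_add starHom x y

lemma star_single (g : G) (a : ℂ) : star (single g a) = single g⁻¹ (conj a) :=
  starHom_single g a

instance : StarModule ℂ (GroupRing G) where
  star_smul c x := by
    induction x using induction_linear with
    | zero => simp
    | add x y hx hy => rw [smul_add, star_add, hx, hy, star_add, smul_add]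
    | single g a => simp [star_single, smul_single]

/-- The C*-seminorms on the group algebra. -/
structure IsCStarSeminorm (p : Seminorm ℂ (GroupRing G)) : Prop where
  mul_le : ∀ x y, p (x * y) ≤ p x * p y
  star_mul_self : ∀ x, p (star x * x) = p x ^ 2

lemma isCStarSeminorm_zero : IsCStarSeminorm (0 : Seminorm ℂ (GroupRing G)) :=
  ⟨fun _ _ => by simp, fun _ => by simp⟩

lemma IsCStarSeminorm.le_one {p : Seminorm ℂ (GroupRing G)} (hp : IsCStarSeminorm p) (g : G) :
    p (single g 1) ≤ 1 := by
  have h1 : p 1 ≤ 1 := by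
    have h := hp.star_mul_self 1
    rw [star_one, one_mul] at h
    nlinarith [sq_nonneg (p 1 - 1)]
  have h := hp.star_mul_self (single g 1)
  rw [star_single, single_mul_single] at h
  simp only [inv_mul_cancel, map_one, mul_one, ← one_def] at h
  nlinarith [apply_nonneg p (single g 1)]

lemma bddAbove_cstar (x : GroupRing G) :
    BddAbove (Set.range fun p : {p : Seminorm ℂ (GroupRing G) // IsCStarSeminorm p} => p.1 x) := by
  induction x using induction_linear with
  | zero => exact ⟨0, by rintro _ ⟨p, rfl⟩; simp⟩
  | add x y hx hy =>
    obtain ⟨a, ha⟩ := hx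
    obtain ⟨b, hb⟩ := hy
    refine ⟨a + b, ?_⟩
    rintro _ ⟨p, rfl⟩
    exact (map_add_le_add p.1 x y).trans (add_le_add (ha ⟨p, rfl⟩) (hb ⟨p, rfl⟩))
  | single g a =>
    refine ⟨‖a‖, ?_⟩
    rintro _ ⟨p, rfl⟩
    have : single g a = a • single g 1 := by rw [smul_single, mul_one]
    simp only [this, map_smul_eq_mul]
    exact mul_le_of_le_one_right (norm_nonneg _) (p.2.le_one g)

instance : Nonempty {p : Seminorm ℂ (GroupRing G) // IsCStarSeminorm p} :=
  ⟨⟨0, isCStarSeminorm_zero⟩⟩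

/-- The greatest C*-seminorm of the group algebra. By the Gelfand–Naimark theorem it is
`sup ‖ρ(x)‖` over the unitary representations `ρ` of `G`. -/
def maxNorm (x : GroupRing G) : ℝ :=
  ⨆ p : {p : Seminorm ℂ (GroupRing G) // IsCStarSeminorm p}, p.1 x

lemma le_maxNorm {p : Seminorm ℂ (GroupRing G)} (hp : IsCStarSeminorm p) (x : GroupRing G) :
    p x ≤ maxNorm x :=
  le_ciSup (bddAbove_cstar x) ⟨p, hp⟩

lemma maxNorm_nonneg (x : GroupRing G) : 0 ≤ maxNorm x :=
  (le_of_eq (by simp)).trans (le_maxNorm isCStarSeminorm_zero x)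

lemma maxNorm_add_le (x y : GroupRing G) : maxNorm (x + y) ≤ maxNorm x + maxNorm y :=
  ciSup_le fun p => (map_add_le_add p.1 x y).trans
    (add_le_add (le_maxNorm p.2 x) (le_maxNorm p.2 y))

lemma maxNorm_smul_le (c : ℂ) (x : GroupRing G) : maxNorm (c • x) ≤ ‖c‖ * maxNorm x :=
  ciSup_le fun p => by
    rw [map_smul_eq_mul]
    exact mul_le_mul_of_nonneg_left (le_maxNorm p.2 x) (norm_nonneg _)

lemma maxNorm_mul_le (x y : GroupRing G) : maxNorm (x * y) ≤ maxNorm x * maxNorm y :=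
  ciSup_le fun p => (p.2.mul_le x y).trans
    (mul_le_mul (le_maxNorm p.2 x) (le_maxNorm p.2 y) (apply_nonneg _ _) (maxNorm_nonneg _))

lemma sq_maxNorm_le (x : GroupRing G) : maxNorm x * maxNorm x ≤ maxNorm (star x * x) := by
  have h : maxNorm x ≤ Real.sqrt (maxNorm (star x * x)) :=
    ciSup_le fun p => Real.le_sqrt_of_sq_le (by
      rw [← p.2.star_mul_self]; exact le_maxNorm p.2 _)
  calc maxNorm x * maxNorm x ≤ _ := mul_self_le_mul_self (maxNorm_nonneg x) h
    _ = _ := Real.mul_self_sqrt (maxNorm_nonneg _)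

instance : Norm (GroupRing G) := ⟨maxNorm⟩

lemma maxNorm_core : SeminormedSpace.Core ℂ (GroupRing G) where
  norm_nonneg := maxNorm_nonneg
  norm_smul c x := by
    refine le_antisymm (maxNorm_smul_le c x) ?_
    by_cases hc : c = 0
    · rw [hc, norm_zero, zero_mul]; exact maxNorm_nonneg _
    · have h := maxNorm_smul_le c⁻¹ (c • x)
      rw [smul_smul, inv_mul_cancel₀ hc, one_smul, norm_inv] at h
      have hc' : 0 < ‖c‖ := norm_pos_iff.2 hc
      calc ‖c‖ * maxNorm x ≤ ‖c‖ * (‖c‖⁻¹ * maxNorm (c • x)) :=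
            mul_le_mul_of_nonneg_left h hc'.le
        _ = maxNorm (c • x) := by field_simp
  norm_triangle := maxNorm_add_le

instance : SeminormedRing (GroupRing G) where
  __ := (inferInstance : Ring (GroupRing G))
  __ := SeminormedAddCommGroup.ofCore (maxNorm_core (G := G))
  norm_mul_le := maxNorm_mul_le

lemma norm_def (x : GroupRing G) : ‖x‖ = maxNorm x := rfl

instance : NormedAlgebra ℂ (GroupRing G) where
  norm_smul_le := maxNorm_smul_le

instance : NormedStarGroup (GroupRing G) where
  norm_star_le x := by
    have h : ∀ y : GroupRing G, ‖y‖ ≤ ‖star y‖ := fun y => by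
      have h1 : ‖y‖ * ‖y‖ ≤ ‖star y‖ * ‖y‖ := (sq_maxNorm_le y).trans (maxNorm_mul_le (star y) y)
      by_cases h0 : ‖y‖ = 0
      · rw [h0]; exact norm_nonneg _
      · exact le_of_mul_le_mul_right h1 (lt_of_le_of_ne (norm_nonneg _) (Ne.symm h0))
    simpa using h (star x)

end GroupRing

/-- The (full) group C*-algebra `C*(G)` of the discrete group `G`: the completion of `ℂ[G]` in the
greatest C*-seminorm. -/
def GroupCStar (G : Type*) [Group G] : Type _ := Completion (GroupRing G)

namespace GroupCStar

variable {G : Type*} [Group G]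

instance : NormedRing (GroupCStar G) := inferInstanceAs (NormedRing (Completion (GroupRing G)))
instance : CompleteSpace (GroupCStar G) :=
  inferInstanceAs (CompleteSpace (Completion (GroupRing G)))

/-- The canonical map `ℂ[G] → C*(G)`. -/
def incl : GroupRing G →+* GroupCStar G := Completion.coeRingHom

lemma norm_incl (x : GroupRing G) : ‖incl x‖ = ‖x‖ := Completion.norm_coe x
lemma denseRange_incl : DenseRange (incl : GroupRing G → GroupCStar G) :=
  Completion.denseRange_coe
lemma continuous_incl : Continuous (incl : GroupRing G → GroupCStar G) :=
  Completion.continuous_coe _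

lemma induction_on {P : GroupCStar G → Prop} (x : GroupCStar G) (hp : IsClosed {x | P x})
    (ih : ∀ y, P (incl y)) : P x := Completion.induction_on x hp ih

instance : NormedAlgebra ℂ (GroupCStar G) where
  __ := (inferInstance : Algebra ℂ (Completion (GroupRing G)))
  norm_smul_le := (inferInstance : NormedSpace ℂ (Completion (GroupRing G))).norm_smul_le

lemma smul_incl (c : ℂ) (x : GroupRing G) : c • incl x = incl (c • x) :=
  (Completion.coe_smul c x).symm

instance : Star (GroupCStar G) := ⟨Completion.map star⟩

lemma star_incl (x : GroupRing G) : star (incl x) = incl (star x) :=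
  Completion.map_coe (starₗᵢ ℂ : GroupRing G ≃ₗᵢ⋆[ℂ] GroupRing G).isometry.uniformContinuous x

lemma continuous_starMap : Continuous (star : GroupCStar G → GroupCStar G) :=
  Completion.continuous_map

instance : StarRing (GroupCStar G) where
  star_involutive x := by
    induction x using induction_on with
    | hp => exact isClosed_eq (continuous_starMap.comp continuous_starMap) continuous_id
    | ih x => rw [star_incl, star_incl, star_star]
  star_mul x y := by
    induction x using induction_on with
    | hp =>
      exact isClosed_eq (continuous_starMap.comp (continuous_id.mul continuous_const))
        (continuous_const.mul continuous_starMap)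
    | ih x =>
      induction y using induction_on with
      | hp =>
        exact isClosed_eq (continuous_starMap.comp (continuous_const.mul continuous_id))
          (continuous_starMap.mul continuous_const)
      | ih y => rw [← map_mul, star_incl, star_mul, map_mul, star_incl, star_incl]
  star_add x y := by
    induction x using induction_on with
    | hp =>
      exact isClosed_eq (continuous_starMap.comp (continuous_id.add continuous_const))
        (continuous_starMap.add continuous_const)
    | ih x =>
      induction y using induction_on with
      | hp =>
        exact isClosed_eq (continuous_starMap.comp (continuous_const.add continuous_id))
          (continuous_const.add continuous_starMap)
      | ih y => rw [← map_add, star_incl, star_add, map_add, star_incl, star_incl]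

instance : CStarAlgebra (GroupCStar G) where
  norm_mul_self_le x := by
    induction x using induction_on with
    | hp =>
      exact isClosed_le (continuous_norm.mul continuous_norm)
        (continuous_norm.comp (continuous_starMap.mul continuous_id))
    | ih x =>
      rw [star_incl, ← map_mul, norm_incl, norm_incl]
      exact GroupRing.sq_maxNorm_le x
  star_smul c x := by
    induction x using induction_on with
    | hp =>
      exact isClosed_eq (continuous_starMap.comp (continuous_const_smul c))
        ((continuous_const_smul (star c)).comp continuous_starMap)
    | ih x => rw [smul_incl, star_incl, star_smul, star_incl, smul_incl]

/-- The canonical unitary `g` of `C*(G)`. -/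
def of (g : G) : GroupCStar G := incl (GroupRing.single g 1)

lemma of_mem_unitary (g : G) : of g ∈ unitary (GroupCStar G) := by
  rw [Unitary.mem_iff]
  simp [of, star_incl, ← map_mul, GroupRing.star_single, GroupRing.single_mul_single,
    ← GroupRing.one_def]

/-- The canonical unitary representation of `G` in `C*(G)`. -/
def ofHom : G →* unitary (GroupCStar G) where
  toFun g := ⟨of g, of_mem_unitary g⟩
  map_one' := Subtype.ext (map_one incl)
  map_mul' g h := Subtype.ext (by
    simp [of, ← map_mul, GroupRing.single_mul_single])

variable {B : Type*} [CStarAlgebra B]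

/-- The homomorphism of `ℂ[G]` given by a unitary representation of `G`. -/
def liftRing (u : G →* unitary B) : GroupRing G →ₐ[ℂ] B :=
  MonoidAlgebra.lift ℂ B G ((unitary B).subtype.comp u)

lemma liftRing_single (u : G →* unitary B) (g : G) (a : ℂ) :
    liftRing u (GroupRing.single g a) = a • (u g : B) :=
  MonoidAlgebra.lift_single _ _ _

lemma liftRing_star (u : G →* unitary B) (x : GroupRing G) :
    liftRing u (star x) = star (liftRing u x) := by
  induction x using GroupRing.induction_linear with
  | zero => simp
  | add x y hx hy => rw [star_add, map_add, hx, hy, map_add, star_add]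
  | single g a =>
    rw [GroupRing.star_single, liftRing_single, liftRing_single, star_smul, map_inv,
      ← Unitary.star_eq_inv]
    rfl

lemma norm_liftRing_le (u : G →* unitary B) (x : GroupRing G) : ‖liftRing u x‖ ≤ ‖x‖ := by
  have h : GroupRing.IsCStarSeminorm
      ((normSeminorm ℂ B).comp (liftRing u).toLinearMap) :=
    ⟨fun x y => by simpa using norm_mul_le _ _, fun x => by
      simp [liftRing_star, CStarRing.norm_star_mul_self, sq]⟩
  exact GroupRing.le_maxNorm h x

lemma uniformContinuous_liftRing (u : G →* unitary B) : UniformContinuous (liftRing u) :=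
  (AddMonoidHomClass.lipschitz_of_bound (liftRing u) 1 fun x => by
    simpa using norm_liftRing_le u x).uniformContinuous

lemma continuous_extension (u : G →* unitary B) :
    Continuous (Completion.extension (liftRing u) : GroupCStar G → B) :=
  Completion.continuous_extension

lemma extension_incl (u : G →* unitary B) (x : GroupRing G) :
    (Completion.extension (liftRing u) : GroupCStar G → B) (incl x) = liftRing u x :=
  Completion.extension_coe (uniformContinuous_liftRing u) x

/-- The extension of a unitary representation of `G` to `C*(G)`. -/
def lift (u : G →* unitary B) : GroupCStar G →⋆ₐ[ℂ] B where
  toFun := Completion.extension (liftRing u)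
  map_one' := (extension_incl u 1).trans (map_one _)
  map_zero' := (extension_incl u 0).trans (map_zero _)
  map_mul' x y := by
    have hc := continuous_extension u
    induction x using induction_on with
    | hp =>
      exact isClosed_eq (hc.comp (continuous_id.mul continuous_const)) (hc.mul continuous_const)
    | ih x =>
      induction y using induction_on with
      | hp =>
        exact isClosed_eq (hc.comp (continuous_const.mul continuous_id)) (continuous_const.mul hc)
      | ih y => rw [← map_mul, extension_incl, extension_incl, extension_incl, map_mul]
  map_add' x y := by
    have hc := continuous_extension u
    induction x using induction_on with
    | hp =>
      exact isClosed_eq (hc.comp (continuous_id.add continuous_const)) (hc.add continuous_const)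
    | ih x =>
      induction y using induction_on with
      | hp =>
        exact isClosed_eq (hc.comp (continuous_const.add continuous_id)) (continuous_const.add hc)
      | ih y => rw [← map_add, extension_incl, extension_incl, extension_incl, map_add]
  commutes' c := by
    rw [Algebra.algebraMap_eq_smul_one, Algebra.algebraMap_eq_smul_one,
      ← map_one (incl (G := G)), smul_incl, extension_incl, map_smul, map_one]
  map_star' x := by
    have hc := continuous_extension u
    induction x using induction_on with
    | hp => exact isClosed_eq (hc.comp continuous_starMap) hc.star
    | ih x => rw [star_incl, extension_incl, extension_incl, liftRing_star]

/-- Functoriality of the group C*-algebra. -/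
def map {G' : Type*} [Group G'] (φ : G →* G') : GroupCStar G →⋆ₐ[ℂ] GroupCStar G' :=
  lift (ofHom.comp φ)

end GroupCStar

/-! ### Affine smearing simplices and chains -/

/-- The standard simplex `{t | tᵢ ≥ 0, ∑ tᵢ ≤ 1}` of `ℝⁿ`. -/
def standardSimplex (n : ℕ) : Set (Fin n → ℝ) := {t | (∀ i, 0 ≤ t i) ∧ ∑ i, t i ≤ 1}

lemma isCompact_standardSimplex (n : ℕ) : IsCompact (standardSimplex n) := by
  refine IsCompact.of_isClosed_subset (isCompact_Icc (a := (0 : Fin n → ℝ)) (b := 1)) ?_ ?_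
  · refine IsClosed.inter ?_ (isClosed_le
      (continuous_finsetSum _ fun i _ => continuous_apply i) continuous_const)
    exact isClosed_Ici (a := (0 : Fin n → ℝ))
  · rintro t ⟨h1, h2⟩
    exact ⟨h1, fun i => (Finset.single_le_sum (fun j _ => h1 j) (Finset.mem_univ i)).trans h2⟩

instance (n : ℕ) : IsFiniteMeasure ((volume : Measure (Fin n → ℝ)).restrict (standardSimplex n)) :=
  ⟨by rw [Measure.restrict_apply_univ]; exact (isCompact_standardSimplex n).measure_lt_top⟩

/-- An affine smearing `n`-simplex `(s₀, …, sₙ; f)`: its vertices and its smearing function `f`,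
a real Schwartz function whose support contains `0`. -/
@[ext]
structure Simplex (n : ℕ) where
  /-- the vertices `s₀, …, sₙ` -/
  vertex : Fin (n + 1) → Spacetime
  /-- the smearing function -/
  smearing : TestFunction
  zero_mem : (0 : Spacetime) ∈ tsupport smearing

/-- Smearing `0`-simplices `a = (a₀; f)`. -/
abbrev Point : Type := Simplex 0
/-- Affine smearing `1`-simplices `b = (b₀, b₁; f)`. -/
abbrev Edge : Type := Simplex 1
/-- Affine smearing `2`-simplices `c = (c₀, c₁, c₂; f)`. -/
abbrev Triangle : Type := Simplex 2

namespace Simplex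

variable {n : ℕ}

/-- The affine map `t ↦ s₀ + ∑ tᵢ (sᵢ - s₀)`. -/
def param (s : Simplex n) (t : Fin n → ℝ) : Spacetime :=
  s.vertex 0 + ∑ i, t i • (s.vertex i.succ - s.vertex 0)

lemma continuous_param (s : Simplex n) : Continuous s.param := by
  unfold param; fun_prop

lemma exists_param_bound (s : Simplex n) :
    ∃ R, ∀ᵐ t ∂(volume : Measure (Fin n → ℝ)).restrict (standardSimplex n), ‖s.param t‖ ≤ R := by
  obtain ⟨R, hR⟩ :=
    (isCompact_standardSimplex n).exists_bound_of_continuousOn s.continuous_param.continuousOn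
  exact ⟨R, (ae_restrict_mem (isCompact_standardSimplex n).measurableSet).mono hR⟩

/-- The test function `x ↦ ∫_{Δₙ} f(x - s(t)) dⁿt`. -/
def smear (s : Simplex n) : TestFunction :=
  average _ s.continuous_param.measurable s.exists_param_bound.choose_spec s.smearing

lemma smear_apply (s : Simplex n) (x : Spacetime) :
    s.smear x = ∫ t in standardSimplex n, s.smearing (x - s.param t) := rfl

/-- The Jacobian `det (∂ s^{αᵢ} / ∂tⱼ)`; it is constant, `s` being affine. For `n = 1` this is
`(b₁ - b₀)^α`, and for `n = 2` it is `∂₁σ^μ ∂₂σ^ν - ∂₂σ^μ ∂₁σ^ν`. -/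
def jacobian (s : Simplex n) (α : Fin n → Fin 4) : ℝ :=
  Matrix.det (Matrix.of fun i j : Fin n => (s.vertex j.succ - s.vertex 0) (α i))

/-- The components `x ↦ ∫_{Δₙ} f(x - s(t)) s^{α₁…αₙ}(t) dⁿt` of the form associated with the
smearing simplex `s`. -/
def form (s : Simplex n) (α : Fin n → Fin 4) : TestFunction := s.jacobian α • s.smear

/-- The support `|s|` of a smearing simplex, i.e. the support of its form. -/
def support (s : Simplex n) : Set Spacetime := closure {x | ∃ α, s.form α x ≠ 0}

/-- A simplex is degenerate if two of its vertices coincide. -/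
def IsDegenerate (s : Simplex n) : Prop := ¬ Function.Injective s.vertex

/-- The face `∂ᵢs`, omitting the vertex `sᵢ`. -/
def face (i : Fin (n + 2)) (s : Simplex (n + 1)) : Simplex n :=
  ⟨s.vertex ∘ i.succAbove, s.smearing, s.zero_mem⟩

/-- The cone `h^a(s) = (a₀, s₀, …, sₙ; f)` over an affine simplex. -/
def cone (a : Point) (s : Simplex n) : Simplex (n + 1) :=
  ⟨Fin.cons (a.vertex 0) s.vertex, s.smearing, s.zero_mem⟩

/-- The action `(P s, f_L)` of the Poincaré group. -/
instance : SMul Poincare (Simplex n) :=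
  ⟨fun P s => ⟨fun i => P • s.vertex i, transform P.linearPart s.smearing, by
    rw [tsupport_transform]
    exact ⟨0, s.zero_mem, P.linearPart_smul_zero⟩⟩⟩

@[simp] lemma smul_vertex (P : Poincare) (s : Simplex n) (i : Fin (n + 1)) :
    (P • s).vertex i = P • s.vertex i := rfl
@[simp] lemma smul_smearing (P : Poincare) (s : Simplex n) :
    (P • s).smearing = transform P.linearPart s.smearing := rfl

instance : MulAction Poincare (Simplex n) where
  one_smul s := by
    ext1
    · funext i; simp
    · simp [Poincare.linearPart_one, transform_one]
  mul_smul P Q s := by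
    ext1
    · funext i; simp [mul_smul]
    · simp [Poincare.linearPart_mul, transform_mul]

lemma smul_face (P : Poincare) (i : Fin (n + 2)) (s : Simplex (n + 1)) :
    P • s.face i = (P • s).face i := rfl

lemma isDegenerate_smul (P : Poincare) (s : Simplex n) :
    (P • s).IsDegenerate ↔ s.IsDegenerate :=
  not_congr ((MulAction.injective P).of_comp_iff s.vertex)

lemma smul_param (P : Poincare) (s : Simplex n) (t : Fin n → ℝ) :
    (P • s).param t = P • s.param t := by
  simp only [param, smul_vertex, Poincare.smul_sub_smul]
  simp only [Poincare.smul_def, Matrix.mulVec_add, Matrix.mulVec_sum, Matrix.mulVec_smul, add_assoc]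

lemma smear_smul (P : Poincare) (s : Simplex n) (x : Spacetime) :
    (P • s).smear (P • x) = s.smear x := by
  rw [smear_apply, smear_apply]
  congr 1
  funext t
  have h : P • x - P • s.param t = P.linearPart • (x - s.param t) := by
    rw [Poincare.smul_sub_smul]
    simp [Poincare.smul_def, Poincare.linearPart]
  rw [smul_smearing, transform_apply, smul_param, h, inv_smul_smul]

end Simplex

/-- The opposite `(b₁, b₀; f)` of a `1`-simplex. -/
def Edge.opposite (b : Edge) : Edge := ⟨![b.vertex 1, b.vertex 0], b.smearing, b.zero_mem⟩

/-- The opposite `(c₀, c₂, c₁; f)` of a `2`-simplex. -/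
def Triangle.opposite (c : Triangle) : Triangle :=
  ⟨![c.vertex 0, c.vertex 2, c.vertex 1], c.smearing, c.zero_mem⟩

/-- The trivial loop `e_a = (a₀, a₀; f)`. -/
def Point.trivialLoop (a : Point) : Edge :=
  ⟨![a.vertex 0, a.vertex 0], a.smearing, a.zero_mem⟩

lemma smul_opposite (P : Poincare) (b : Edge) : P • b.opposite = (P • b).opposite := by
  ext1
  · funext i; fin_cases i <;> rfl
  · rfl

lemma smul_trivialLoop (P : Poincare) (a : Point) : P • a.trivialLoop = (P • a).trivialLoop := by
  ext1
  · funext i; fin_cases i <;> rfl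
  · rfl

lemma Edge.exists_jacobian_ne_zero (b : Edge) :
    (∃ α, b.jacobian α ≠ 0) ↔ b.vertex 0 ≠ b.vertex 1 := by
  simp only [Simplex.jacobian, Matrix.det_unique, Matrix.of_apply]
  constructor
  · rintro ⟨α, h⟩ h'
    exact h (by simp [h'])
  · intro h
    obtain ⟨i, hi⟩ := Function.ne_iff.1 h
    exact ⟨fun _ => i, fun h' => hi (sub_eq_zero.1 h').symm⟩

lemma Edge.smul_mem_support (P : Poincare) (b : Edge) {x : Spacetime} (hx : x ∈ b.support) :
    P • x ∈ (P • b).support := by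
  have h : {x | ∃ α, b.form α x ≠ 0} ⊆ (P • ·) ⁻¹' {x | ∃ α, (P • b).form α x ≠ 0} := by
    rintro y ⟨α, hy⟩
    have hy' : b.jacobian α * b.smear y ≠ 0 := hy
    obtain ⟨β, hβ⟩ := (P • b).exists_jacobian_ne_zero.2 (by
      simpa using b.exists_jacobian_ne_zero.1 ⟨α, left_ne_zero_of_mul hy'⟩)
    refine ⟨β, ?_⟩
    change (P • b).jacobian β * (P • b).smear (P • y) ≠ 0
    rw [Simplex.smear_smul]
    exact mul_ne_zero hβ (right_ne_zero_of_mul hy')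
  exact map_mem_closure P.continuous_smul hx h

/-- Smearing chains: finite formal integer combinations of smearing simplices. -/
abbrev Chain (n : ℕ) : Type := Simplex n →₀ ℤ

namespace Chain

variable {n : ℕ}

/-- The form associated with a smearing chain. -/
def form (φ : Chain n) (α : Fin n → Fin 4) : TestFunction := φ.sum fun s m => m • s.form α

/-- The support of a smearing chain, i.e. the support of its form. -/
def support (φ : Chain n) : Set Spacetime := closure {x | ∃ α, φ.form α x ≠ 0}

/-- The cone construction, extended linearly to chains. -/
def cone (a : Point) (φ : Chain n) : Chain (n + 1) := Finsupp.mapDomain (Simplex.cone a) φ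

end Chain

/-- The boundary `∑ᵢ (-1)ⁱ ∂ᵢs`. -/
def Simplex.boundary {n : ℕ} (s : Simplex (n + 1)) : Chain n :=
  ∑ i : Fin (n + 2), Finsupp.single (s.face i) ((-1) ^ (i : ℕ))

/-! ### The net of causal loops -/

/-- The relations `b b̄ = 1` and `e_a = 1`. -/
def edgeRelations : Set (FreeGroup Edge) :=
  {r | ∃ b : Edge, r = FreeGroup.of b * FreeGroup.of b.opposite} ∪
    {r | ∃ a : Point, r = FreeGroup.of a.trivialLoop}

/-- The group `F` generated by the `1`-simplices with the relations `b b̄ = 1`, `e_a = 1`. -/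
abbrev EdgeGroup : Type := PresentedGroup edgeRelations

/-- The element `bₙ ⋯ b₁` of `F` given by the word `[bₙ, …, b₁]`. -/
def wordClass (w : List Edge) : EdgeGroup := (w.map (PresentedGroup.of (rels := edgeRelations))).prod

/-- Reduced words: neither degenerate letters nor consecutive letters `b b̄` occur. -/
def IsReduced (w : List Edge) : Prop :=
  (∀ b ∈ w, ¬ b.IsDegenerate) ∧ w.IsChain fun b b' => b' ≠ b.opposite

/-- The support `|g|` of `g ∈ F`: the union of the supports of the letters of the reduced word that
represents `g`. -/
def wordSupport (g : EdgeGroup) : Set Spacetime :=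
  {x | ∃ w, IsReduced w ∧ wordClass w = g ∧ ∃ b ∈ w, x ∈ b.support}

/-- The word `[bₙ, …, b₁]` is a path from `a` to `a'`: `∂₁b₁ = a`, `∂₁bᵢ₊₁ = ∂₀bᵢ`, `∂₀bₙ = a'`
(the empty word being a path from `a` to `a`). -/
def IsPath : List Edge → Point → Point → Prop
  | [], a, a' => a = a'
  | b :: w, a, a' => b.face 0 = a' ∧ IsPath w a (b.face 1)

lemma IsPath.smul (P : Poincare) : ∀ {w : List Edge} {a a' : Point}, IsPath w a a' →
    IsPath (w.map (P • ·)) (P • a) (P • a')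
  | [], _, _, h => congrArg (P • ·) h
  | _ :: _, _, _, h => ⟨congrArg (P • ·) h.1, IsPath.smul P h.2⟩

lemma IsReduced.smul (P : Poincare) {w : List Edge} (h : IsReduced w) :
    IsReduced (w.map (P • ·)) := by
  refine ⟨?_, ?_⟩
  · simp only [List.mem_map]
    rintro _ ⟨b, hb, rfl⟩
    rw [Simplex.isDegenerate_smul]
    exact h.1 b hb
  · rw [List.isChain_map]
    refine h.2.imp fun b b' hb => ?_
    rw [← smul_opposite]
    exact fun e => hb (MulAction.injective P e)

/-- The action of the Poincaré group on `F`. -/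
def edgeAction (P : Poincare) : EdgeGroup →* EdgeGroup :=
  PresentedGroup.toGroup (f := fun b : Edge => PresentedGroup.of (rels := edgeRelations) (P • b)) (by
    rintro r (⟨b, rfl⟩ | ⟨a, rfl⟩)
    · rw [map_mul, FreeGroup.lift_apply_of, FreeGroup.lift_apply_of, smul_opposite]
      exact PresentedGroup.one_of_mem (Or.inl ⟨P • b, rfl⟩)
    · rw [FreeGroup.lift_apply_of, smul_trivialLoop]
      exact PresentedGroup.one_of_mem (Or.inr ⟨P • a, rfl⟩))

lemma edgeAction_of (P : Poincare) (b : Edge) :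
    edgeAction P (PresentedGroup.of b) = PresentedGroup.of (P • b) :=
  PresentedGroup.toGroup.of _

lemma edgeAction_wordClass (P : Poincare) (w : List Edge) :
    edgeAction P (wordClass w) = wordClass (w.map (P • ·)) := by
  simp only [wordClass, map_list_prod, List.map_map]
  congr 2

lemma edgeAction_inv (P : Poincare) (g : EdgeGroup) : edgeAction P⁻¹ (edgeAction P g) = g := by
  have h : (edgeAction P⁻¹).comp (edgeAction P) = MonoidHom.id _ :=
    PresentedGroup.ext fun b => by simp [edgeAction_of]
  exact DFunLike.congr_fun h g

lemma wordSupport_edgeAction (P : Poincare) (g : EdgeGroup) :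
    wordSupport (edgeAction P g) ⊆ (P • ·) '' wordSupport g := by
  rintro x ⟨w, hw, hg, b, hb, hx⟩
  refine ⟨P⁻¹ • x, ⟨w.map (P⁻¹ • ·), hw.smul P⁻¹, ?_, P⁻¹ • b, List.mem_map_of_mem hb,
    Edge.smul_mem_support P⁻¹ b hx⟩, smul_inv_smul P x⟩
  rw [← edgeAction_wordClass, hg, edgeAction_inv]

/-- The group of loops: the subgroup of `F` generated by the loops. -/
def loopGroup : Subgroup EdgeGroup :=
  Subgroup.closure {g | ∃ a w, IsPath w a a ∧ wordClass w = g}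

lemma wordClass_mem_loopGroup {a : Point} {w : List Edge} (h : IsPath w a a) :
    wordClass w ∈ loopGroup :=
  Subgroup.subset_closure ⟨a, w, h, rfl⟩

lemma loopGroup_le_comap (P : Poincare) : loopGroup ≤ loopGroup.comap (edgeAction P) := by
  refine (Subgroup.closure_le _).2 ?_
  rintro _ ⟨a, w, h, rfl⟩
  change edgeAction P (wordClass w) ∈ loopGroup
  rw [edgeAction_wordClass]
  exact wordClass_mem_loopGroup (h.smul P)

/-- The action of the Poincaré group on the group of loops. -/
def loopAction (P : Poincare) : loopGroup →* loopGroup :=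
  ((edgeAction P).comp loopGroup.subtype).codRestrict loopGroup fun g => loopGroup_le_comap P g.2

/-- `L_o`: the elements of the group of loops whose support is contained in `o`. -/
def localLoops (o : Set Spacetime) : Set loopGroup := {g | wordSupport (g : EdgeGroup) ⊆ o}

lemma loopAction_mem_localLoops (P : Poincare) {o : Set Spacetime} {g : loopGroup}
    (h : g ∈ localLoops o) : loopAction P g ∈ localLoops ((P • ·) '' o) :=
  (wordSupport_edgeAction P g).trans (Set.image_mono h)

/-- The commutators of elements of `L_{o₁}` and `L_{o₂}`, for causally disjoint double cones
`o₁`, `o₂`. -/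
def causalRelations : Set loopGroup :=
  {r | ∃ o₁ o₂, IsDoubleCone o₁ ∧ IsDoubleCone o₂ ∧ CausallyDisjoint o₁ o₂ ∧
    ∃ g₁ ∈ localLoops o₁, ∃ g₂ ∈ localLoops o₂, r = g₁ * g₂ * g₁⁻¹ * g₂⁻¹}

/-- The group of causal loops. -/
abbrev CausalLoopGroup : Type := loopGroup ⧸ Subgroup.normalClosure causalRelations

lemma causalRelations_le_comap (P : Poincare) : Subgroup.normalClosure causalRelations ≤
    (Subgroup.normalClosure causalRelations).comap (loopAction P) := by
  refine Subgroup.normalClosure_le_normal ?_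
  rintro _ ⟨o₁, o₂, h₁, h₂, h, g₁, hg₁, g₂, hg₂, rfl⟩
  change loopAction P (g₁ * g₂ * g₁⁻¹ * g₂⁻¹) ∈ Subgroup.normalClosure causalRelations
  rw [map_mul, map_mul, map_mul, map_inv, map_inv]
  exact Subgroup.subset_normalClosure ⟨_, _, h₁.image P, h₂.image P, h.image P, _,
    loopAction_mem_localLoops P hg₁, _, loopAction_mem_localLoops P hg₂, rfl⟩

/-- The action `β` of the Poincaré group on the group of causal loops. -/
def causalLoopAction (P : Poincare) : CausalLoopGroup →* CausalLoopGroup :=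
  QuotientGroup.map _ _ (loopAction P) (causalRelations_le_comap P)

/-- The class of a loop in the group of causal loops. -/
def loopClass {a : Point} {w : List Edge} (h : IsPath w a a) : CausalLoopGroup :=
  QuotientGroup.mk ⟨wordClass w, wordClass_mem_loopGroup h⟩

/-- The C*-algebra `A(ℝ⁴)` of the net of causal loops. -/
abbrev LoopAlgebra : Type := GroupCStar CausalLoopGroup

/-- The subgroup of the group of causal loops generated by the image of `L_o`. -/
def localLoopGroup (o : Set Spacetime) : Subgroup CausalLoopGroup :=
  Subgroup.closure (QuotientGroup.mk '' localLoops o)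

/-- The net `o ↦ A_o` of causal loops: `A_o` is the image of the C*-algebra of the local group
in `A(ℝ⁴)`. -/
def localAlgebra (o : Set Spacetime) : StarSubalgebra ℂ LoopAlgebra :=
  (GroupCStar.map (localLoopGroup o).subtype).range

/-- The action `α` of the Poincaré group on `A(ℝ⁴)`. -/
def loopAlgebraAction (P : Poincare) : LoopAlgebra →⋆ₐ[ℂ] LoopAlgebra :=
  GroupCStar.map (causalLoopAction P)

/-! ### Representations and 2-cochains -/

section Representations

variable {H : Type*} [NormedAddCommGroup H] [InnerProductSpace ℂ H] [CompleteSpace H]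

/-- `(π, U)` is a covariant representation of the net of causal loops: `ad_{U(P)} ∘ π = π ∘ α_P`.
(The representation `π` is unital, hence non-degenerate.) -/
def IsCovariantRepresentation (π : LoopAlgebra →⋆ₐ[ℂ] (H →L[ℂ] H))
    (U : Poincare →* unitary (H →L[ℂ] H)) : Prop :=
  ∀ P A, (U P : H →L[ℂ] H) * π A * star (U P : H →L[ℂ] H) = π (loopAlgebraAction P A)

/-- `(w, U)` is a causal and covariant 2-cochain. -/
structure IsCausalCovariantCochain (w : Triangle → unitary (H →L[ℂ] H))
    (U : Poincare →* unitary (H →L[ℂ] H)) : Prop where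
  star_eq : ∀ c, star (w c) = w c.opposite
  degenerate : ∀ c : Triangle, c.IsDegenerate → w c = 1
  causal : ∀ c₁ c₂ : Triangle, CausallyDisjoint c₁.support c₂.support → Commute (w c₁) (w c₂)
  covariant : ∀ (P : Poincare) (c : Triangle), U P * w c * star (U P) = w (P • c)

/-- `V` is the strongly continuous one-parameter unitary group `V(t) = exp(itA)` generated by the
operator `A`: the derivative of `t ↦ V(t)ψ` at `0` exists iff `ψ` is in the domain of `A`, and it is
then `iAψ`. -/
structure IsUnitaryGroupOf (A : H →ₗ.[ℂ] H) (V : ℝ → unitary (H →L[ℂ] H)) : Prop where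
  map_add : ∀ s t, V (s + t) = V s * V t
  continuous : ∀ ψ : H, Continuous fun t => (V t : H →L[ℂ] H) ψ
  generator : ∀ ψ φ : H, (ψ, φ) ∈ A.graph ↔
    HasDerivAt (fun t : ℝ => (V t : H →L[ℂ] H) ψ) (Complex.I • φ) 0

/-- `W = exp(iA)`. -/
def IsExpI (A : H →ₗ.[ℂ] H) (W : unitary (H →L[ℂ] H)) : Prop :=
  ∃ V, IsUnitaryGroupOf A V ∧ V 1 = W

open Classical in
/-- The unitary `exp(iA)` of a self-adjoint operator `A` (and `1` if `A` does not generate a unitary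
group). -/
def expI (A : H →ₗ.[ℂ] H) : unitary (H →L[ℂ] H) :=
  if h : ∃ W, IsExpI A W then h.choose else 1

/-- Essential self-adjointness: a densely defined operator with self-adjoint closure. -/
def IsEssentiallySelfAdjoint (A : H →ₗ.[ℂ] H) : Prop :=
  Dense (A.domain : Set H) ∧ IsSelfAdjoint A.closure

/-- An operator of the subspace `D` into itself, as an unbounded operator with domain `D`. -/
def unbounded {D : Submodule ℂ H} (A : D →ₗ[ℂ] D) : H →ₗ.[ℂ] H := ⟨D, D.subtype ∘ₗ A⟩

end Representations

/-! ### The quantum electromagnetic field -/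

/-- The partial derivative `∂_α f`. -/
def partialDeriv (α : Fin 4) (f : TestFunction) : TestFunction :=
  LineDeriv.lineDerivOp (Pi.single α (1 : ℝ) : Spacetime) f

/-- `L_μ^α = g_{μρ} L^ρ_σ g^{σα}`. -/
def lowered (L : Matrix (Fin 4) (Fin 4) ℝ) (μ α : Fin 4) : ℝ := (metric * L * metric) μ α

open scoped InnerProductSpace in
/-- The quantum electromagnetic field on the Hilbert space `H`. -/
structure QuantumEMField (H : Type*) [NormedAddCommGroup H] [InnerProductSpace ℂ H]
    [CompleteSpace H] where
  /-- the unitary representation of the Poincaré group -/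
  U : Poincare →* unitary (H →L[ℂ] H)
  /-- the translations are strongly continuous -/
  continuous_translation : ∀ ψ : H,
    Continuous fun a : Spacetime => (U (Poincare.translation a) : H →L[ℂ] H) ψ
  /-- the spectrum condition: the generators of the translations in the directions of the closed
  forward light cone are positive; as that cone is self-dual, this says that the joint spectrum of
  the generators `p` in `U(a) = exp(i a·p)` lies in the closed forward light cone -/
  spectrum_condition : ∀ e ∈ closedForwardCone, ∀ ψ φ : H,
    HasDerivAt (fun t : ℝ => (U (Poincare.translation (t • e)) : H →L[ℂ] H) ψ)
      (Complex.I • φ) 0 → 0 ≤ (⟪ψ, φ⟫_ℂ).re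
  /-- the domain of the field -/
  D : Submodule ℂ H
  dense_D : Dense (D : Set H)
  U_mem : ∀ P, ∀ ψ ∈ D, (U P : H →L[ℂ] H) ψ ∈ D
  /-- existence and uniqueness (up to a factor) of the vacuum -/
  vacuum : ∃ Ω ∈ D, ‖Ω‖ = 1 ∧ ∀ ψ : H, (∀ P, (U P : H →L[ℂ] H) ψ = ψ) ↔ ∃ z : ℂ, ψ = z • Ω
  /-- the components `F_{μν}(f)` of the field, as operators `D → D` -/
  F : Fin 4 → Fin 4 → TestFunction → (D →ₗ[ℂ] D)
  /-- the matrix elements of the field are real-linear continuous functionals of `f` -/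
  tempered : ∀ μ ν (φ ψ : D), ∃ T : TestFunction →L[ℝ] ℂ, ∀ f, T f = ⟪(φ : H), (F μ ν f ψ : H)⟫_ℂ
  essentiallySelfAdjoint : ∀ μ ν f, IsEssentiallySelfAdjoint (unbounded (F μ ν f))
  /-- essential self-adjointness of the contractions with 1-tensors -/
  essentiallySelfAdjoint₁ : ∀ μ (h : Fin 4 → TestFunction),
    IsEssentiallySelfAdjoint (unbounded (∑ ν, F μ ν (h ν)))
  /-- essential self-adjointness of the contractions with 2-tensors -/
  essentiallySelfAdjoint₂ : ∀ h : Fin 4 → Fin 4 → TestFunction,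
    IsEssentiallySelfAdjoint (unbounded (∑ μ, ∑ ν, F μ ν (h μ ν)))
  /-- `U(P) F_{μν}(f) U(P)* = (L⁻¹)_μ^α (L⁻¹)_ν^β F_{αβ}(f_P)` on `D` -/
  covariance : ∀ (P : Poincare) μ ν f (ψ : D),
    (U P : H →L[ℂ] H) (F μ ν f ψ) =
      ∑ α, ∑ β, ((lowered P⁻¹.lor μ α * lowered P⁻¹.lor ν β : ℝ) : ℂ) •
        (F α β (transform P f) ⟨(U P : H →L[ℂ] H) ψ, U_mem P ψ ψ.2⟩ : H)
  causality : ∀ μ ν α β (f g : TestFunction), CausallyDisjoint (tsupport f) (tsupport g) →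
    Commute (F μ ν f) (F α β g)
  strong_causality : ∀ μ ν α β (f g : TestFunction), CausallyDisjoint (tsupport f) (tsupport g) →
    Commute (expI (unbounded (F μ ν f)).closure) (expI (unbounded (F α β g)).closure)
  antisymmetric : ∀ μ ν f, F μ ν f = -F ν μ f
  /-- the first Maxwell equation `∂_σ F_{μν} + ∂_μ F_{νσ} + ∂_ν F_{σμ} = 0` -/
  maxwell : ∀ σ μ ν f,
    F μ ν (partialDeriv σ f) + F ν σ (partialDeriv μ f) + F σ μ (partialDeriv ν f) = 0

namespace QuantumEMField

variable {H : Type*} [NormedAddCommGroup H] [InnerProductSpace ℂ H] [CompleteSpace H]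

/-- `F⟨σ_c, f⟩ = ½ F_{μν}(σ_c[f]^{μν})`. -/
def surfaceIntegral (Q : QuantumEMField H) (c : Triangle) : Q.D →ₗ[ℂ] Q.D :=
  (1 / 2 : ℂ) • ∑ μ, ∑ ν, Q.F μ ν (c.form ![μ, ν])

/-- The electromagnetic 2-cochain `w^em(c) = exp(iF⟨σ_c, f⟩)`. -/
def emCochain (Q : QuantumEMField H) (c : Triangle) : unitary (H →L[ℂ] H) :=
  expI (unbounded (Q.surfaceIntegral c)).closure

end QuantumEMField

end

end CausalLoops

open CausalLoops

/-! The analysis rests on one criterion: if A is essentially self-adjoint on D, then (x, y) lies in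
the graph of its closure as soon as ⟨Aχ, x⟩ = ⟨χ, y⟩ for all χ in D (`mem_graph_closure`). Stone's
theorem, obtained by Yosida approximation (`isUnitaryGroupOf_stoneGroup`), supplies exp(iA), and
`IsUnitaryGroupOf.intertwine` makes it unique. If a bounded T commutes with the unitary groups of
several A_i, then T maps D into the domain of each closure, hence, by the criterion, into that of
the closure of ∑ A_i, and T commutes with exp(i ∑ A_i) (`commute_expI_sum`). So strong causality
passes from single components to contractions F_{μν}(h^{μν}) (`commute_contraction`). The remaining
cochain properties express how the forms behave under reversal, degeneration and Poincaré
transformations.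

For the representation the difficulty is that the prescription p ↦ ∏ w(h^a(bᵢ)) uses a base point
that varies with the loop, and no cocycle identity is available. `IsHolonomy.transportHom` lets the
whole group F act by permutations on the states of an automaton that reads edges, remembers the base
point and the current end of an open path, and accumulates the factors. Loops return the closed
state `none` to itself, which yields `IsHolonomy.loopHom`. Cones over edges that start or end at the
apex are degenerate, so opening and closing a path costs no factor.

For this homomorphism to respect the causal relations, an element supported in a double cone o must
be sent to a product of operators localized in o. Two facts give this. An element of the group of
loops has a reduced word that is a concatenation of loops (`exists_isLoopProduct`). And a
nondegenerate edge supported in o forces supp f + bᵢ ⊆ o (`Edge.add_vertex_mem`), even if f changes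
sign. Hence all the cones h^a(b) over the edges of these loops are supported in o. The universal
property of the group C*-algebra then gives π; covariance and uniqueness are checked on loops.

The last assertion is Stokes plus Maxwell. The form of the boundary of a 3-simplex is minus the
divergence of its 3-form (`Simplex.form_boundary`), which the first Maxwell equation annihilates
(`QuantumEMField.contraction_boundary`). As h^a(∂c) = c − ∂h^a(c), the operator F⟨σ_c, f⟩ is also
the contraction with the form of h^a(∂c), and causality of contractions applies. -/

namespace CausalLoops
open scoped ComplexConjugate SchwartzMap ContDiff
open MeasureTheory UniformSpace
noncomputable section

/-! ### Graphs of self-adjoint operators and uniqueness of their unitary groups -/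

section UnboundedOperators

open scoped InnerProductSpace
open Filter Topology

variable {H : Type*} [NormedAddCommGroup H] [InnerProductSpace ℂ H] [CompleteSpace H]

lemma mem_graph_iff_of_isSelfAdjoint {A : H →ₗ.[ℂ] H} (hA : IsSelfAdjoint A) {x y : H} :
    (x, y) ∈ A.graph ↔ ∀ p ∈ A.graph, ⟪p.2, x⟫_ℂ = ⟪p.1, y⟫_ℂ := by
  have h := LinearPMap.adjoint_graph_eq_graph_adjoint hA.dense_domain
  rw [LinearPMap.isSelfAdjoint_def.1 hA] at h
  have h' : (x, y) ∈ A.graph ↔ (x, y) ∈ A.graph.adjoint := by rw [← h]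
  rw [h', Submodule.mem_adjoint_iff]
  constructor
  · rintro h ⟨a, b⟩ hp
    exact sub_eq_zero.1 (h a b hp)
  · intro h a b hp
    exact sub_eq_zero.2 (h (a, b) hp)

lemma inner_graph_symm {A : H →ₗ.[ℂ] H} (hA : IsSelfAdjoint A) {p q : H × H}
    (hp : p ∈ A.graph) (hq : q ∈ A.graph) : ⟪p.2, q.1⟫_ℂ = ⟪p.1, q.2⟫_ℂ :=
  (mem_graph_iff_of_isSelfAdjoint hA (x := q.1) (y := q.2)).1 hq p hp

lemma isClosable_of_isEssentiallySelfAdjoint {A : H →ₗ.[ℂ] H} (h : IsEssentiallySelfAdjoint A) :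
    A.IsClosable :=
  (h.2.isClosed.isClosable).leIsClosable A.le_closure

lemma graph_closure_eq {A : H →ₗ.[ℂ] H} (h : IsEssentiallySelfAdjoint A) :
    (A.closure.graph : Set (H × H)) = closure (A.graph : Set (H × H)) := by
  rw [← (isClosable_of_isEssentiallySelfAdjoint h).graph_closure_eq_closure_graph]
  rfl

omit [CompleteSpace H] in
lemma graph_subset_graph_closure (A : H →ₗ.[ℂ] H) {p : H × H} (hp : p ∈ A.graph) :
    p ∈ A.closure.graph :=
  LinearPMap.le_graph_of_le A.le_closure hp

/-- A pair which satisfies the symmetry relation against the graph of an essentially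
self-adjoint operator belongs to the graph of its closure. -/
lemma mem_graph_closure {A : H →ₗ.[ℂ] H} (h : IsEssentiallySelfAdjoint A) {x y : H}
    (hxy : ∀ p ∈ A.graph, ⟪p.2, x⟫_ℂ = ⟪p.1, y⟫_ℂ) : (x, y) ∈ A.closure.graph := by
  rw [mem_graph_iff_of_isSelfAdjoint h.2]
  intro p hp
  have hp' : p ∈ closure (A.graph : Set (H × H)) := by
    rw [← graph_closure_eq h]; exact hp
  have hc : IsClosed {p : H × H | ⟪p.2, x⟫_ℂ = ⟪p.1, y⟫_ℂ} :=
    isClosed_eq (by fun_prop) (by fun_prop)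
  exact closure_minimal (fun q hq => hxy q hq) hc hp'

namespace IsUnitaryGroupOf

variable {A : H →ₗ.[ℂ] H} {V : ℝ → unitary (H →L[ℂ] H)}

lemma map_zero (h : IsUnitaryGroupOf A V) : V 0 = 1 := by
  have := h.map_add 0 0
  rw [add_zero] at this
  exact left_eq_mul.1 this

/-- The group law V(s) = V(t)V(s − t) carries the derivative at 0 to every t. -/
lemma hasDerivAt (h : IsUnitaryGroupOf A V) {ψ φ : H} (hg : (ψ, φ) ∈ A.graph) (t : ℝ) :
    HasDerivAt (fun t : ℝ => (V t : H →L[ℂ] H) ψ)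
      ((V t : H →L[ℂ] H) (Complex.I • φ)) t := by
  have h0 := (h.generator ψ φ).1 hg
  have h1 : HasDerivAt (fun s : ℝ => (V (s - t) : H →L[ℂ] H) ψ) (Complex.I • φ) t := by
    have := HasDerivAt.comp_sub_const (x := t) (a := t) (f := fun t : ℝ => (V t : H →L[ℂ] H) ψ)
      (f' := Complex.I • φ) (by rwa [sub_self])
    exact this
  have h2 := ((V t : H →L[ℂ] H).restrictScalars ℝ).hasFDerivAt.comp_hasDerivAt t h1
  refine h2.congr_of_eventuallyEq (Eventually.of_forall fun s => ?_)
  have := h.map_add t (s - t)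
  rw [add_sub_cancel] at this
  change (V s : H →L[ℂ] H) ψ = _
  rw [this]; rfl

lemma mem_graph_apply (h : IsUnitaryGroupOf A V) {ψ φ : H} (hg : (ψ, φ) ∈ A.graph) (t : ℝ) :
    ((V t : H →L[ℂ] H) ψ, (V t : H →L[ℂ] H) φ) ∈ A.graph := by
  rw [h.generator]
  have h2 := ((V t : H →L[ℂ] H).restrictScalars ℝ).hasFDerivAt.comp_hasDerivAt 0
    ((h.generator ψ φ).1 hg)
  refine (h2.congr_of_eventuallyEq (Eventually.of_forall fun s => ?_)).congr_deriv (by simp)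
  change ((V s * V t : unitary (H →L[ℂ] H)) : H →L[ℂ] H) ψ
    = ((V t * V s : unitary (H →L[ℂ] H)) : H →L[ℂ] H) ψ
  rw [← h.map_add, ← h.map_add, add_comm]

/-- A bounded operator which intertwines two self-adjoint operators intertwines the unitary groups
which they generate. -/
lemma intertwine {A' : H →ₗ.[ℂ] H} {V' : ℝ → unitary (H →L[ℂ] H)} (h : IsUnitaryGroupOf A V)
    (h' : IsUnitaryGroupOf A' V') (hd : Dense (A.domain : Set H)) (T : H →L[ℂ] H)
    (hT : ∀ p ∈ A.graph, (T p.1, T p.2) ∈ A'.graph) (t : ℝ) :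
    T * (V t : H →L[ℂ] H) = (V' t : H →L[ℂ] H) * T := by
  have key : ∀ ψ ∈ A.domain, T ((V t : H →L[ℂ] H) ψ) = (V' t : H →L[ℂ] H) (T ψ) := by
    intro ψ hψ
    obtain ⟨φ, hg⟩ : ∃ φ, (ψ, φ) ∈ A.graph := ⟨A ⟨ψ, hψ⟩, A.mem_graph ⟨ψ, hψ⟩⟩
    -- `x(s) = V'(t - s) T V(s) ψ` is constant
    have hnorm : ∀ s, HasDerivAt (fun s : ℝ => (V' (-s) : H →L[ℂ] H) (T ((V s : H →L[ℂ] H) ψ))) 0 s := by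
      intro s
      rw [hasDerivAt_iff_isLittleO]
      -- The product V'(−u) T V(u)ψ is not differentiated directly. The curves u ↦ T V(u)ψ and u ↦
      -- V'(u − s) T V(s)ψ agree at u = s and have the same velocity there, so they differ by o(u −
      -- s). The isometry V'(−u) preserves this bound and makes the second curve constant.
      have h1 := ((T.restrictScalars ℝ).hasFDerivAt.comp_hasDerivAt s (h.hasDerivAt hg s))
      have h2 := h'.hasDerivAt (hT _ (h.mem_graph_apply hg s)) 0
      have h3 : HasDerivAt (fun u : ℝ => (V' (u - s) : H →L[ℂ] H) (T ((V s : H →L[ℂ] H) ψ)))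
          (Complex.I • (T ((V s : H →L[ℂ] H) φ))) s := by
        have := HasDerivAt.comp_sub_const (x := s) (a := s)
          (f := fun u : ℝ => (V' u : H →L[ℂ] H) (T ((V s : H →L[ℂ] H) ψ)))
          (f' := Complex.I • (T ((V s : H →L[ℂ] H) φ))) (by
            rw [sub_self]; exact (h'.generator _ _).1 (hT _ (h.mem_graph_apply hg s)))
        exact this
      have h4 := (h1.sub h3)
      have h5 : (T.restrictScalars ℝ) ((V s : H →L[ℂ] H) (Complex.I • φ))
          - Complex.I • (T ((V s : H →L[ℂ] H) φ)) = 0 := by simp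
      rw [h5, hasDerivAt_iff_isLittleO] at h4
      refine (Asymptotics.IsBigO.of_bound 1 (Eventually.of_forall fun u => ?_)).trans_isLittleO h4
      rw [one_mul]
      simp only [smul_zero, sub_zero, Pi.sub_apply, Function.comp_apply, sub_self]
      have e1 : (V' (-u) : H →L[ℂ] H) ((V' (u - s) : H →L[ℂ] H) (T ((V s : H →L[ℂ] H) ψ)))
          = (V' (-s) : H →L[ℂ] H) (T ((V s : H →L[ℂ] H) ψ)) := by
        have := h'.map_add (-u) (u - s)
        rw [neg_add_eq_sub, sub_sub_cancel_left] at this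
        rw [this]; rfl
      have e2 : (V' 0 : H →L[ℂ] H) (T ((V s : H →L[ℂ] H) ψ)) = T ((V s : H →L[ℂ] H) ψ) := by
        rw [h'.map_zero]; rfl
      rw [← e1, ← map_sub, e2]
      have : ∀ W : unitary (H →L[ℂ] H), ∀ x, ‖(W : H →L[ℂ] H) x‖ = ‖x‖ := fun W x =>
        Unitary.norm_map W x
      rw [this]
      simp
    have hconst := is_const_of_deriv_eq_zero (fun s => (hnorm s).differentiableAt)
      (fun s => (hnorm s).deriv) t 0
    have hV0 : V 0 = 1 := h.map_zero
    have hV0' : V' 0 = 1 := h'.map_zero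
    simp only [neg_zero, hV0, hV0', OneMemClass.coe_one, one_apply_eq_self] at hconst
    rw [← hconst]
    have := h'.map_add t (-t)
    rw [add_neg_cancel, hV0'] at this
    change _ = ((V' t * V' (-t) : unitary (H →L[ℂ] H)) : H →L[ℂ] H) _
    rw [← this]; rfl
  ext ψ
  exact hd.induction (P := fun ψ => T ((V t : H →L[ℂ] H) ψ) = (V' t : H →L[ℂ] H) (T ψ)) key
    (isClosed_eq (by fun_prop) (by fun_prop)) ψ

lemma unique {V' : ℝ → unitary (H →L[ℂ] H)} (h : IsUnitaryGroupOf A V)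
    (h' : IsUnitaryGroupOf A V') (hd : Dense (A.domain : Set H)) (t : ℝ) : V t = V' t :=
  Subtype.ext (by simpa using h.intertwine h' hd 1 (fun p hp => hp) t)

/-- `expI` is defined by choice; uniqueness of the generated group identifies the chosen value with
that of any known group. -/
lemma expI_eq (h : IsUnitaryGroupOf A V) (hd : Dense (A.domain : Set H)) : expI A = V 1 := by
  have hex : ∃ W, IsExpI A W := ⟨V 1, V, h, rfl⟩
  rw [expI, dif_pos hex]
  obtain ⟨V', h', e⟩ := hex.choose_spec
  rw [← e]
  exact h'.unique h hd 1

/-- The unitary group generated by `rA`. -/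
lemma scale {A' : H →ₗ.[ℂ] H} (h : IsUnitaryGroupOf A V) {r : ℝ} (hr : r ≠ 0)
    (hA' : ∀ x y, (x, y) ∈ A.graph ↔ (x, (r : ℂ) • y) ∈ A'.graph) :
    IsUnitaryGroupOf A' fun t => V (r * t) where
  map_add s t := by rw [mul_add, h.map_add]
  continuous ψ := (h.continuous ψ).comp (continuous_const.mul continuous_id)
  generator ψ φ := by
    have hr' : (r : ℂ) ≠ 0 := Complex.ofReal_ne_zero.2 hr
    have e : φ = (r : ℂ) • ((r : ℂ)⁻¹ • φ) := by rw [smul_smul, mul_inv_cancel₀ hr', one_smul]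
    rw [e, ← hA', h.generator]
    constructor
    · intro hd
      have := HasDerivAt.scomp (𝕜 := ℝ) (h := fun t : ℝ => r * t) (h' := r) (x := 0)
        (g₁ := fun t : ℝ => (V t : H →L[ℂ] H) ψ) (g₁' := Complex.I • (r : ℂ)⁻¹ • φ)
        (by rw [mul_zero]; exact hd) (by simpa using (hasDerivAt_id (0 : ℝ)).const_mul r)
      refine this.congr_deriv ?_
      rw [← Complex.coe_smul, smul_comm]
    · intro hd
      have := HasDerivAt.scomp (𝕜 := ℝ) (h := fun t : ℝ => r⁻¹ * t) (h' := r⁻¹) (x := 0)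
        (g₁ := fun t : ℝ => (V (r * t) : H →L[ℂ] H) ψ)
        (by rw [mul_zero]; exact hd) (by simpa using (hasDerivAt_id (0 : ℝ)).const_mul r⁻¹)
      simp only [Function.comp_def, mul_inv_cancel_left₀ hr] at this
      refine this.congr_deriv ?_
      rw [← e, ← Complex.coe_smul, smul_comm, Complex.ofReal_inv]

end IsUnitaryGroupOf

end UnboundedOperators

/-! ### Stone's theorem: bounded exponentials and resolvents -/

section Stone

open scoped InnerProductSpace
open Filter Topology

variable {H : Type*} [NormedAddCommGroup H] [InnerProductSpace ℂ H] [CompleteSpace H]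

/-! ### Exponentials of bounded skew-adjoint operators -/

lemma norm_unitary_apply (W : unitary (H →L[ℂ] H)) (x : H) : ‖(W : H →L[ℂ] H) x‖ = ‖x‖ :=
  Unitary.norm_map W x

/-- `exp(tZ)` for a bounded skew-adjoint operator `Z`. -/
def expSkew (Z : skewAdjoint (H →L[ℂ] H)) (t : ℝ) : unitary (H →L[ℂ] H) :=
  ⟨NormedSpace.exp (t • (Z : H →L[ℂ] H)),
    letI : NormedAlgebra ℚ (H →L[ℂ] H) := .restrictScalars ℚ ℂ _
    NormedSpace.exp_mem_unitary_of_mem_skewAdjoint (skewAdjoint.smul_mem t Z.2)⟩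

lemma hasDerivAt_expSkew (Z : skewAdjoint (H →L[ℂ] H)) (ψ : H) (t : ℝ) :
    HasDerivAt (fun t => (expSkew Z t : H →L[ℂ] H) ψ)
      ((expSkew Z t : H →L[ℂ] H) ((Z : H →L[ℂ] H) ψ)) t := by
  have h := (hasDerivAt_exp_smul_const (𝕂 := ℝ) (Z : H →L[ℂ] H) t)
  exact (((ContinuousLinearMap.apply ℂ H ψ).restrictScalars ℝ).hasFDerivAt.comp_hasDerivAt t h)

lemma expSkew_zero (Z : skewAdjoint (H →L[ℂ] H)) : expSkew Z 0 = 1 :=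
  Subtype.ext (by simp [expSkew])

lemma expSkew_add (Z : skewAdjoint (H →L[ℂ] H)) (s t : ℝ) :
    expSkew Z (s + t) = expSkew Z s * expSkew Z t := by
  let +nondep : NormedAlgebra ℚ (H →L[ℂ] H) := .restrictScalars ℚ ℂ _
  refine Subtype.ext ?_
  change NormedSpace.exp _ = NormedSpace.exp _ * NormedSpace.exp _
  rw [add_smul, NormedSpace.exp_add_of_commute]
  exact ((Commute.refl (Z : H →L[ℂ] H)).smul_left s).smul_right t

lemma norm_expSkew_sub_le (Z : skewAdjoint (H →L[ℂ] H)) (ψ : H) (t : ℝ) :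
    ‖(expSkew Z t : H →L[ℂ] H) ψ - ψ‖ ≤ |t| * ‖(Z : H →L[ℂ] H) ψ‖ := by
  have h := Convex.norm_image_sub_le_of_norm_hasDerivWithin_le (s := Set.univ) (x := (0 : ℝ)) (y := t)
    (fun s _ => (hasDerivAt_expSkew Z ψ s).hasDerivWithinAt)
    (fun s _ => (norm_unitary_apply (expSkew Z s) _).le) convex_univ trivial trivial
  simp only [expSkew_zero, OneMemClass.coe_one, one_apply_eq_self, sub_zero, Real.norm_eq_abs] at h
  rwa [mul_comm]

/-- With η = Zψ, the function exp(sZ)ψ − sη has derivative exp(sZ)η − η. The vector η is replaced by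
a free χ because the bound has to survive a limit of operators Z of growing norm: Zχ stays bounded
there for χ in the domain of the limiting generator, whereas Zη need not. -/
lemma norm_expSkew_sub_sub_le (Z : skewAdjoint (H →L[ℂ] H)) (ψ χ : H) (t : ℝ) :
    ‖(expSkew Z t : H →L[ℂ] H) ψ - ψ - t • (Z : H →L[ℂ] H) ψ‖
      ≤ (2 * ‖(Z : H →L[ℂ] H) ψ - χ‖ + |t| * ‖(Z : H →L[ℂ] H) χ‖) * |t| := by
  set η := (Z : H →L[ℂ] H) ψ
  have hd : ∀ s : ℝ, HasDerivAt (fun s => (expSkew Z s : H →L[ℂ] H) ψ - s • η)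
      ((expSkew Z s : H →L[ℂ] H) η - η) s := fun s =>
    ((hasDerivAt_expSkew Z ψ s).sub ((hasDerivAt_id s).smul_const η)).congr_deriv (by simp [η])
  have hb : ∀ s ∈ Set.uIcc 0 t, ‖(expSkew Z s : H →L[ℂ] H) η - η‖
      ≤ 2 * ‖η - χ‖ + |t| * ‖(Z : H →L[ℂ] H) χ‖ := by
    intro s hs
    have e : (expSkew Z s : H →L[ℂ] H) η - η = (expSkew Z s : H →L[ℂ] H) (η - χ)
        + ((expSkew Z s : H →L[ℂ] H) χ - χ) - (η - χ) := by rw [map_sub]; abel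
    have h1 : |s| ≤ |t| := by
      have := Set.abs_sub_left_of_mem_uIcc hs
      simpa using this
    have h2 := norm_expSkew_sub_le Z χ s
    have h3 := mul_le_mul_of_nonneg_right h1 (norm_nonneg ((Z : H →L[ℂ] H) χ))
    rw [e]
    refine (norm_sub_le _ _).trans ?_
    have h4 := norm_add_le ((expSkew Z s : H →L[ℂ] H) (η - χ)) ((expSkew Z s : H →L[ℂ] H) χ - χ)
    rw [norm_unitary_apply] at h4
    linarith
  have h := Convex.norm_image_sub_le_of_norm_hasDerivWithin_le (s := Set.uIcc 0 t) (x := (0 : ℝ))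
    (y := t) (fun s _ => (hd s).hasDerivWithinAt) hb (convex_uIcc 0 t) Set.left_mem_uIcc
    Set.right_mem_uIcc
  simp only [expSkew_zero, OneMemClass.coe_one, one_apply_eq_self, sub_zero, Real.norm_eq_abs,
    zero_smul] at h
  rwa [sub_right_comm]

/-- For commuting Z and Z' one has exp(tZ) = exp(tZ') exp(t(Z − Z')), and the first factor is an
isometry. Convergence of the generators on a vector thus forces convergence of the exponentials on
it. -/
lemma norm_expSkew_sub_expSkew_le {Z Z' : skewAdjoint (H →L[ℂ] H)}
    (hZ : Commute (Z : H →L[ℂ] H) (Z' : H →L[ℂ] H)) (ψ : H) (t : ℝ) :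
    ‖(expSkew Z t : H →L[ℂ] H) ψ - (expSkew Z' t : H →L[ℂ] H) ψ‖
      ≤ |t| * ‖(Z : H →L[ℂ] H) ψ - (Z' : H →L[ℂ] H) ψ‖ := by
  have e : expSkew Z t = expSkew Z' t * expSkew (Z - Z') t := by
    let +nondep : NormedAlgebra ℚ (H →L[ℂ] H) := .restrictScalars ℚ ℂ _
    refine Subtype.ext ?_
    change NormedSpace.exp _ = NormedSpace.exp _ * NormedSpace.exp _
    rw [← NormedSpace.exp_add_of_commute, ← smul_add]
    · congr 2
      simp
    · have h : Commute (Z' : H →L[ℂ] H) ((Z - Z' : skewAdjoint (H →L[ℂ] H)) : H →L[ℂ] H) := by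
        rw [AddSubgroup.coe_sub]
        exact hZ.symm.sub_right (Commute.refl _)
      exact (h.smul_left t).smul_right t
  have h := norm_expSkew_sub_le (Z - Z') ψ t
  rw [AddSubgroup.coe_sub, sub_apply] at h
  rw [e]
  change ‖(expSkew Z' t : H →L[ℂ] H) ((expSkew (Z - Z') t : H →L[ℂ] H) ψ) - _‖ ≤ _
  rwa [← map_sub, norm_unitary_apply]

/-! ### Limits of contractions -/

omit [CompleteSpace H] in
lemma isClosed_setOf_cauchySeq {T : ℕ → H →L[ℂ] H} (hT : ∀ n x, ‖T n x‖ ≤ ‖x‖) :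
    IsClosed {x | CauchySeq fun n => T n x} := by
  refine isClosed_of_closure_subset fun x hx => Metric.cauchySeq_iff'.2 fun ε hε => ?_
  obtain ⟨y, hy, hxy⟩ := Metric.mem_closure_iff.1 hx (ε / 3) (by positivity)
  obtain ⟨N, hN⟩ := Metric.cauchySeq_iff'.1 hy (ε / 3) (by positivity)
  refine ⟨N, fun n hn => ?_⟩
  have h1 := hN n hn
  have h2 := hT n (x - y)
  have h3 := hT N (x - y)
  rw [map_sub, ← dist_eq_norm, ← dist_eq_norm] at h2 h3
  have h4 := dist_triangle4_right (T n x) (T N x) (T n y) (T N y)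
  linarith

omit [CompleteSpace H] in
lemma isClosed_setOf_tendsto {T : ℕ → H →L[ℂ] H} (hT : ∀ n x, ‖T n x‖ ≤ ‖x‖) :
    IsClosed {x | Tendsto (fun n => T n x) atTop (𝓝 x)} := by
  refine isClosed_of_closure_subset fun x hx => Metric.tendsto_atTop.2 fun ε hε => ?_
  obtain ⟨y, hy, hxy⟩ := Metric.mem_closure_iff.1 hx (ε / 3) (by positivity)
  obtain ⟨N, hN⟩ := Metric.tendsto_atTop.1 hy (ε / 3) (by positivity)
  refine ⟨N, fun n hn => ?_⟩
  have h1 := hN n hn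
  have h2 := hT n (x - y)
  rw [map_sub, ← dist_eq_norm, ← dist_eq_norm] at h2
  have h4 := dist_triangle4_right (T n x) x (T n y) y
  linarith

/-! ### Resolvents -/

variable {A : H →ₗ.[ℂ] H} (hA : IsSelfAdjoint A)

/-- The map `(ψ, φ) ↦ φ + isψ`. -/
def shift (s : ℝ) : H × H →L[ℂ] H :=
  ContinuousLinearMap.snd ℂ H H + (Complex.I * s) • ContinuousLinearMap.fst ℂ H H

omit [CompleteSpace H] in
lemma shift_apply (s : ℝ) (p : H × H) : shift s p = p.2 + (Complex.I * s) • p.1 := rfl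

include hA

/-- The cross term is 2 Re(is⟨φ, ψ⟩), which vanishes because ⟨Aψ, ψ⟩ is real. -/
lemma norm_shift_sq (s : ℝ) {p : H × H} (hp : p ∈ A.graph) :
    ‖shift s p‖ ^ 2 = ‖p.2‖ ^ 2 + s ^ 2 * ‖p.1‖ ^ 2 := by
  have h := inner_graph_symm hA hp hp
  rw [shift_apply, norm_add_sq (𝕜 := ℂ), inner_smul_right, norm_smul]
  have h2 : (⟪p.2, p.1⟫_ℂ).im = 0 := by
    rw [← inner_conj_symm p.1 p.2] at h
    exact Complex.conj_eq_iff_im.1 h.symm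
  simp [h2, mul_pow]

lemma norm_fst_le (s : ℝ) {p : H × H} (hp : p ∈ A.graph) : |s| * ‖p.1‖ ≤ ‖shift s p‖ := by
  refine abs_le_of_sq_le_sq' ?_ (norm_nonneg _) |>.2
  rw [norm_shift_sq hA s hp, mul_pow, sq_abs]
  nlinarith [sq_nonneg ‖p.2‖]

lemma norm_snd_le (s : ℝ) {p : H × H} (hp : p ∈ A.graph) : ‖p.2‖ ≤ ‖shift s p‖ := by
  refine abs_le_of_sq_le_sq' ?_ (norm_nonneg _) |>.2
  rw [norm_shift_sq hA s hp]
  nlinarith [sq_nonneg (s * ‖p.1‖)]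

/-- A + is is bounded below on its closed graph, so it is injective with closed range. A vector
orthogonal to the range would be an eigenvector of A with eigenvalue is, which symmetry excludes. -/
lemma bijective_shift {s : ℝ} (hs : s ≠ 0) :
    Function.Bijective ((shift s : H × H →L[ℂ] H).toLinearMap ∘ₗ A.graph.subtype) := by
  have hs' : 0 < |s| := abs_pos.2 hs
  constructor
  · rw [← LinearMap.ker_eq_bot, LinearMap.ker_eq_bot']
    rintro ⟨p, hp⟩ h0
    have h0 : shift s p = 0 := h0
    have h1 := norm_fst_le hA s hp
    have h2 := norm_snd_le hA s hp
    rw [h0, norm_zero] at h1 h2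
    have h3 : ‖p.1‖ ≤ 0 := by
      by_contra! h
      nlinarith [mul_pos hs' h]
    exact Subtype.ext (Prod.ext (norm_le_zero_iff.1 h3) (norm_le_zero_iff.1 h2))
  · rw [← LinearMap.range_eq_top]
    set K := LinearMap.range ((shift s : H × H →L[ℂ] H).toLinearMap ∘ₗ A.graph.subtype)
    have hcomplete : CompleteSpace A.graph := by
      have : IsClosed (A.graph : Set (H × H)) := hA.isClosed
      exact this.completeSpace_coe
    have hclosed : IsClosed (K : Set H) := by
      have hanti : AntilipschitzWith (Real.toNNReal (max 1 |s|⁻¹))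
          ((shift s : H × H →L[ℂ] H).comp A.graph.subtypeL) := by
        refine ContinuousLinearMap.antilipschitz_of_bound _ fun p => ?_
        have h1 := norm_fst_le hA s p.2
        have h2 := norm_snd_le hA s p.2
        rw [Real.coe_toNNReal _ (by positivity)]
        change ‖(p : H × H)‖ ≤ _ * ‖shift s (p : H × H)‖
        rw [Prod.norm_def]
        refine max_le ?_ ?_
        · calc ‖(p : H × H).1‖ ≤ |s|⁻¹ * ‖shift s (p : H × H)‖ := by
                rw [le_inv_mul_iff₀ hs']; exact h1
            _ ≤ _ := by gcongr; exact le_max_right _ _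
        · calc ‖(p : H × H).2‖ ≤ 1 * ‖shift s (p : H × H)‖ := by rw [one_mul]; exact h2
            _ ≤ _ := by gcongr; exact le_max_left _ _
      have := hanti.isClosed_range (ContinuousLinearMap.uniformContinuous _)
      convert this using 1
      ext y
      simp [K]
    have hperp : Kᗮ = ⊥ := by
      rw [Submodule.eq_bot_iff]
      intro y hy
      have hg : (y, (Complex.I * s) • y) ∈ A.graph := by
        rw [mem_graph_iff_of_isSelfAdjoint hA]
        intro p hp
        have h := (Submodule.mem_orthogonal K y).1 hy (shift s p) ⟨⟨p, hp⟩, rfl⟩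
        rw [shift_apply, inner_add_left, inner_smul_left] at h
        rw [inner_smul_right]
        simp only [map_mul, Complex.conj_I, Complex.conj_ofReal] at h
        linear_combination h
      have h := inner_graph_symm hA hg hg
      simp only [inner_smul_left, inner_smul_right, map_mul, Complex.conj_I,
        Complex.conj_ofReal] at h
      have h2 : (Complex.I * s) * ⟪y, y⟫_ℂ = 0 := by linear_combination (-1 / 2 : ℂ) * h
      have h3 : Complex.I * (s : ℂ) ≠ 0 := mul_ne_zero Complex.I_ne_zero (by exact_mod_cast hs)
      exact inner_self_eq_zero.1 ((mul_eq_zero.1 h2).resolve_left h3)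
    rw [← hclosed.submodule_topologicalClosure_eq]
    exact Submodule.topologicalClosure_eq_top_iff.2 hperp

end Stone

/-! ### Stone's theorem: Yosida approximation and the limiting unitary group -/

section Stone

open scoped InnerProductSpace
open Filter Topology

variable {H : Type*} [NormedAddCommGroup H] [InnerProductSpace ℂ H] [CompleteSpace H]
  {A : H →ₗ.[ℂ] H} (hA : IsSelfAdjoint A)

include hA in
lemma exists_resolvent {s : ℝ} (hs : s ≠ 0) : ∃ R : H →L[ℂ] H,
    (∀ χ, (R χ, χ - (Complex.I * s) • R χ) ∈ A.graph) ∧ ∀ χ, |s| * ‖R χ‖ ≤ ‖χ‖ := by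
  let e := LinearEquiv.ofBijective _ (bijective_shift hA hs)
  have he : ∀ χ, shift s (e.symm χ : H × H) = χ := fun χ => e.apply_symm_apply χ
  have hb : ∀ χ, |s| * ‖(e.symm χ : H × H).1‖ ≤ ‖χ‖ := fun χ => by
    have := norm_fst_le hA s (e.symm χ).2
    rwa [he] at this
  let R : H →ₗ[ℂ] H := LinearMap.fst ℂ H H ∘ₗ A.graph.subtype ∘ₗ e.symm.toLinearMap
  refine ⟨R.mkContinuous |s|⁻¹ fun χ => ?_, fun χ => ?_, hb⟩
  · rw [le_inv_mul_iff₀ (abs_pos.2 hs)]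
    exact hb χ
  · have h := he χ
    rw [shift_apply] at h
    have h2 : χ - (Complex.I * s) • (e.symm χ : H × H).1 = (e.symm χ : H × H).2 := by
      rw [sub_eq_iff_eq_add, h]
    change ((e.symm χ : H × H).1, χ - (Complex.I * s) • (e.symm χ : H × H).1) ∈ A.graph
    rw [h2]
    exact (e.symm χ).2

/-- The resolvent `(A + is)⁻¹` of a self-adjoint operator. -/
def resolventI {s : ℝ} (hs : s ≠ 0) : H →L[ℂ] H := (exists_resolvent hA hs).choose

section

variable {s : ℝ} (hs : s ≠ 0)

lemma resolventI_mem (χ : H) :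
    (resolventI hA hs χ, χ - (Complex.I * s) • resolventI hA hs χ) ∈ A.graph :=
  (exists_resolvent hA hs).choose_spec.1 χ

lemma norm_resolventI_le (χ : H) : |s| * ‖resolventI hA hs χ‖ ≤ ‖χ‖ :=
  (exists_resolvent hA hs).choose_spec.2 χ

lemma resolventI_eq {ψ φ : H} (h : (ψ, φ) ∈ A.graph) :
    resolventI hA hs (φ + (Complex.I * s) • ψ) = ψ := by
  set χ := φ + (Complex.I * s) • ψ with hχ
  have h1 : (⟨_, resolventI_mem hA hs χ⟩ : A.graph) = ⟨(ψ, φ), h⟩ := by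
    refine (bijective_shift hA hs).1 ?_
    change shift s _ = shift s _
    exact sub_add_cancel _ _
  exact congrArg (fun p : A.graph => (p : H × H).1) h1

lemma resolventI_snd {ψ φ : H} (h : (ψ, φ) ∈ A.graph) :
    resolventI hA hs φ = ψ - (Complex.I * s) • resolventI hA hs ψ := by
  have := resolventI_eq hA hs h
  rw [map_add, map_smul] at this
  rw [eq_sub_iff_add_eq, this]

/-- The resolvent commutes with A on its domain; this is what makes two resolvents commute. -/
lemma resolventI_mem_graph {ψ φ : H} (h : (ψ, φ) ∈ A.graph) :
    (resolventI hA hs ψ, resolventI hA hs φ) ∈ A.graph := by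
  rw [resolventI_snd hA hs h]
  exact resolventI_mem hA hs ψ

lemma resolventI_comm {r : ℝ} (hr : r ≠ 0) :
    Commute (resolventI hA hs) (resolventI hA hr) := by
  ext χ
  change resolventI hA hs (resolventI hA hr χ) = resolventI hA hr (resolventI hA hs χ)
  have h := resolventI_eq hA hr (resolventI_mem_graph hA hs (resolventI_mem hA hr χ))
  rw [map_sub, map_smul, sub_add_cancel] at h
  exact h.symm

lemma adjoint_resolventI {r : ℝ} (hr : r ≠ 0) (h : r = -s) :
    star (resolventI hA hs) = resolventI hA hr := by
  subst h
  rw [ContinuousLinearMap.star_eq_adjoint]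
  symm
  rw [ContinuousLinearMap.eq_adjoint_iff]
  intro x y
  have h := inner_graph_symm hA (resolventI_mem hA hr x) (resolventI_mem hA hs y)
  simp only [inner_sub_left, inner_sub_right, inner_smul_left, inner_smul_right, map_mul,
    Complex.conj_I, Complex.conj_ofReal, Complex.ofReal_neg, map_neg] at h
  linear_combination -h

/-- `is(A + is)⁻¹`. -/
def mollifier : H →L[ℂ] H := (Complex.I * s) • resolventI hA hs

lemma norm_mollifier_le (x : H) : ‖mollifier hA hs x‖ ≤ ‖x‖ := by
  rw [mollifier, smul_apply, norm_smul]
  simpa using norm_resolventI_le hA hs x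

end

/-- On the domain of A the error is is(A + is)⁻¹ψ − ψ = −(A + is)⁻¹Aψ, of norm at most ‖Aψ‖/|s|. The
mollifiers being contractions, convergence extends to the closure of the domain. -/
lemma tendsto_mollifier (s : ℕ → ℝ) (hs : ∀ n, s n ≠ 0) (hlim : Tendsto (fun n => |s n|) atTop atTop)
    (x : H) : Tendsto (fun n => mollifier hA (hs n) x) atTop (𝓝 x) := by
  refine hA.dense_domain.induction (P := fun x => Tendsto (fun n => mollifier hA (hs n) x) atTop (𝓝 x))
    ?_ (isClosed_setOf_tendsto fun n => norm_mollifier_le hA (hs n)) x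
  intro ψ hψ
  obtain ⟨φ, hg⟩ : ∃ φ, (ψ, φ) ∈ A.graph := ⟨A ⟨ψ, hψ⟩, A.mem_graph ⟨ψ, hψ⟩⟩
  rw [tendsto_iff_norm_sub_tendsto_zero]
  refine squeeze_zero (fun n => norm_nonneg _) (fun n => ?_)
    ((tendsto_inv_atTop_zero.comp hlim).mul_const ‖φ‖ |>.trans (by rw [zero_mul]))
  have h := resolventI_snd hA (hs n) hg
  have e : mollifier hA (hs n) ψ - ψ = - resolventI hA (hs n) φ := by
    rw [h, mollifier, smul_apply, neg_sub]
  rw [e, norm_neg]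
  change _ ≤ |s n|⁻¹ * _
  rw [le_inv_mul_iff₀ (abs_pos.2 (hs n))]
  exact norm_resolventI_le hA (hs n) φ

lemma yosida_ne_zero (n : ℕ) : (n : ℝ) + 1 ≠ 0 := by positivity

lemma yosida_neg_ne_zero (n : ℕ) : -((n : ℝ) + 1) ≠ 0 := neg_ne_zero.2 (yosida_ne_zero n)

/-- `½(is(A + is)⁻¹ - is(A - is)⁻¹)`, where `s = n + 1`. -/
def yosidaMollifier (n : ℕ) : H →L[ℂ] H :=
  (1 / 2 : ℂ) • (mollifier hA (yosida_ne_zero n) + mollifier hA (yosida_neg_ne_zero n))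

lemma norm_yosidaMollifier_le (n : ℕ) (x : H) : ‖yosidaMollifier hA n x‖ ≤ ‖x‖ := by
  have h1 := norm_mollifier_le hA (yosida_ne_zero n) x
  have h2 := norm_mollifier_le hA (yosida_neg_ne_zero n) x
  have h3 := norm_add_le (mollifier hA (yosida_ne_zero n) x) (mollifier hA (yosida_neg_ne_zero n) x)
  rw [yosidaMollifier, smul_apply, add_apply, norm_smul]
  have h4 : ‖(1 / 2 : ℂ)‖ = 1 / 2 := by norm_num
  rw [h4]
  linarith

lemma tendsto_yosidaMollifier (x : H) :
    Tendsto (fun n => yosidaMollifier hA n x) atTop (𝓝 x) := by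
  have hl : Tendsto (fun n : ℕ => (n : ℝ) + 1) atTop atTop :=
    tendsto_atTop_add_const_right _ _ tendsto_natCast_atTop_atTop
  have h1 := tendsto_mollifier hA _ yosida_ne_zero (tendsto_abs_atTop_atTop.comp hl) x
  have h2 := tendsto_mollifier hA _ yosida_neg_ne_zero (by
    simp only [abs_neg]; exact tendsto_abs_atTop_atTop.comp hl) x
  have h3 := (h1.add h2).const_smul (1 / 2 : ℂ)
  have e : (1 / 2 : ℂ) • (x + x) = x := by rw [← two_smul ℂ, smul_smul]; norm_num
  rw [e] at h3
  exact h3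

/-- The Yosida approximation `½s²((A + is)⁻¹ + (A - is)⁻¹)`, where `s = n + 1`, multiplied by `i`. -/
def yosida (n : ℕ) : skewAdjoint (H →L[ℂ] H) :=
  ⟨(Complex.I * ((((n : ℝ) + 1) ^ 2 / 2 : ℝ) : ℂ)) • (resolventI hA (yosida_ne_zero n) +
    resolventI hA (yosida_neg_ne_zero n)), by
    rw [skewAdjoint.mem_iff, star_smul, star_add,
      adjoint_resolventI hA _ (yosida_neg_ne_zero n) rfl,
      adjoint_resolventI hA _ (yosida_ne_zero n) (neg_neg _).symm,
      add_comm (resolventI hA (yosida_neg_ne_zero n)), ← neg_smul]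
    congr 1
    simp⟩

/-- In terms of spectral values, ½s²(1/(a + is) + 1/(a − is)) = a · s²/(a² + s²), and the last
factor is the symbol of `yosidaMollifier`. So the bounded approximants are mollifications of A and
converge to A strongly on its domain; averaging over ±s is what makes them self-adjoint. -/
lemma yosida_apply (n : ℕ) {ψ φ : H} (h : (ψ, φ) ∈ A.graph) :
    (yosida hA n : H →L[ℂ] H) ψ = Complex.I • yosidaMollifier hA n φ := by
  have h1 := resolventI_snd hA (yosida_ne_zero n) h
  have h2 := resolventI_snd hA (yosida_neg_ne_zero n) h
  simp only [yosida, yosidaMollifier, mollifier, smul_apply,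
    add_apply, h1, h2]
  push_cast
  simp only [smul_sub, smul_add, smul_smul]
  have hI : Complex.I * Complex.I = -1 := Complex.I_mul_I
  match_scalars
  all_goals first
    | linear_combination ((n + 1 : ℂ) ^ 2 / 2 * Complex.I) * hI
    | ring1

lemma yosida_comm (n m : ℕ) : Commute (yosida hA n : H →L[ℂ] H) (yosida hA m : H →L[ℂ] H) := by
  refine Commute.smul_left (Commute.smul_right ?_ _) _
  exact ((resolventI_comm hA _ _).add_right (resolventI_comm hA _ _)).add_left
    ((resolventI_comm hA _ _).add_right (resolventI_comm hA _ _))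

lemma exists_tendsto_expSkew_yosida (t : ℝ) (x : H) :
    ∃ y, Tendsto (fun n => (expSkew (yosida hA n) t : H →L[ℂ] H) x) atTop (𝓝 y) := by
  refine cauchySeq_tendsto_of_complete ?_
  refine hA.dense_domain.induction
    (P := fun x => CauchySeq fun n => (expSkew (yosida hA n) t : H →L[ℂ] H) x) ?_
    (isClosed_setOf_cauchySeq fun n x => (norm_unitary_apply _ x).le) x
  intro ψ hψ
  obtain ⟨φ, hg⟩ : ∃ φ, (ψ, φ) ∈ A.graph := ⟨A ⟨ψ, hψ⟩, A.mem_graph ⟨ψ, hψ⟩⟩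
  have hc : CauchySeq fun n => t • (yosida hA n : H →L[ℂ] H) ψ := by
    simp only [yosida_apply hA _ hg]
    exact (((tendsto_yosidaMollifier hA φ).const_smul Complex.I).const_smul t).cauchySeq
  rw [Metric.cauchySeq_iff] at hc ⊢
  intro ε hε
  obtain ⟨N, hN⟩ := hc ε hε
  refine ⟨N, fun m hm n hn => lt_of_le_of_lt ?_ (hN m hm n hn)⟩
  rw [dist_eq_norm, dist_eq_norm, ← smul_sub, norm_smul]
  exact norm_expSkew_sub_expSkew_le (yosida_comm hA m n) ψ t

/-- `exp(itA)ψ`. -/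
def stoneFun (t : ℝ) (x : H) : H := (exists_tendsto_expSkew_yosida hA t x).choose

lemma tendsto_stoneFun (t : ℝ) (x : H) :
    Tendsto (fun n => (expSkew (yosida hA n) t : H →L[ℂ] H) x) atTop (𝓝 (stoneFun hA t x)) :=
  (exists_tendsto_expSkew_yosida hA t x).choose_spec

lemma stoneFun_add (s t : ℝ) (x : H) :
    stoneFun hA (s + t) x = stoneFun hA s (stoneFun hA t x) := by
  refine tendsto_nhds_unique (tendsto_stoneFun hA (s + t) x) ?_
  have h1 := tendsto_stoneFun hA s (stoneFun hA t x)
  have h2 := tendsto_stoneFun hA t x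
  rw [tendsto_iff_norm_sub_tendsto_zero] at h2
  -- exp(sZₙ) is isometric uniformly in n, so exp(tZₙ)x may be replaced by its limit inside it.
  have h3 : Tendsto (fun n => (expSkew (yosida hA n) (s + t) : H →L[ℂ] H) x
      - (expSkew (yosida hA n) s : H →L[ℂ] H) (stoneFun hA t x)) atTop (𝓝 0) := by
    rw [tendsto_zero_iff_norm_tendsto_zero]
    refine h2.congr fun n => ?_
    rw [expSkew_add]
    change _ = ‖(expSkew (yosida hA n) s : H →L[ℂ] H) ((expSkew (yosida hA n) t : H →L[ℂ] H) x) - _‖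
    rw [← map_sub, norm_unitary_apply]
  simpa using h3.add h1

lemma stoneFun_zero (x : H) : stoneFun hA 0 x = x :=
  tendsto_nhds_unique (tendsto_stoneFun hA 0 x) (by simp [expSkew_zero])

lemma norm_stoneFun (t : ℝ) (x : H) : ‖stoneFun hA t x‖ = ‖x‖ :=
  tendsto_nhds_unique (tendsto_stoneFun hA t x).norm (by simp [norm_unitary_apply])

/-- `exp(itA)`, as a linear isometric bijection. -/
def stoneEquiv (t : ℝ) : H ≃ₗᵢ[ℂ] H where
  toFun := stoneFun hA t
  map_add' x y := tendsto_nhds_unique (tendsto_stoneFun hA t (x + y)) (by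
    simp only [map_add]; exact (tendsto_stoneFun hA t x).add (tendsto_stoneFun hA t y))
  map_smul' c x := tendsto_nhds_unique (tendsto_stoneFun hA t (c • x)) (by
    simp only [map_smul]; exact (tendsto_stoneFun hA t x).const_smul c)
  invFun := stoneFun hA (-t)
  left_inv x := by rw [← stoneFun_add, neg_add_cancel, stoneFun_zero]
  right_inv x := by rw [← stoneFun_add, add_neg_cancel, stoneFun_zero]
  norm_map' := norm_stoneFun hA t

/-- The unitary group `t ↦ exp(itA)`. -/
def stoneGroup (t : ℝ) : unitary (H →L[ℂ] H) :=
  Unitary.linearIsometryEquiv.symm (stoneEquiv hA t)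

lemma stoneGroup_apply (t : ℝ) (x : H) : (stoneGroup hA t : H →L[ℂ] H) x = stoneFun hA t x := rfl

lemma norm_stoneFun_sub_le (t : ℝ) {ψ φ χ η : H} (h : (ψ, φ) ∈ A.graph) (h' : (χ, η) ∈ A.graph) :
    ‖stoneFun hA t ψ - ψ - t • (Complex.I • φ)‖
      ≤ (2 * ‖Complex.I • φ - χ‖ + |t| * ‖η‖) * |t| := by
  have hlim : Tendsto (fun n => (yosida hA n : H →L[ℂ] H) ψ) atTop (𝓝 (Complex.I • φ)) := by
    simp only [yosida_apply hA _ h]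
    exact (tendsto_yosidaMollifier hA φ).const_smul _
  refine le_of_tendsto_of_tendsto
    (((tendsto_stoneFun hA t ψ).sub_const ψ).sub (hlim.const_smul t)).norm
    (((((hlim.sub_const χ).norm.const_mul 2).add_const (|t| * ‖η‖)).mul_const |t|))
    (Eventually.of_forall fun n => ?_)
  refine (norm_expSkew_sub_sub_le (yosida hA n) ψ χ t).trans ?_
  change _ ≤ (2 * ‖(yosida hA n : H →L[ℂ] H) ψ - χ‖ + |t| * ‖η‖) * |t|
  gcongr
  rw [yosida_apply hA n h', norm_smul, Complex.norm_I, one_mul]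
  exact norm_yosidaMollifier_le hA n η

lemma hasDerivAt_stoneFun {ψ φ : H} (h : (ψ, φ) ∈ A.graph) :
    HasDerivAt (fun t : ℝ => stoneFun hA t ψ) (Complex.I • φ) 0 := by
  rw [hasDerivAt_iff_isLittleO, Asymptotics.isLittleO_iff]
  intro ε hε
  -- iφ need not lie in the domain of A, so it is approximated by some χ there. The error bound
  -- contains 2‖iφ − χ‖, hence ε/4; the other ε/2 is absorbed by |t|‖Aχ‖ for small t.
  obtain ⟨χ, hχ, hd⟩ := Metric.mem_closure_iff.1 (hA.dense_domain (Complex.I • φ)) (ε / 4)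
    (by positivity)
  obtain ⟨η, hg⟩ : ∃ η, (χ, η) ∈ A.graph := ⟨A ⟨χ, hχ⟩, A.mem_graph ⟨χ, hχ⟩⟩
  have hb : ∀ᶠ t : ℝ in 𝓝 0, |t| * ‖η‖ < ε / 2 := by
    have : Tendsto (fun t : ℝ => |t| * ‖η‖) (𝓝 0) (𝓝 (|0| * ‖η‖)) :=
      (continuous_abs.mul continuous_const).tendsto 0
    exact this.eventually_lt_const (by simpa using hε)
  filter_upwards [hb] with t ht
  have h1 := norm_stoneFun_sub_le hA t h hg
  rw [dist_eq_norm] at hd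
  rw [stoneFun_zero, sub_zero, Real.norm_eq_abs]
  refine h1.trans ?_
  gcongr
  linarith

lemma continuous_stoneFun (x : H) : Continuous fun t => stoneFun hA t x := by
  refine continuous_of_uniform_approx_of_continuous fun u hu => ?_
  obtain ⟨ε, hε, hu⟩ := Metric.mem_uniformity_dist.1 hu
  obtain ⟨ψ, hψ, hd⟩ := Metric.mem_closure_iff.1 (hA.dense_domain x) ε hε
  obtain ⟨φ, hg⟩ : ∃ φ, (ψ, φ) ∈ A.graph := ⟨A ⟨ψ, hψ⟩, A.mem_graph ⟨ψ, hψ⟩⟩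
  refine ⟨fun t => stoneFun hA t ψ, ?_, fun t => hu ?_⟩
  · refine continuous_iff_continuousAt.2 fun t => ?_
    have h1 : ContinuousAt (fun s => stoneFun hA (s - t) ψ) t := by
      refine ContinuousAt.comp (g := fun s => stoneFun hA s ψ) ?_ (by fun_prop)
      rw [sub_self]
      exact (hasDerivAt_stoneFun hA hg).continuousAt
    have h2 := (stoneEquiv hA t).continuous.continuousAt.comp h1
    refine h2.congr (Eventually.of_forall fun s => ?_)
    change stoneFun hA t (stoneFun hA (s - t) ψ) = _
    rw [← stoneFun_add, add_sub_cancel]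
  · rw [dist_eq_norm]
    change ‖stoneEquiv hA t x - stoneEquiv hA t ψ‖ < ε
    rwa [← map_sub, LinearIsometryEquiv.norm_map, ← dist_eq_norm]

/-- Stone's theorem: a self-adjoint operator generates a unitary group. -/
theorem isUnitaryGroupOf_stoneGroup : IsUnitaryGroupOf A (stoneGroup hA) where
  map_add s t := Subtype.ext (ContinuousLinearMap.ext fun x => stoneFun_add hA s t x)
  continuous ψ := continuous_stoneFun hA ψ
  generator ψ φ := by
    refine ⟨fun h => hasDerivAt_stoneFun hA h, fun h => ?_⟩
    -- The generator is no larger than A: differentiating the constant ⟨V(t)p₁, V(t)ψ⟩ at 0 shows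
    -- that (ψ, φ) satisfies the symmetry relation against the graph of A, and a self-adjoint
    -- operator has no proper extension of this kind.
    rw [mem_graph_iff_of_isSelfAdjoint hA]
    intro p hp
    have h1 := (hasDerivAt_stoneFun hA (ψ := p.1) (φ := p.2) hp).inner ℂ h
    have e : ∀ t : ℝ, ⟪stoneFun hA t p.1, (stoneGroup hA t : H →L[ℂ] H) ψ⟫_ℂ = ⟪p.1, ψ⟫_ℂ :=
      fun t => (stoneEquiv hA t).inner_map_map p.1 ψ
    have h2 := h1.unique ((hasDerivAt_const (0 : ℝ) ⟪p.1, ψ⟫_ℂ).congr_of_eventuallyEq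
      (Eventually.of_forall e))
    rw [stoneFun_zero, stoneGroup_apply, stoneFun_zero, inner_smul_left, inner_smul_right,
      Complex.conj_I] at h2
    have h3 : Complex.I * (⟪p.2, ψ⟫_ℂ - ⟪p.1, φ⟫_ℂ) = 0 := by linear_combination -h2
    exact sub_eq_zero.1 ((mul_eq_zero.1 h3).resolve_left Complex.I_ne_zero)

end Stone

/-! ### Exponentials of essentially self-adjoint operators with a common core -/

section EssentiallySelfAdjoint

open scoped InnerProductSpace
open Filter Topology

variable {H : Type*} [NormedAddCommGroup H] [InnerProductSpace ℂ H] [CompleteSpace H]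
  {D : Submodule ℂ H}

omit [CompleteSpace H] in
lemma mem_graph_unbounded (A : D →ₗ[ℂ] D) {p : H × H} :
    p ∈ (unbounded A).graph ↔ ∃ ψ : D, p = ((ψ : H), (A ψ : H)) := by
  rw [LinearPMap.mem_graph_iff]
  constructor
  · rintro ⟨ψ, h1, h2⟩
    exact ⟨ψ, Prod.ext h1.symm h2.symm⟩
  · rintro ⟨ψ, rfl⟩
    exact ⟨ψ, rfl, rfl⟩

omit [CompleteSpace H] in
lemma apply_mem_graph_closure {A : D →ₗ[ℂ] D} (ψ : D) :
    ((ψ : H), (A ψ : H)) ∈ (unbounded A).closure.graph :=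
  graph_subset_graph_closure _ ((mem_graph_unbounded A).2 ⟨ψ, rfl⟩)

lemma IsEssentiallySelfAdjoint.dense_closure {A : H →ₗ.[ℂ] H} (h : IsEssentiallySelfAdjoint A) :
    Dense (A.closure.domain : Set H) :=
  h.1.mono A.le_closure.1

/-- The unitary group generated by the closure of an essentially self-adjoint operator. -/
lemma IsEssentiallySelfAdjoint.isUnitaryGroupOf {A : H →ₗ.[ℂ] H}
    (h : IsEssentiallySelfAdjoint A) : IsUnitaryGroupOf A.closure (stoneGroup h.2) :=
  isUnitaryGroupOf_stoneGroup h.2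

lemma IsEssentiallySelfAdjoint.expI_eq {A : H →ₗ.[ℂ] H} (h : IsEssentiallySelfAdjoint A) :
    expI A.closure = stoneGroup h.2 1 :=
  h.isUnitaryGroupOf.expI_eq h.dense_closure

lemma IsEssentiallySelfAdjoint.isExpI {A : H →ₗ.[ℂ] H} (h : IsEssentiallySelfAdjoint A) :
    IsExpI A.closure (expI A.closure) :=
  ⟨_, h.isUnitaryGroupOf, h.expI_eq.symm⟩

/-- A bounded operator which maps the graph of `A` into the graph of the closure of `A'` does so with
the graph of the closure of `A`. -/
lemma map_graph_closure {A A' : H →ₗ.[ℂ] H} (h : IsEssentiallySelfAdjoint A)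
    (h' : IsEssentiallySelfAdjoint A') {T : H →L[ℂ] H}
    (hT : ∀ p ∈ A.graph, (T p.1, T p.2) ∈ A'.closure.graph) :
    ∀ p ∈ A.closure.graph, (T p.1, T p.2) ∈ A'.closure.graph := by
  intro p hp
  have hp' : p ∈ closure (A.graph : Set (H × H)) := by rw [← graph_closure_eq h]; exact hp
  have hc : IsClosed {p : H × H | (T p.1, T p.2) ∈ A'.closure.graph} :=
    IsClosed.preimage (f := fun p : H × H => (T p.1, T p.2)) (by fun_prop) h'.2.isClosed
  exact closure_minimal (fun q hq => hT q hq) hc hp'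

/-- If `T` intertwines essentially self-adjoint operators on a common core, then it intertwines the
unitaries which they generate. -/
lemma expI_intertwine {A A' : D →ₗ[ℂ] D} (h : IsEssentiallySelfAdjoint (unbounded A))
    (h' : IsEssentiallySelfAdjoint (unbounded A')) {T : H →L[ℂ] H}
    (hT : ∀ ψ : D, (T ψ, T (A ψ)) ∈ (unbounded A').closure.graph) :
    T * (expI (unbounded A).closure : H →L[ℂ] H)
      = (expI (unbounded A').closure : H →L[ℂ] H) * T := by
  rw [h.expI_eq, h'.expI_eq]
  refine h.isUnitaryGroupOf.intertwine h'.isUnitaryGroupOf h.dense_closure T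
    (map_graph_closure h h' ?_) 1
  intro p hp
  obtain ⟨ψ, rfl⟩ := (mem_graph_unbounded A).1 hp
  exact hT ψ

lemma graph_closure_smul {A : D →ₗ[ℂ] D} (h : IsEssentiallySelfAdjoint (unbounded A)) {r : ℝ}
    (hr : r ≠ 0) (h' : IsEssentiallySelfAdjoint (unbounded ((r : ℂ) • A))) (x y : H) :
    (x, y) ∈ (unbounded A).closure.graph ↔
      (x, (r : ℂ) • y) ∈ (unbounded ((r : ℂ) • A)).closure.graph := by
  have hr' : (r : ℂ) ≠ 0 := Complex.ofReal_ne_zero.2 hr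
  have e : ∀ c : ℂ, Continuous fun p : H × H => (p.1, c • p.2) := fun c => by fun_prop
  have key : ∀ {A₁ A₂ : H →ₗ.[ℂ] H} (c : ℂ), IsEssentiallySelfAdjoint A₁ →
      IsEssentiallySelfAdjoint A₂ → (∀ p ∈ A₁.graph, (p.1, c • p.2) ∈ A₂.graph) →
      ∀ p ∈ A₁.closure.graph, (p.1, c • p.2) ∈ A₂.closure.graph := by
    intro A₁ A₂ c h₁ h₂ hp p hpc
    have hp' : p ∈ closure (A₁.graph : Set (H × H)) := by rw [← graph_closure_eq h₁]; exact hpc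
    have hc : IsClosed {p : H × H | (p.1, c • p.2) ∈ A₂.closure.graph} :=
      h₂.2.isClosed.preimage (e c)
    exact closure_minimal (t := {p : H × H | (p.1, c • p.2) ∈ A₂.closure.graph})
      (fun q hq => graph_subset_graph_closure _ (hp q hq)) hc hp'
  constructor
  · refine key (r : ℂ) h h' ?_ (x, y)
    intro p hp
    obtain ⟨ψ, rfl⟩ := (mem_graph_unbounded A).1 hp
    exact (mem_graph_unbounded _).2 ⟨ψ, rfl⟩
  · intro hxy
    have := key (r : ℂ)⁻¹ h' h ?_ (x, (r : ℂ) • y) hxy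
    · rwa [smul_smul, inv_mul_cancel₀ hr', one_smul] at this
    · intro p hp
      obtain ⟨ψ, rfl⟩ := (mem_graph_unbounded _).1 hp
      refine (mem_graph_unbounded _).2 ⟨ψ, ?_⟩
      refine Prod.ext rfl ?_
      change (r : ℂ)⁻¹ • (r : ℂ) • (A ψ : H) = A ψ
      rw [smul_smul, inv_mul_cancel₀ hr', one_smul]

/-- This recovers the whole group of A from single exponentials: exp(i(rA)) is the value at r of t ↦
exp(itA). Causality is given only for exponentials, so it needs this form to reach the generators.
-/
lemma expI_smul {A : D →ₗ[ℂ] D} (h : IsEssentiallySelfAdjoint (unbounded A)) {r : ℝ}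
    (hr : r ≠ 0) (h' : IsEssentiallySelfAdjoint (unbounded ((r : ℂ) • A))) :
    expI (unbounded ((r : ℂ) • A)).closure = stoneGroup h.2 r := by
  have := (h.isUnitaryGroupOf.scale hr (graph_closure_smul h hr h')).expI_eq h'.dense_closure
  rwa [mul_one] at this

/-- `exp(-iA) = exp(iA)*`. -/
lemma expI_neg {A : D →ₗ[ℂ] D} (h : IsEssentiallySelfAdjoint (unbounded A))
    (h' : IsEssentiallySelfAdjoint (unbounded (-A))) :
    expI (unbounded (-A)).closure = star (expI (unbounded A).closure) := by
  have e : ((-1 : ℝ) : ℂ) • A = -A := by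
    ext ψ
    simp
  have h1 := expI_smul h (r := -1) (by norm_num) (by rwa [e])
  rw [e] at h1
  rw [h1, h.expI_eq, Unitary.star_eq_inv, eq_inv_iff_mul_eq_one, ← h.isUnitaryGroupOf.map_add,
    neg_add_cancel, h.isUnitaryGroupOf.map_zero]

/-- `exp(i0) = 1`. -/
lemma expI_zero (h : IsEssentiallySelfAdjoint (unbounded (0 : D →ₗ[ℂ] D))) :
    expI (unbounded (0 : D →ₗ[ℂ] D)).closure = 1 := by
  have hz : ∀ p ∈ (unbounded (0 : D →ₗ[ℂ] D)).closure.graph, p.2 = 0 := by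
    intro p hp
    have hp' : p ∈ closure ((unbounded (0 : D →ₗ[ℂ] D)).graph : Set (H × H)) := by
      rw [← graph_closure_eq h]; exact hp
    refine closure_minimal (t := {p : H × H | p.2 = 0}) ?_ (isClosed_eq (by fun_prop) (by fun_prop)) hp'
    intro q hq
    obtain ⟨ψ, rfl⟩ := (mem_graph_unbounded _).1 hq
    simp
  have hm : ∀ ψ, (ψ, (0 : H)) ∈ (unbounded (0 : D →ₗ[ℂ] D)).closure.graph := by
    intro ψ
    refine mem_graph_closure h fun p hp => ?_
    rw [hz p (graph_subset_graph_closure _ hp)]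
    simp
  have : IsUnitaryGroupOf (unbounded (0 : D →ₗ[ℂ] D)).closure fun _ => 1 := by
    refine ⟨fun _ _ => (mul_one 1).symm, fun ψ => continuous_const, fun ψ φ => ?_⟩
    constructor
    · intro hp
      have := hz _ hp
      simp only at this
      rw [this, smul_zero]
      exact hasDerivAt_const _ _
    · intro hd
      have := hd.unique (hasDerivAt_const _ _)
      have : φ = 0 := (smul_eq_zero.1 this).resolve_left Complex.I_ne_zero
      rw [this]
      exact hm ψ
  exact this.expI_eq h.dense_closure

/-- A bounded operator which commutes with the unitary groups of essentially self-adjoint operators on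
a common core commutes with the unitary generated by their sum, if the latter is essentially
self-adjoint as well. -/
lemma commute_expI_sum {ι : Type*} (s : Finset ι) (A : ι → D →ₗ[ℂ] D)
    (hA : ∀ i ∈ s, ∀ r : ℝ, IsEssentiallySelfAdjoint (unbounded ((r : ℂ) • A i)))
    (hsum : IsEssentiallySelfAdjoint (unbounded (∑ i ∈ s, A i))) {T : H →L[ℂ] H}
    (hT : ∀ i ∈ s, ∀ r : ℝ, Commute T (expI (unbounded ((r : ℂ) • A i)).closure : H →L[ℂ] H)) :
    Commute T (expI (unbounded (∑ i ∈ s, A i)).closure : H →L[ℂ] H) := by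
  have hA1 : ∀ i ∈ s, IsEssentiallySelfAdjoint (unbounded (A i)) := fun i hi => by
    simpa using hA i hi 1
  have hcomm : ∀ i (hi : i ∈ s), ∀ t, Commute T (stoneGroup (hA1 i hi).2 t : H →L[ℂ] H) := by
    intro i hi t
    by_cases ht : t = 0
    · rw [ht, (hA1 i hi).isUnitaryGroupOf.map_zero]
      exact Commute.one_right T
    · rw [← expI_smul (hA1 i hi) ht (hA i hi t)]
      exact hT i hi t
  -- T commutes with t ↦ exp(itAᵢ); differentiating at 0 shows that T maps D into the domain of the
  -- closure of Aᵢ and commutes with that closure there.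
  have hgr : ∀ i ∈ s, ∀ ψ : D, (T ψ, T (A i ψ)) ∈ (unbounded (A i)).closure.graph := by
    intro i hi ψ
    have hV := (hA1 i hi).isUnitaryGroupOf
    rw [hV.generator]
    have h1 := (hV.generator _ _).1 (apply_mem_graph_closure (A := A i) ψ)
    have h2 := (T.restrictScalars ℝ).hasFDerivAt.comp_hasDerivAt 0 h1
    refine (h2.congr_of_eventuallyEq (Eventually.of_forall fun t => ?_)).congr_deriv (by simp)
    exact (DFunLike.congr_fun (hcomm i hi t).eq (ψ : H)).symm
  -- Tψ need not lie in D, and lying in the domain of every closure does not by itself put it in the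
  -- domain of the closure of the sum. The symmetry relations against D do add up, however, and
  -- essential self-adjointness of the sum turns them into membership.
  refine expI_intertwine hsum hsum fun ψ => mem_graph_closure hsum fun p hp => ?_
  obtain ⟨χ, rfl⟩ := (mem_graph_unbounded _).1 hp
  simp only [LinearMap.sum_apply, Submodule.coe_sum, map_sum, sum_inner, inner_sum]
  refine Finset.sum_congr rfl fun i hi => ?_
  exact inner_graph_symm (hA1 i hi).2 (apply_mem_graph_closure χ) (hgr i hi ψ)

end EssentiallySelfAdjoint

/-! ### Integrals over the standard simplex -/

section SimplexIntegrals

open Filter Topology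

variable {n : ℕ}

lemma insertNth_mem_standardSimplex (i : Fin (n + 1)) (r : ℝ) (u : Fin n → ℝ) :
    (i.insertNth r u : Fin (n + 1) → ℝ) ∈ standardSimplex (n + 1) ↔
      u ∈ standardSimplex n ∧ r ∈ Set.Icc 0 (1 - ∑ j, u j) := by
  have h1 : ∑ j, (i.insertNth r u : Fin (n + 1) → ℝ) j = r + ∑ j, u j := by
    rw [Fin.sum_univ_succAbove _ i]; simp
  simp only [standardSimplex, Set.mem_ofPred_eq, h1, Set.mem_Icc, Fin.forall_iff_succAbove i,
    Fin.insertNth_apply_same, Fin.insertNth_apply_succAbove]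
  constructor
  · rintro ⟨⟨hr, hu⟩, hs⟩
    exact ⟨⟨hu, by linarith⟩, hr, by linarith⟩
  · rintro ⟨⟨hu, _⟩, hr, hs⟩
    exact ⟨⟨hr, hu⟩, by linarith⟩

/-- Fubini's theorem for the standard simplex. -/
lemma setIntegral_standardSimplex_succ {g : (Fin (n + 1) → ℝ) → ℝ} (hg : Continuous g)
    (i : Fin (n + 1)) : ∫ t in standardSimplex (n + 1), g t =
      ∫ u in standardSimplex n, ∫ r in (0)..(1 - ∑ j, u j), g (i.insertNth r u) := by
  have hm := (isCompact_standardSimplex (n + 1)).measurableSet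
  have hm' := (isCompact_standardSimplex n).measurableSet
  have hint : Integrable ((standardSimplex (n + 1)).indicator g) :=
    (integrable_indicator_iff hm).2 (hg.continuousOn.integrableOn_compact (isCompact_standardSimplex _))
  have hmp := (volume_preserving_piFinSuccAbove (fun _ : Fin (n + 1) => ℝ) i).symm
  rw [← integral_indicator hm, ← hmp.integral_comp' (g := (standardSimplex (n + 1)).indicator g),
    ← integral_indicator hm']
  have hint' := hmp.integrable_comp_of_integrable hint
  rw [Measure.volume_eq_prod] at hint' ⊢
  have hfubini := integral_prod_symm _ hint'
  simp only [Function.comp_apply] at hfubini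
  rw [hfubini]
  congr 1
  funext u
  by_cases hu : u ∈ standardSimplex n
  · rw [Set.indicator_of_mem hu, intervalIntegral.integral_of_le (by linarith [hu.2]),
      ← integral_Icc_eq_integral_Ioc, ← integral_indicator measurableSet_Icc]
    congr 1
    funext r
    change (standardSimplex (n + 1)).indicator g (i.insertNth r u) = _
    by_cases hr : r ∈ Set.Icc 0 (1 - ∑ j, u j)
    · rw [Set.indicator_of_mem hr, Set.indicator_of_mem]
      exact (insertNth_mem_standardSimplex i r u).2 ⟨hu, hr⟩
    · rw [Set.indicator_of_notMem hr, Set.indicator_of_notMem]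
      exact fun h => hr ((insertNth_mem_standardSimplex i r u).1 h).2
  · rw [Set.indicator_of_notMem hu]
    refine integral_eq_zero_of_ae (Eventually.of_forall fun r => ?_)
    change (standardSimplex (n + 1)).indicator g (i.insertNth r u) = 0
    rw [Set.indicator_of_notMem]
    exact fun h => hu ((insertNth_mem_standardSimplex i r u).1 h).1

/-- The affine automorphism of the standard simplex exchanging the origin and the `i`th vertex. -/
def reflectSimplex (i : Fin (n + 1)) (t : Fin (n + 1) → ℝ) : Fin (n + 1) → ℝ :=
  Function.update t i (1 - ∑ j, t j)

lemma reflectSimplex_insertNth (i : Fin (n + 1)) (r : ℝ) (u : Fin n → ℝ) :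
    reflectSimplex i (i.insertNth r u) = i.insertNth (1 - ∑ j, u j - r) u := by
  have h1 : ∑ j, (i.insertNth r u : Fin (n + 1) → ℝ) j = r + ∑ j, u j := by
    rw [Fin.sum_univ_succAbove _ i]; simp
  rw [reflectSimplex, h1, Fin.update_insertNth]
  congr 1
  ring

lemma continuous_reflectSimplex (i : Fin (n + 1)) : Continuous (reflectSimplex i) :=
  continuous_id.update i (by fun_prop)

/-- With the other coordinates fixed, the reflection reverses the interval [0, 1 − ∑ u] over which
the i-th coordinate runs. -/
lemma setIntegral_reflectSimplex {g : (Fin (n + 1) → ℝ) → ℝ} (hg : Continuous g)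
    (i : Fin (n + 1)) : ∫ t in standardSimplex (n + 1), g (reflectSimplex i t) =
      ∫ t in standardSimplex (n + 1), g t := by
  have h := setIntegral_standardSimplex_succ (hg.comp (continuous_reflectSimplex i)) i
  simp only [Function.comp_apply] at h
  rw [setIntegral_standardSimplex_succ hg i, h]
  congr 1
  funext u
  simp only [reflectSimplex_insertNth]
  rw [intervalIntegral.integral_comp_sub_left (fun r => g (i.insertNth r u)), sub_self, sub_zero]

lemma setIntegral_permute (g : (Fin n → ℝ) → ℝ) (σ : Equiv.Perm (Fin n)) :
    ∫ t in standardSimplex n, g (t ∘ σ) = ∫ t in standardSimplex n, g t := by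
  have hmp := (volume_measurePreserving_piCongrLeft (fun _ : Fin n => ℝ) σ).symm
  have e : (MeasurableEquiv.piCongrLeft (fun _ : Fin n => ℝ) σ).symm ⁻¹' standardSimplex n
      = standardSimplex n := by
    ext t
    change t ∘ σ ∈ standardSimplex n ↔ _
    simp only [standardSimplex, Set.mem_ofPred_eq, Function.comp_apply, Equiv.sum_comp σ t]
    rw [σ.forall_congr_left (p := fun i => 0 ≤ t (σ i))]
    simp
  have := hmp.setIntegral_preimage_emb (MeasurableEquiv.measurableEmbedding _) g (standardSimplex n)
  rw [e] at this
  exact this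

/-- Gauss's theorem for the standard simplex and the `i`th coordinate. -/
lemma setIntegral_deriv_standardSimplex {g g' : (Fin (n + 1) → ℝ) → ℝ} (hg' : Continuous g')
    (hg : Continuous g) (i : Fin (n + 1))
    (hd : ∀ u r, HasDerivAt (fun r => g (i.insertNth r u)) (g' (i.insertNth r u)) r) :
    ∫ t in standardSimplex (n + 1), g' t =
      (∫ u in standardSimplex n, g (i.insertNth (1 - ∑ j, u j) u))
        - ∫ u in standardSimplex n, g (i.insertNth 0 u) := by
  have hc : ∀ {h : (Fin (n + 1) → ℝ) → ℝ} {r : (Fin n → ℝ) → ℝ}, Continuous h → Continuous r →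
      IntegrableOn (fun u => h (i.insertNth (r u) u)) (standardSimplex n) := fun hh hr =>
    (hh.comp (hr.finInsertNth i continuous_id)).continuousOn.integrableOn_compact
      (isCompact_standardSimplex n)
  rw [setIntegral_standardSimplex_succ hg' i,
    ← integral_sub (hc hg (by fun_prop)) (hc hg continuous_const)]
  congr 1
  funext u
  rw [intervalIntegral.integral_eq_sub_of_hasDerivAt (fun r _ => hd u r)]
  have hins : Continuous fun r : ℝ => (i.insertNth r u : Fin (n + 1) → ℝ) :=
    Continuous.finInsertNth i continuous_id continuous_const
  exact (hg'.comp hins).intervalIntegrable _ _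

end SimplexIntegrals

/-! ### Stokes' theorem for smearing simplices -/

namespace Simplex

open Filter Topology

variable {n : ℕ}

/-- The `i`th edge vector issuing from the vertex `s₀`. -/
def edgeVec (s : Simplex n) (i : Fin n) : Spacetime := s.vertex i.succ - s.vertex 0

lemma param_face_succ (s : Simplex (n + 2)) (i : Fin (n + 2)) (u : Fin (n + 1) → ℝ) :
    (s.face i.succ).param u = s.param (i.insertNth 0 u) := by
  simp only [param, face, Function.comp_apply, Fin.succ_succAbove_zero, Fin.succ_succAbove_succ]
  rw [Fin.sum_univ_succAbove _ i]
  simp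

lemma param_insertNth (s : Simplex (n + 1)) (i : Fin (n + 1)) (r : ℝ) (u : Fin n → ℝ) :
    s.param (i.insertNth r u) = s.param (i.insertNth 0 u) + r • s.edgeVec i := by
  simp only [param, edgeVec]
  rw [Fin.sum_univ_succAbove _ i, Fin.sum_univ_succAbove _ i]
  simp only [Fin.insertNth_apply_same, Fin.insertNth_apply_succAbove, zero_smul, zero_add]
  abel

lemma lineDeriv_smear (s : Simplex n) (v x : Spacetime) :
    LineDeriv.lineDerivOp v s.smear x =
      ∫ t in standardSimplex n, LineDeriv.lineDerivOp v s.smearing (x - s.param t) := by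
  rw [SchwartzMap.lineDerivOp_apply_eq_fderiv]
  have h := hasFDerivAt_average ((volume : Measure (Fin n → ℝ)).restrict (standardSimplex n))
    s.continuous_param.measurable s.smearing x
  have e : fderiv ℝ s.smear x = _ := HasFDerivAt.fderiv h
  rw [e, ContinuousLinearMap.integral_apply (integrable_schwartz_comp _
    s.continuous_param.measurable _ x)]
  simp [SchwartzMap.lineDerivOp_apply_eq_fderiv]

/-- The derivative of f(x − s(t)) in tᵢ is minus the derivative of f along the i-th edge vector, so
integrating over the simplex leaves boundary terms on the faces tᵢ = 0 and ∑ tⱼ = 1. -/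
lemma lineDeriv_edgeVec_smear (s : Simplex (n + 1)) (i : Fin (n + 1)) (x : Spacetime) :
    LineDeriv.lineDerivOp (s.edgeVec i) s.smear x =
      (∫ u in standardSimplex n, s.smearing (x - s.param (i.insertNth 0 u)))
      - ∫ u in standardSimplex n, s.smearing (x - s.param (i.insertNth (1 - ∑ j, u j) u)) := by
  have hd : ∀ (u : Fin n → ℝ) (r : ℝ),
      HasDerivAt (fun r => s.smearing (x - s.param (i.insertNth r u)))
        (-LineDeriv.lineDerivOp (s.edgeVec i) s.smearing (x - s.param (i.insertNth r u))) r := by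
    intro u r
    have h1 : HasDerivAt (fun r => x - s.param (i.insertNth r u)) (-s.edgeVec i) r := by
      rw [show (fun r => x - s.param (i.insertNth r u)) =
        fun r => x - (s.param (i.insertNth 0 u) + r • s.edgeVec i) from
        funext fun r => by rw [s.param_insertNth i r u]]
      have := (((hasDerivAt_id r).smul_const (s.edgeVec i)).const_add
        (s.param (i.insertNth 0 u))).const_sub x
      exact this.congr_deriv (by rw [one_smul])
    have h2 := (s.smearing.hasFDerivAt (x - s.param (i.insertNth r u))).comp_hasDerivAt r h1
    refine h2.congr_deriv ?_
    rw [map_neg, SchwartzMap.lineDerivOp_apply_eq_fderiv]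
  have hp := s.continuous_param
  have h := setIntegral_deriv_standardSimplex
    (g := fun t => s.smearing (x - s.param t))
    (g' := fun t => -LineDeriv.lineDerivOp (s.edgeVec i) s.smearing (x - s.param t))
    (((SchwartzMap.continuous _).comp (by fun_prop)).neg)
    ((SchwartzMap.continuous _).comp (by fun_prop)) i hd
  rw [integral_neg, ← lineDeriv_smear] at h
  linarith

/-- Solving ∑ tⱼ = 1 for tᵢ parametrizes the face opposite s₀ with origin at sᵢ₊₁, whereas `face 0`
has its origin at s₁. The two differ by a permutation of the vertices: none for i = 0, a reflection
for i = 1, a reflection and a transposition for i = 2. -/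
lemma integral_far_face (s : Simplex 3) (i : Fin 3) (x : Spacetime) :
    ∫ u in standardSimplex 2, s.smearing (x - s.param (i.insertNth (1 - ∑ j, u j) u))
      = (s.face 0).smear x := by
  have hp := (s.face 0).continuous_param
  have hg : Continuous fun u => s.smearing (x - (s.face 0).param u) :=
    (SchwartzMap.continuous _).comp (by fun_prop)
  rw [smear_apply]
  change _ = ∫ u in standardSimplex 2, s.smearing (x - (s.face 0).param u)
  fin_cases i
  · congr 1
    funext u
    congr 2
    ext α
    simp [param, face, Fin.sum_univ_succ]
    ring
  · have h0 : ∀ a (u : Fin 2 → ℝ), (Fin.insertNth (1 : Fin 3) a u : Fin 3 → ℝ) 0 = u 0 :=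
      fun _ _ => rfl
    have h2 : ∀ a (u : Fin 2 → ℝ), (Fin.insertNth (1 : Fin 3) a u : Fin 3 → ℝ) 2 = u 1 :=
      fun _ _ => rfl
    rw [← setIntegral_reflectSimplex hg 0]
    congr 1
    funext u
    congr 2
    ext α
    simp [param, face, Fin.sum_univ_succ, reflectSimplex, h0, h2]
    ring
  · have h0 : ∀ a (u : Fin 2 → ℝ), (Fin.insertNth (2 : Fin 3) a u : Fin 3 → ℝ) 0 = u 0 :=
      fun _ _ => rfl
    have h1 : ∀ a (u : Fin 2 → ℝ), (Fin.insertNth (2 : Fin 3) a u : Fin 3 → ℝ) 1 = u 1 :=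
      fun _ _ => rfl
    rw [← setIntegral_reflectSimplex hg 1,
      ← setIntegral_permute (fun u => s.smearing (x - (s.face 0).param (reflectSimplex 1 u)))
        (Equiv.swap 0 1)]
    congr 1
    funext u
    congr 2
    ext α
    simp [param, face, Fin.sum_univ_succ, reflectSimplex, h0, h1]
    ring

lemma lineDeriv_edgeVec (s : Simplex 3) (i : Fin 3) :
    LineDeriv.lineDerivOp (s.edgeVec i) s.smear = (s.face i.succ).smear - (s.face 0).smear := by
  ext x
  rw [lineDeriv_edgeVec_smear, integral_far_face]
  simp only [← param_face_succ]
  rfl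

lemma lineDeriv_eq_sum (v : Spacetime) (f : TestFunction) :
    LineDeriv.lineDerivOp v f = ∑ α, v α • partialDeriv α f := by
  conv_lhs => rw [pi_eq_sum_univ' v, LineDeriv.lineDerivOp_left_sum]
  refine Finset.sum_congr rfl fun α _ => ?_
  rw [LineDeriv.lineDerivOp_left_smul, partialDeriv]

lemma jacobian_two (s : Simplex 2) (μ ν : Fin 4) :
    s.jacobian ![μ, ν] = s.edgeVec 0 μ * s.edgeVec 1 ν - s.edgeVec 1 μ * s.edgeVec 0 ν := by
  simp [jacobian, Matrix.det_fin_two, edgeVec]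

lemma jacobian_three (s : Simplex 3) (σ μ ν : Fin 4) :
    s.jacobian ![σ, μ, ν] =
      s.edgeVec 0 σ * (s.edgeVec 1 μ * s.edgeVec 2 ν - s.edgeVec 2 μ * s.edgeVec 1 ν)
      - s.edgeVec 1 σ * (s.edgeVec 0 μ * s.edgeVec 2 ν - s.edgeVec 2 μ * s.edgeVec 0 ν)
      + s.edgeVec 2 σ * (s.edgeVec 0 μ * s.edgeVec 1 ν - s.edgeVec 1 μ * s.edgeVec 0 ν) := by
  simp [jacobian, Matrix.det_fin_three, edgeVec]
  ring

end Simplex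

namespace Chain

variable {n : ℕ}

lemma form_single (s : Simplex n) (m : ℤ) (α : Fin n → Fin 4) :
    form (Finsupp.single s m) α = m • s.form α := by
  exact Finsupp.sum_single_index (h := fun (s : Simplex n) (m : ℤ) => m • s.form α) (zero_smul _ _)

lemma form_add (φ ψ : Chain n) (α : Fin n → Fin 4) : form (φ + ψ) α = form φ α + form ψ α := by
  exact Finsupp.sum_add_index' (h := fun (s : Simplex n) (m : ℤ) => m • s.form α) (fun s => zero_smul _ _)
    (fun s a b => add_smul a b _)

lemma form_zero (α : Fin n → Fin 4) : form (0 : Chain n) α = 0 := Finsupp.sum_zero_index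

lemma form_sum {ι : Type*} (t : Finset ι) (φ : ι → Chain n) (α : Fin n → Fin 4) :
    form (∑ i ∈ t, φ i) α = ∑ i ∈ t, form (φ i) α := by
  classical
  induction t using Finset.induction_on with
  | empty => simp [form_zero]
  | insert i t hi ih => rw [Finset.sum_insert hi, Finset.sum_insert hi, form_add, ih]

end Chain

/-- Stokes' theorem for smearing `3`-simplices. -/
lemma Simplex.form_boundary (s : Simplex 3) (μ ν : Fin 4) :
    s.boundary.form ![μ, ν] = -∑ σ, s.jacobian ![σ, μ, ν] • partialDeriv σ s.smear := by
  -- Expanding the determinant along its σ-row turns the divergence into derivatives along the three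
  -- edge vectors, each of which is a difference of two faces.
  have h : ∑ σ, s.jacobian ![σ, μ, ν] • partialDeriv σ s.smear =
      (s.edgeVec 1 μ * s.edgeVec 2 ν - s.edgeVec 2 μ * s.edgeVec 1 ν) •
        ((s.face 1).smear - (s.face 0).smear)
      - (s.edgeVec 0 μ * s.edgeVec 2 ν - s.edgeVec 2 μ * s.edgeVec 0 ν) •
        ((s.face 2).smear - (s.face 0).smear)
      + (s.edgeVec 0 μ * s.edgeVec 1 ν - s.edgeVec 1 μ * s.edgeVec 0 ν) •
        ((s.face 3).smear - (s.face 0).smear) := by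
    have h0 := s.lineDeriv_edgeVec 0
    have h1 := s.lineDeriv_edgeVec 1
    have h2 := s.lineDeriv_edgeVec 2
    rw [lineDeriv_eq_sum] at h0 h1 h2
    change _ = (s.face 1).smear - _ at h0
    change _ = (s.face 2).smear - _ at h1
    change _ = (s.face 3).smear - _ at h2
    rw [← h0, ← h1, ← h2, Finset.smul_sum, Finset.smul_sum, Finset.smul_sum,
      ← Finset.sum_sub_distrib, ← Finset.sum_add_distrib]
    refine Finset.sum_congr rfl fun σ _ => ?_
    rw [jacobian_three]
    module
  have e4 : ∀ g : Fin (2 + 2) → TestFunction, ∑ i, g i = g 0 + g 1 + g 2 + g 3 :=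
    fun g => Fin.sum_univ_four g
  have hj : ∀ i : Fin 4, (s.face i).jacobian ![μ, ν] =
      (s.vertex (i.succAbove 1) μ - s.vertex (i.succAbove 0) μ)
        * (s.vertex (i.succAbove 2) ν - s.vertex (i.succAbove 0) ν)
      - (s.vertex (i.succAbove 2) μ - s.vertex (i.succAbove 0) μ)
        * (s.vertex (i.succAbove 1) ν - s.vertex (i.succAbove 0) ν) :=
    fun i => jacobian_two (s.face i) μ ν
  have hv : ∀ (i : Fin 3) α, s.edgeVec i α = s.vertex i.succ α - s.vertex 0 α := fun _ _ => rfl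
  rw [h, boundary, Chain.form_sum, e4]
  simp only [Chain.form_single, form, hv]
  erw [hj 0, hj 1, hj 2, hj 3]
  simp [Fin.succAbove]
  module

/-! ### Symmetries of the forms -/

namespace Triangle

lemma smear_opposite (c : Triangle) : Simplex.smear (Triangle.opposite c) = Simplex.smear c := by
  ext x
  rw [Simplex.smear_apply, Simplex.smear_apply,
    ← setIntegral_permute (fun t => c.smearing (x - c.param t)) (Equiv.swap 0 1)]
  congr 1
  funext t
  change c.smearing (x - Simplex.param (opposite c) t) = c.smearing (x - c.param (t ∘ Equiv.swap 0 1))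
  congr 2
  ext α
  simp [Simplex.param, opposite, Fin.sum_univ_succ]
  ring

lemma form_opposite (c : Triangle) (μ ν : Fin 4) :
    Simplex.form (Triangle.opposite c) ![μ, ν] = -Simplex.form c ![μ, ν] := by
  rw [Simplex.form, Simplex.form, smear_opposite, ← neg_smul, Simplex.jacobian_two,
    Simplex.jacobian_two]
  congr 1
  simp [Simplex.edgeVec, opposite]

lemma form_of_isDegenerate (c : Triangle) (hc : Simplex.IsDegenerate c) (μ ν : Fin 4) :
    Simplex.form c ![μ, ν] = 0 := by
  have h : c.vertex 0 = c.vertex 1 ∨ c.vertex 0 = c.vertex 2 ∨ c.vertex 1 = c.vertex 2 := by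
    by_contra! hne
    refine hc fun i j hij => ?_
    fin_cases i <;> fin_cases j <;> simp_all [eq_comm]
  rw [Simplex.form, Simplex.jacobian_two]
  have e0 : Simplex.edgeVec c 0 = c.vertex 1 - c.vertex 0 := rfl
  have e1 : Simplex.edgeVec c 1 = c.vertex 2 - c.vertex 0 := rfl
  rcases h with h | h | h <;> simp [e0, e1, h, mul_comm]

lemma tsupport_form_subset {n : ℕ} (s : Simplex n) (α : Fin n → Fin 4) :
    tsupport (s.form α) ⊆ s.support :=
  closure_mono fun _ hx => ⟨α, hx⟩

end Triangle

lemma Chain.tsupport_form_subset {n : ℕ} (φ : Chain n) (α : Fin n → Fin 4) :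
    tsupport (φ.form α) ⊆ φ.support :=
  closure_mono fun _ hx => ⟨α, hx⟩

lemma sum_comm_pairs {ι M : Type*} [Fintype ι] [AddCommMonoid M] (φ : ι → ι → ι → ι → M) :
    ∑ a, ∑ b, ∑ c, ∑ d, φ a b c d = ∑ c, ∑ d, ∑ a, ∑ b, φ a b c d := by
  have h := Finset.sum_comm (s := Finset.univ) (t := Finset.univ)
    (f := fun (p q : ι × ι) => φ p.1 p.2 q.1 q.2)
  simpa only [Fintype.sum_prod_type] using h

lemma sum_cyclic {ι M : Type*} [Fintype ι] [AddCommMonoid M] (φ : ι → ι → ι → M) :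
    ∑ a, ∑ b, ∑ c, φ b c a = ∑ a, ∑ b, ∑ c, φ a b c := by
  rw [Finset.sum_comm]
  exact Finset.sum_congr rfl fun b _ => Finset.sum_comm

/-- The smearing function is moved by the Lorentz part only; the translation enters through the
vertices, and together they amount to the action of P. -/
lemma Simplex.smear_smul_eq {n : ℕ} (P : Poincare) (s : Simplex n) :
    (P • s).smear = transform P s.smear := by
  ext x
  rw [transform_apply, ← Simplex.smear_smul P s (P⁻¹ • x), smul_inv_smul]

lemma CausallyDisjoint.mono {X Y X' Y' : Set Spacetime} (h : CausallyDisjoint X Y) (hX : X' ⊆ X)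
    (hY : Y' ⊆ Y) : CausallyDisjoint X' Y' := fun x hx y hy => h x (hX hx) y (hY hy)

/-- Since L⁻¹ = gLᵀg, lowering and raising indices leaves the transpose. The coefficients in the
covariance law are therefore those by which Jacobians transform. -/
lemma lowered_inv (P : Poincare) (μ α : Fin 4) : lowered P⁻¹.lor μ α = P.lor α μ := by
  have e : metric * P⁻¹.lor * metric = P.lor.transpose := by
    rw [Poincare.inv_lor]
    calc metric * (metric * P.lor.transpose * metric) * metric
        = (metric * metric) * P.lor.transpose * (metric * metric) := by simp only [mul_assoc]
      _ = _ := by rw [metric_mul_metric, one_mul, mul_one]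
  rw [lowered, e, Matrix.transpose_apply]

lemma Simplex.edgeVec_smul {n : ℕ} (P : Poincare) (s : Simplex n) (i : Fin n) (α : Fin 4) :
    (P • s).edgeVec i α = ∑ μ, P.lor α μ * s.edgeVec i μ := by
  rw [edgeVec, smul_vertex, smul_vertex, Poincare.smul_sub_smul]
  rfl

lemma Triangle.jacobian_smul (P : Poincare) (c : Triangle) (α β : Fin 4) :
    Simplex.jacobian (P • c) ![α, β]
      = ∑ μ, ∑ ν, P.lor α μ * P.lor β ν * Simplex.jacobian c ![μ, ν] := by
  simp only [Simplex.jacobian_two, Simplex.edgeVec_smul, Finset.sum_mul_sum]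
  rw [← Finset.sum_sub_distrib]
  refine Finset.sum_congr rfl fun μ _ => ?_
  rw [← Finset.sum_sub_distrib]
  refine Finset.sum_congr rfl fun ν _ => ?_
  ring

/-! ### Contractions of the field: causality, covariance, vanishing on boundaries -/

namespace QuantumEMField

open scoped InnerProductSpace

variable {H : Type*} [NormedAddCommGroup H] [InnerProductSpace ℂ H] [CompleteSpace H]
  (Q : QuantumEMField H)

lemma eq_of_inner {x y : Q.D} (h : ∀ φ : Q.D, ⟪(φ : H), (x : H)⟫_ℂ = ⟪(φ : H), (y : H)⟫_ℂ) : x = y :=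
  Subtype.ext (Q.dense_D.eq_of_inner_right ℂ fun φ hφ => h ⟨φ, hφ⟩)

/-- Linearity in f is assumed for matrix elements only; density of D makes it an identity of
operators. -/
lemma F_add (μ ν : Fin 4) (f g : TestFunction) : Q.F μ ν (f + g) = Q.F μ ν f + Q.F μ ν g := by
  ext1 ψ
  refine Q.eq_of_inner fun φ => ?_
  obtain ⟨T, hT⟩ := Q.tempered μ ν φ ψ
  rw [← hT, map_add, hT, hT, ← inner_add_right]
  rfl

lemma F_smul (μ ν : Fin 4) (r : ℝ) (f : TestFunction) : Q.F μ ν (r • f) = (r : ℂ) • Q.F μ ν f := by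
  ext1 ψ
  refine Q.eq_of_inner fun φ => ?_
  obtain ⟨T, hT⟩ := Q.tempered μ ν φ ψ
  rw [← hT, map_smul, hT, ← Complex.coe_smul, smul_eq_mul, ← inner_smul_right]
  rfl

/-- The field as a real-linear map of test functions. -/
def fieldMap (μ ν : Fin 4) : TestFunction →ₗ[ℝ] (Q.D →ₗ[ℂ] Q.D) where
  toFun := Q.F μ ν
  map_add' := Q.F_add μ ν
  map_smul' r f := by
    rw [Q.F_smul]
    ext ψ
    simp

lemma fieldMap_apply (μ ν : Fin 4) (f : TestFunction) : Q.fieldMap μ ν f = Q.F μ ν f := rfl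

/-- The contraction `F_{μν}(h^{μν})`. -/
def contraction (h : Fin 4 → Fin 4 → TestFunction) : Q.D →ₗ[ℂ] Q.D :=
  ∑ μ, ∑ ν, Q.F μ ν (h μ ν)

lemma isEssentiallySelfAdjoint_contraction (h : Fin 4 → Fin 4 → TestFunction) :
    IsEssentiallySelfAdjoint (unbounded (Q.contraction h)) :=
  Q.essentiallySelfAdjoint₂ h

lemma contraction_smul (r : ℝ) (h : Fin 4 → Fin 4 → TestFunction) :
    Q.contraction (fun μ ν => r • h μ ν) = (r : ℂ) • Q.contraction h := by
  simp only [contraction, F_smul, Finset.smul_sum]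

lemma surfaceIntegral_eq (c : Triangle) : Q.surfaceIntegral c =
    Q.contraction fun μ ν => (1 / 2 : ℝ) • c.form ![μ, ν] := by
  rw [contraction_smul, surfaceIntegral, contraction]
  norm_num

lemma isEssentiallySelfAdjoint_surfaceIntegral (c : Triangle) :
    IsEssentiallySelfAdjoint (unbounded (Q.surfaceIntegral c)) := by
  rw [surfaceIntegral_eq]
  exact Q.isEssentiallySelfAdjoint_contraction _

/-- All real multiples r of the components are required because `commute_expI_sum` needs T to
commute with the entire one-parameter groups. -/
lemma commute_of_commute_field {T : H →L[ℂ] H} (h : Fin 4 → Fin 4 → TestFunction)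
    (hT : ∀ μ ν (r : ℝ), Commute T (expI (unbounded (Q.F μ ν (r • h μ ν))).closure : H →L[ℂ] H)) :
    Commute T (expI (unbounded (Q.contraction h)).closure : H →L[ℂ] H) := by
  have e : Q.contraction h = ∑ i : Fin 4 × Fin 4, Q.F i.1 i.2 (h i.1 i.2) := by
    rw [contraction, Fintype.sum_prod_type]
  have hs := Q.isEssentiallySelfAdjoint_contraction h
  rw [e] at hs ⊢
  refine commute_expI_sum _ _ (fun i _ r => ?_) hs fun i _ r => ?_
  · rw [← F_smul]
    exact Q.essentiallySelfAdjoint _ _ _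
  · rw [← F_smul]
    exact hT i.1 i.2 r

lemma commute_contraction {h h' : Fin 4 → Fin 4 → TestFunction}
    (hh : ∀ μ ν α β, CausallyDisjoint (tsupport (h μ ν)) (tsupport (h' α β))) :
    Commute (expI (unbounded (Q.contraction h)).closure)
      (expI (unbounded (Q.contraction h')).closure) := by
  have hts : ∀ (r : ℝ) (f : TestFunction), tsupport (r • f : TestFunction) ⊆ tsupport f := fun r f =>
    closure_mono fun x hx h0 => hx (by
      change r • f x = 0
      rw [h0, smul_zero])
  have key : Commute (expI (unbounded (Q.contraction h)).closure : H →L[ℂ] H)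
      (expI (unbounded (Q.contraction h')).closure : H →L[ℂ] H) := by
    -- The contractions are resolved into components one at a time: first h' with exp(iF(h)) as the
    -- bounded operator, then h with a component exponential of h' in that role.
    refine Q.commute_of_commute_field h' fun α β r => Commute.symm ?_
    refine Q.commute_of_commute_field h fun μ ν r' => Commute.symm ?_
    exact congrArg Subtype.val
      (Q.strong_causality μ ν α β _ _ ((hh μ ν α β).mono (hts _ _) (hts _ _))).eq
  exact Subtype.ext key.eq

lemma star_emCochain (c : Triangle) : star (Q.emCochain c) = Q.emCochain c.opposite := by
  have e : Q.surfaceIntegral c.opposite = -Q.surfaceIntegral c := by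
    simp only [surfaceIntegral, Triangle.form_opposite, ← fieldMap_apply, map_neg,
      Finset.sum_neg_distrib, smul_neg]
  have h := Q.isEssentiallySelfAdjoint_surfaceIntegral c.opposite
  rw [e] at h
  rw [emCochain, emCochain, e, expI_neg (Q.isEssentiallySelfAdjoint_surfaceIntegral c) h]

lemma emCochain_of_isDegenerate (c : Triangle) (hc : c.IsDegenerate) : Q.emCochain c = 1 := by
  have e : Q.surfaceIntegral c = 0 := by
    simp [surfaceIntegral, Triangle.form_of_isDegenerate c hc, ← fieldMap_apply]
  have h := Q.isEssentiallySelfAdjoint_surfaceIntegral c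
  rw [emCochain]
  rw [e] at h ⊢
  exact expI_zero h

lemma commute_emCochain (c₁ c₂ : Triangle) (h : CausallyDisjoint c₁.support c₂.support) :
    Commute (Q.emCochain c₁) (Q.emCochain c₂) := by
  rw [emCochain, emCochain, surfaceIntegral_eq, surfaceIntegral_eq]
  have hts : ∀ (r : ℝ) (f : TestFunction), tsupport (r • f : TestFunction) ⊆ tsupport f := fun r f =>
    closure_mono fun x hx h0 => hx (by
      change r • f x = 0
      rw [h0, smul_zero])
  exact Q.commute_contraction fun μ ν α β => h.mono
    ((hts _ _).trans (Triangle.tsupport_form_subset c₁ _))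
    ((hts _ _).trans (Triangle.tsupport_form_subset c₂ _))

/-- U(P) moves the matrices L from the field indices to the Jacobian, where they produce exactly the
Jacobian of the transformed triangle; this holds on D, which U(P) preserves. -/
lemma U_surfaceIntegral (P : Poincare) (c : Triangle) (ψ : Q.D) :
    (Q.U P : H →L[ℂ] H) (Q.surfaceIntegral c ψ) =
      Q.surfaceIntegral (P • c) ⟨(Q.U P : H →L[ℂ] H) ψ, Q.U_mem P ψ ψ.2⟩ := by
  set χ : Q.D := ⟨(Q.U P : H →L[ℂ] H) ψ, Q.U_mem P ψ ψ.2⟩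
  have h1 : ∀ μ ν f, (Q.U P : H →L[ℂ] H) (Q.F μ ν f ψ) =
      ((∑ α, ∑ β, (P.lor α μ * P.lor β ν : ℝ) • Q.F α β (transform P f) χ : Q.D) : H) := by
    intro μ ν f
    rw [Q.covariance P μ ν f ψ]
    simp only [lowered_inv, Submodule.coe_sum]
    refine Finset.sum_congr rfl fun α _ => Finset.sum_congr rfl fun β _ => ?_
    rw [Complex.coe_smul]
    rfl
  have h2 : ∀ α β, Q.F α β ((P • c).form ![α, β]) χ = ∑ μ, ∑ ν,
      (P.lor α μ * P.lor β ν * c.jacobian ![μ, ν] : ℝ) • Q.F α β (transform P c.smear) χ := by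
    intro α β
    rw [Simplex.form, Triangle.jacobian_smul, Simplex.smear_smul_eq, ← fieldMap_apply, map_smul]
    simp only [Finset.sum_smul]
    rfl
  have h3 : ∀ μ ν, Q.F μ ν (c.form ![μ, ν]) = (c.jacobian ![μ, ν]) • Q.F μ ν c.smear := by
    intro μ ν
    rw [Simplex.form, ← fieldMap_apply, map_smul]
    rfl
  have h4 : (Q.U P : H →L[ℂ] H) ((∑ μ, ∑ ν, Q.F μ ν (c.form ![μ, ν]) : Q.D →ₗ[ℂ] Q.D) ψ) =
      ((∑ α, ∑ β, Q.F α β ((P • c).form ![α, β]) : Q.D →ₗ[ℂ] Q.D) χ) := by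
    have h5 : ∀ μ ν, (Q.U P : H →L[ℂ] H) (Q.F μ ν (c.form ![μ, ν]) ψ) = ((∑ α, ∑ β,
        (P.lor α μ * P.lor β ν * c.jacobian ![μ, ν]) • Q.F α β (transform P c.smear) χ : Q.D) : H) := by
      intro μ ν
      have e : ((c.jacobian ![μ, ν] • Q.F μ ν c.smear ψ : Q.D) : H)
          = ((c.jacobian ![μ, ν] : ℝ) : ℂ) • (Q.F μ ν c.smear ψ : H) := by
        rw [Complex.coe_smul]; rfl
      have e' : ∀ x : Q.D, ((c.jacobian ![μ, ν] : ℝ) : ℂ) • (x : H)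
          = ((c.jacobian ![μ, ν] • x : Q.D) : H) := fun x => by rw [Complex.coe_smul]; rfl
      rw [h3, LinearMap.smul_apply, e, map_smul, h1, e']
      simp only [Finset.smul_sum, smul_smul]
      congr 1
      refine Finset.sum_congr rfl fun α _ => Finset.sum_congr rfl fun β _ => ?_
      congr 1
      ring
    simp only [LinearMap.sum_apply, h2]
    rw [Submodule.coe_sum, map_sum]
    simp only [Submodule.coe_sum (p := Q.D), map_sum, h5]
    simp only [← Submodule.coe_sum]
    congr 1
    exact sum_comm_pairs _
  rw [surfaceIntegral, surfaceIntegral, LinearMap.smul_apply, LinearMap.smul_apply,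
    Submodule.coe_smul, Submodule.coe_smul, map_smul, h4]

lemma covariant_emCochain (P : Poincare) (c : Triangle) :
    Q.U P * Q.emCochain c * star (Q.U P) = Q.emCochain (P • c) := by
  have h := expI_intertwine (Q.isEssentiallySelfAdjoint_surfaceIntegral c)
    (Q.isEssentiallySelfAdjoint_surfaceIntegral (P • c)) (T := (Q.U P : H →L[ℂ] H)) fun ψ => by
      rw [U_surfaceIntegral]
      exact apply_mem_graph_closure (⟨_, Q.U_mem P ψ ψ.2⟩ : Q.D)
  have h' : Q.U P * Q.emCochain c = Q.emCochain (P • c) * Q.U P := Subtype.ext h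
  rw [h', mul_assoc, Unitary.mul_star_self, mul_one]

theorem isCausalCovariantCochain_emCochain : IsCausalCovariantCochain Q.emCochain Q.U where
  star_eq := Q.star_emCochain
  degenerate := Q.emCochain_of_isDegenerate
  causal := Q.commute_emCochain
  covariant := Q.covariant_emCochain

/-- Stokes gives −∑ J^{σμν} F_{μν}(∂_σ s). Since J is invariant under cyclic permutations, this sum
equals each of its two cyclic rearrangements, and the three together contain the Maxwell expression.
-/
lemma contraction_boundary (s : Simplex 3) :
    Q.contraction (fun μ ν => s.boundary.form ![μ, ν]) = 0 := by
  set G : Fin 4 → Fin 4 → Fin 4 → (Q.D →ₗ[ℂ] Q.D) := fun σ μ ν => Q.F μ ν (partialDeriv σ s.smear)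
  set J : Fin 4 → Fin 4 → Fin 4 → ℝ := fun σ μ ν => s.jacobian ![σ, μ, ν]
  have hJ : ∀ a b c, J b c a = J a b c := fun a b c => by
    simp only [J, Simplex.jacobian_three]
    ring
  have hG : ∀ a b c, G a b c + G b c a + G c a b = 0 := fun a b c => Q.maxwell a b c s.smear
  have h1 : Q.contraction (fun μ ν => s.boundary.form ![μ, ν]) =
      -∑ σ, ∑ μ, ∑ ν, J σ μ ν • G σ μ ν := by
    simp only [contraction, Simplex.form_boundary, ← fieldMap_apply, map_neg, map_sum, map_smul,
      Finset.sum_neg_distrib]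
    exact congrArg Neg.neg (sum_cyclic fun a b c => J c a b • G c a b).symm
  have h2 : ∑ σ, ∑ μ, ∑ ν, J σ μ ν • G σ μ ν = ∑ σ, ∑ μ, ∑ ν, J σ μ ν • G μ ν σ := by
    rw [← sum_cyclic]
    simp only [hJ]
  have h3 : ∑ σ, ∑ μ, ∑ ν, J σ μ ν • G σ μ ν = ∑ σ, ∑ μ, ∑ ν, J σ μ ν • G ν σ μ := by
    rw [h2, ← sum_cyclic]
    simp only [hJ]
  have h4 : (3 : ℝ) • ∑ σ, ∑ μ, ∑ ν, J σ μ ν • G σ μ ν = 0 := by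
    have e : (3 : ℝ) • ∑ σ, ∑ μ, ∑ ν, J σ μ ν • G σ μ ν = (∑ σ, ∑ μ, ∑ ν, J σ μ ν • G σ μ ν)
        + (∑ σ, ∑ μ, ∑ ν, J σ μ ν • G μ ν σ) + ∑ σ, ∑ μ, ∑ ν, J σ μ ν • G ν σ μ := by
      rw [← h2, ← h3]
      module
    rw [e]
    simp only [← Finset.sum_add_distrib, ← smul_add, hG, smul_zero, Finset.sum_const_zero]
  rw [h1, (smul_eq_zero.1 h4).resolve_left (by norm_num), neg_zero]

end QuantumEMField

/-! ### Edges and words -/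

namespace Edge

lemma opposite_opposite (b : Edge) : Edge.opposite (Edge.opposite b) = b := by
  refine Simplex.ext ?_ rfl
  funext i
  fin_cases i <;> rfl

lemma isDegenerate_iff (b : Edge) : Simplex.IsDegenerate b ↔ b.vertex 0 = b.vertex 1 := by
  rw [Simplex.IsDegenerate, not_iff_comm]
  constructor
  · intro h i j hij
    fin_cases i <;> fin_cases j <;> simp_all [eq_comm]
  · intro h e
    exact zero_ne_one (h e)

lemma isDegenerate_opposite (b : Edge) :
    Simplex.IsDegenerate (Edge.opposite b) ↔ Simplex.IsDegenerate b := by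
  rw [isDegenerate_iff, isDegenerate_iff]
  exact eq_comm

lemma face_opposite_zero (b : Edge) : (Edge.opposite b).face 0 = Simplex.face 1 b := by
  refine Simplex.ext ?_ rfl
  funext i
  fin_cases i
  rfl

lemma face_opposite_one (b : Edge) : (Edge.opposite b).face 1 = Simplex.face 0 b := by
  refine Simplex.ext ?_ rfl
  funext i
  fin_cases i
  rfl

lemma face_zero_eq_face_one_iff (b : Edge) :
    Simplex.face 0 b = Simplex.face 1 b ↔ Simplex.IsDegenerate b := by
  rw [isDegenerate_iff]
  constructor
  · intro h
    exact (congrFun (congrArg Simplex.vertex h) 0).symm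
  · intro h
    refine Simplex.ext ?_ rfl
    funext i
    fin_cases i
    exact h.symm

lemma eq_trivialLoop (b : Edge) (h : Simplex.IsDegenerate b) :
    b = Point.trivialLoop (Simplex.face 0 b) := by
  rw [isDegenerate_iff] at h
  refine Simplex.ext ?_ rfl
  funext i
  fin_cases i
  · exact h
  · rfl

end Edge

lemma of_mul_of_opposite (b : Edge) : (PresentedGroup.of b : EdgeGroup)
    * PresentedGroup.of (Edge.opposite b) = 1 :=
  PresentedGroup.one_of_mem (rels := edgeRelations) (Or.inl ⟨b, rfl⟩)

lemma of_eq_one {b : Edge} (h : Simplex.IsDegenerate b) : (PresentedGroup.of b : EdgeGroup) = 1 := by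
  rw [Edge.eq_trivialLoop b h]
  exact PresentedGroup.one_of_mem (rels := edgeRelations) (Or.inr ⟨_, rfl⟩)

lemma of_opposite (b : Edge) :
    (PresentedGroup.of (Edge.opposite b) : EdgeGroup) = (PresentedGroup.of b)⁻¹ :=
  eq_inv_of_mul_eq_one_right (of_mul_of_opposite b)

lemma wordClass_cons (b : Edge) (w : List Edge) :
    wordClass (b :: w) = PresentedGroup.of b * wordClass w := by
  simp [wordClass]

lemma wordClass_append (w w' : List Edge) : wordClass (w ++ w') = wordClass w * wordClass w' := by
  simp [wordClass]

lemma wordClass_nil : wordClass [] = 1 := rfl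

lemma wordClass_reverse (w : List Edge) :
    wordClass (w.map Edge.opposite).reverse = (wordClass w)⁻¹ := by
  induction w with
  | nil => simp [wordClass]
  | cons b w ih =>
    rw [List.map_cons, List.reverse_cons, wordClass_append, ih, wordClass_cons b w, mul_inv_rev,
      wordClass_cons, of_opposite, wordClass_nil, mul_one]

/-- A homomorphism out of the group of edges is determined by invertible images of the edges. -/
def edgeLift {G : Type*} [Group G] (φ : Edge → G) (h : ∀ b, φ b * φ (Edge.opposite b) = 1)
    (h' : ∀ b, Simplex.IsDegenerate b → φ b = 1) : EdgeGroup →* G :=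
  PresentedGroup.toGroup (f := φ) (by
    rintro r (⟨b, rfl⟩ | ⟨a, rfl⟩)
    · rw [map_mul, FreeGroup.lift_apply_of, FreeGroup.lift_apply_of, h]
    · rw [FreeGroup.lift_apply_of]
      exact h' _ ((Edge.isDegenerate_iff _).2 rfl))

lemma edgeLift_of {G : Type*} [Group G] (φ : Edge → G) (h h') (b : Edge) :
    edgeLift φ h h' (PresentedGroup.of b) = φ b :=
  PresentedGroup.toGroup.of _

lemma edgeLift_wordClass_cons {G : Type*} [Group G] (φ : Edge → G) (h h') (b : Edge)
    (w : List Edge) :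
    edgeLift φ h h' (wordClass (b :: w)) = φ b * edgeLift φ h h' (wordClass w) := by
  rw [wordClass_cons, map_mul, edgeLift_of]

/-! ### The action on reduced words -/

open Classical in
/-- Multiplication of a reduced word by an edge. -/
def pushEdge (b : Edge) (w : List Edge) : List Edge :=
  if Simplex.IsDegenerate b then w else
    match w with
    | [] => [b]
    | b' :: w' => if b' = Edge.opposite b then w' else b :: b' :: w'

lemma pushEdge_of_isDegenerate {b : Edge} (h : Simplex.IsDegenerate b) (w : List Edge) :
    pushEdge b w = w := if_pos h

lemma pushEdge_nil {b : Edge} (h : ¬ Simplex.IsDegenerate b) : pushEdge b [] = [b] := by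
  simp [pushEdge, h]

lemma pushEdge_opposite {b : Edge} (h : ¬ Simplex.IsDegenerate b) (w : List Edge) :
    pushEdge b (Edge.opposite b :: w) = w := by
  simp [pushEdge, h]

lemma pushEdge_cons {b b' : Edge} (h : ¬ Simplex.IsDegenerate b) (hb : b' ≠ Edge.opposite b)
    (w : List Edge) : pushEdge b (b' :: w) = b :: b' :: w := by
  simp [pushEdge, h, hb]

lemma pushEdge_cases {motive : List Edge → Prop} {b : Edge} (h : ¬ Simplex.IsDegenerate b)
    (w : List Edge) (cancel : ∀ w', w = Edge.opposite b :: w' → motive w')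
    (push : (∀ w', w ≠ Edge.opposite b :: w') → motive (b :: w)) : motive (pushEdge b w) := by
  match w with
  | [] =>
    rw [pushEdge_nil h]
    exact push (by simp)
  | b' :: w' =>
    by_cases hb : b' = Edge.opposite b
    · rw [hb, pushEdge_opposite h]
      exact cancel w' (by rw [hb])
    · rw [pushEdge_cons h hb]
      exact push fun w'' e => hb (List.cons.inj e).1

lemma isReduced_cons {b : Edge} {w : List Edge} : IsReduced (b :: w) ↔
    ¬ Simplex.IsDegenerate b ∧ (∀ w', w ≠ Edge.opposite b :: w') ∧ IsReduced w := by
  cases w with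
  | nil => simp [IsReduced]
  | cons b' w =>
    simp only [IsReduced, List.mem_cons, forall_eq_or_imp, List.isChain_cons_cons, ne_eq,
      List.cons.injEq, not_and]
    constructor
    · rintro ⟨⟨h1, h2, h3⟩, h4, h5⟩
      exact ⟨h1, fun w' h => absurd h h4, ⟨h2, h3⟩, h5⟩
    · rintro ⟨h1, h2, ⟨h3, h4⟩, h5⟩
      exact ⟨⟨h1, h3, h4⟩, fun h => h2 w h rfl, h5⟩

lemma IsReduced.pushEdge {w : List Edge} (hw : IsReduced w) (b : Edge) :
    IsReduced (pushEdge b w) := by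
  by_cases h : Simplex.IsDegenerate b
  · rwa [pushEdge_of_isDegenerate h]
  · refine pushEdge_cases h w (fun w' e => ?_) fun hne => isReduced_cons.2 ⟨h, hne, hw⟩
    rw [e] at hw
    exact (isReduced_cons.1 hw).2.2

lemma wordClass_pushEdge (b : Edge) (w : List Edge) :
    wordClass (pushEdge b w) = PresentedGroup.of b * wordClass w := by
  by_cases h : Simplex.IsDegenerate b
  · rw [pushEdge_of_isDegenerate h, of_eq_one h, one_mul]
  · refine pushEdge_cases (motive := fun v => wordClass v = PresentedGroup.of b * wordClass w) h w
      (fun w' e => ?_) fun _ => wordClass_cons b w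
    rw [e, wordClass_cons, ← mul_assoc, of_mul_of_opposite, one_mul]

/-- The delicate case is a word b :: w' from which b̄ removes the leading b. Pushing b back must not
cancel again, and it does not: since b :: w' is reduced, w' cannot begin with b̄. -/
lemma pushEdge_pushEdge {w : List Edge} (hw : IsReduced w) (b : Edge) :
    pushEdge b (pushEdge (Edge.opposite b) w) = w := by
  by_cases h : Simplex.IsDegenerate b
  · rw [pushEdge_of_isDegenerate h, pushEdge_of_isDegenerate ((Edge.isDegenerate_opposite b).2 h)]
  · have h' := mt (Edge.isDegenerate_opposite b).1 h
    refine pushEdge_cases (motive := fun v => pushEdge b v = w) h' w (fun w' e => ?_)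
      fun _ => pushEdge_opposite h w
    subst e
    rw [Edge.opposite_opposite] at hw ⊢
    refine pushEdge_cases (motive := fun v => v = b :: w') h w' (fun w'' e => ?_) fun _ => rfl
    exact absurd e ((isReduced_cons.1 hw).2.1 w'')

/-- The permutation of the reduced words given by an edge. -/
def pushPerm (b : Edge) : Equiv.Perm {w : List Edge // IsReduced w} where
  toFun w := ⟨pushEdge b w, w.2.pushEdge b⟩
  invFun w := ⟨pushEdge (Edge.opposite b) w, w.2.pushEdge _⟩
  left_inv w := Subtype.ext (by
    have := pushEdge_pushEdge w.2 (Edge.opposite b)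
    rwa [Edge.opposite_opposite] at this)
  right_inv w := Subtype.ext (pushEdge_pushEdge w.2 b)

/-- The action of the group of edges on the reduced words. -/
def reducedAction : EdgeGroup →* Equiv.Perm {w : List Edge // IsReduced w} :=
  edgeLift pushPerm
    (fun b => Equiv.ext fun w => Subtype.ext (pushEdge_pushEdge w.2 b))
    (fun _ h => Equiv.ext fun w => Subtype.ext (pushEdge_of_isDegenerate h w))

lemma isReduced_nil : IsReduced [] := ⟨by simp, by simp⟩

lemma reducedAction_wordClass_cons (b : Edge) (w : List Edge) (v : {w : List Edge // IsReduced w}) :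
    (reducedAction (wordClass (b :: w)) v : List Edge)
      = pushEdge b (reducedAction (wordClass w) v) := by
  rw [reducedAction, edgeLift_wordClass_cons]
  rfl

lemma exists_wordClass_eq (g : EdgeGroup) : ∃ w, wordClass w = g := by
  have h : g ∈ Subgroup.closure (Set.range (PresentedGroup.of (rels := edgeRelations))) := by
    rw [PresentedGroup.closure_range_of]; trivial
  induction h using Subgroup.closure_induction with
  | mem x hx =>
    obtain ⟨b, rfl⟩ := hx
    exact ⟨[b], by simp [wordClass]⟩
  | one => exact ⟨[], rfl⟩
  | mul x y _ _ hx hy =>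
    obtain ⟨w, rfl⟩ := hx
    obtain ⟨w', rfl⟩ := hy
    exact ⟨w ++ w', wordClass_append w w'⟩
  | inv x _ hx =>
    obtain ⟨w, rfl⟩ := hx
    exact ⟨_, wordClass_reverse w⟩

/-- The image of the empty word is a reduced word for g. It is built one edge at a time, so its
shape can be followed by induction along any product representing g. -/
lemma wordClass_reducedAction (g : EdgeGroup) :
    wordClass (reducedAction g ⟨[], isReduced_nil⟩) = g := by
  obtain ⟨w, rfl⟩ := exists_wordClass_eq g
  induction w with
  | nil => rw [wordClass_nil, map_one]; rfl
  | cons b w ih => rw [reducedAction_wordClass_cons, wordClass_pushEdge, ih, wordClass_cons]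

/-! ### Reduced words of the elements of the group of loops -/

lemma IsPath.append : ∀ {w w' : List Edge} {a a' a'' : Point}, IsPath w a' a'' → IsPath w' a a' →
    IsPath (w ++ w') a a''
  | [], _, _, _, _, h, h' => by
    have h : _ = _ := h
    subst h
    exact h'
  | _ :: _, _, _, _, _, h, h' => ⟨h.1, IsPath.append h.2 h'⟩

lemma IsPath.reverse : ∀ {w : List Edge} {a a' : Point}, IsPath w a a' →
    IsPath (w.map Edge.opposite).reverse a' a
  | [], _, _, h => Eq.symm h
  | b :: w, a, a', h => by
    rw [List.map_cons, List.reverse_cons]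
    refine IsPath.append (IsPath.reverse h.2) ⟨Edge.face_opposite_zero b, ?_⟩
    exact h.1.symm.trans (Edge.face_opposite_one b).symm

/-- Induction on the elements of the group of loops. -/
lemma loopGroup_induction {motive : EdgeGroup → Prop} {g : EdgeGroup} (hg : g ∈ loopGroup)
    (one : motive 1) (loop_mul : ∀ (a : Point) (p : List Edge), IsPath p a a → ∀ g, motive g →
      motive (wordClass p * g)) : motive g := by
  refine Subgroup.closure_induction_left (p := fun g _ => motive g) one ?_ ?_ hg
  · rintro _ ⟨a, p, hp, rfl⟩ y _ hy
    exact loop_mul a p hp y hy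
  · rintro _ ⟨a, p, hp, rfl⟩ y _ hy
    rw [← wordClass_reverse]
    exact loop_mul a _ hp.reverse y hy

/-- Words which are concatenations of nonempty loops. -/
inductive IsLoopProduct : List Edge → Prop
  | nil : IsLoopProduct []
  | append {a : Point} {p w : List Edge} : IsPath p a a → p ≠ [] → IsLoopProduct w →
      IsLoopProduct (p ++ w)

/-- Words which consist of a path from `a` to `a'`, preceded by loops. -/
def IsPathLoopProduct (w : List Edge) (a a' : Point) : Prop :=
  ∃ u v, w = u ++ v ∧ IsPath u a a' ∧ IsLoopProduct v

/-- An edge prolongs the current path, cancels its last edge, or, if the path is empty, cancels into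
the loop standing next to it. In every case a path followed by loops remains. -/
lemma IsPathLoopProduct.pushEdge {w : List Edge} {a : Point} {b : Edge}
    (h : IsPathLoopProduct w a (Simplex.face 1 b)) :
    IsPathLoopProduct (pushEdge b w) a (Simplex.face 0 b) := by
  by_cases hb : Simplex.IsDegenerate b
  · rwa [pushEdge_of_isDegenerate hb, (Edge.face_zero_eq_face_one_iff b).2 hb]
  obtain ⟨u, v, rfl, hu, hv⟩ := h
  refine pushEdge_cases (motive := fun w => IsPathLoopProduct w a (Simplex.face 0 b)) hb _
    (fun w' e => ?_) fun _ => ⟨b :: u, v, rfl, ⟨rfl, hu⟩, hv⟩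
  match u with
  | c :: u' =>
    obtain ⟨rfl, rfl⟩ := List.cons.inj e
    refine ⟨u', v, rfl, ?_, hv⟩
    rw [← Edge.face_opposite_one]
    exact hu.2
  | [] =>
    have hu : a = _ := hu
    subst hu
    match hv with
    | .nil => simp at e
    | .append (a := a₁) (p := []) _ hp _ => exact absurd rfl hp
    | .append (a := a₁) (p := c :: p') (w := v') hp _ hv' =>
      obtain ⟨rfl, rfl⟩ := List.cons.inj e
      -- The neighbouring loop c p' is opened: c = b̄ forces its base point to be ∂₁b, which is a,
      -- and what is left of it is a path from a to ∂₀b that becomes the new current path.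
      refine ⟨p', v', rfl, ?_, hv'⟩
      have h1 := hp.1
      rw [Edge.face_opposite_zero] at h1
      subst h1
      rw [← Edge.face_opposite_one]
      exact hp.2

lemma isLoopProduct_reducedAction {g : EdgeGroup} (hg : g ∈ loopGroup) :
    IsLoopProduct (reducedAction g ⟨[], isReduced_nil⟩) := by
  refine loopGroup_induction
    (motive := fun g => IsLoopProduct (reducedAction g ⟨[], isReduced_nil⟩)) hg
    (by rw [map_one]; exact .nil) fun a p hp g hg => ?_
  have key : ∀ (p : List Edge) (a' : Point), IsPath p a a' →
      IsPathLoopProduct (reducedAction (wordClass p * g) ⟨[], isReduced_nil⟩) a a' := by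
    intro p
    induction p with
    | nil =>
      intro a' h
      rw [wordClass_nil, one_mul]
      exact ⟨[], _, rfl, h, hg⟩
    | cons b p ih =>
      rintro a' ⟨rfl, h⟩
      have := (ih _ h).pushEdge
      rw [map_mul] at this ⊢
      rw [Equiv.Perm.mul_apply] at this ⊢
      rwa [reducedAction_wordClass_cons]
  obtain ⟨u, v, e, hu, hv⟩ := key p a hp
  rw [e]
  by_cases h : u = []
  · rw [h]; exact hv
  · exact .append hu h hv

/-- The reduced word of an element of the group of loops is a concatenation of loops. -/
lemma exists_isLoopProduct {g : EdgeGroup} (hg : g ∈ loopGroup) :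
    ∃ w, IsReduced w ∧ wordClass w = g ∧ IsLoopProduct w :=
  ⟨_, (reducedAction g ⟨[], isReduced_nil⟩).2, wordClass_reducedAction g,
    isLoopProduct_reducedAction hg⟩

/-! ### Homomorphisms out of the group of loops -/

section Transport

variable {X G : Type*} [Group G]

open Classical in
/-- One step of the transport of a group element along a path. The state `none` means that the path
has closed at its base point, the state `some (a, z)` that the current path leads from `a` to `z`.
The step is along an edge from `x` to `y` and multiplies by `η a` when the path is prolonged; on the
remaining states it is defined so as to be a bijection. -/
def transportStep (x y : X) (η : X → G) : Option (X × X) × G → Option (X × X) × G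
  | (none, g) => (some (x, y), g)
  | (some (a, z), g) =>
    if z = x then
      if a = y then (none, g) else if a = x then (some (a, z), g) else (some (a, y), η a * g)
    else if z = y then
      if a = x then (some (y, x), g) else if a = y then (some (a, z), g) else (some (a, x), g)
    else (some (a, z), g)

/-- Undoing each branch fixes how the automaton must act on states that no honest path reaches. For
instance `none` goes to (x, y) and (y, x) goes to `none`, so (x, y) has to go to (y, x). -/
lemma transportStep_transportStep {x y : X} (hxy : x ≠ y) {η η' : X → G}
    (hη : ∀ a, η' a * η a = 1) (s : Option (X × X) × G) :
    transportStep y x η' (transportStep x y η s) = s := by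
  obtain ⟨_ | ⟨a, z⟩, g⟩ := s
  · simp [transportStep]
  · by_cases hz : z = x
    · subst hz
      by_cases ha : a = y
      · subst ha; simp [transportStep]
      · by_cases ha' : a = z
        · subst ha'; simp [transportStep, hxy]
        · simp [transportStep, ha, ha', ← mul_assoc, hη]
    · by_cases hz' : z = y
      · subst hz'
        by_cases ha : a = x
        · subst ha; simp [transportStep, hz, Ne.symm hz]
        · by_cases ha' : a = z
          · subst ha'; simp [transportStep, hz]
          · simp [transportStep, hz, ha, ha', hxy]
      · simp [transportStep, hz, hz']

end Transport

variable {G : Type*} [Group G]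

/-- Systems of holonomies `η a b` of the edges `b`, transported to the base points `a`. -/
structure IsHolonomy (η : Point → Edge → G) : Prop where
  opposite : ∀ a b, η a (Edge.opposite b) = (η a b)⁻¹
  degenerate : ∀ a b, Simplex.IsDegenerate b → η a b = 1
  source : ∀ b, η (Simplex.face 1 b) b = 1
  target : ∀ b, η (Simplex.face 0 b) b = 1

namespace IsHolonomy

variable {η : Point → Edge → G} (hη : IsHolonomy η)

open Classical in
/-- The transport along an edge. -/
def transport (η : Point → Edge → G) (b : Edge) (s : Option (Point × Point) × G) :
    Option (Point × Point) × G :=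
  if Simplex.IsDegenerate b then s
  else transportStep (Simplex.face 1 b) (Simplex.face 0 b) (fun a => η a b) s

include hη in
lemma transport_transport (b : Edge) (s : Option (Point × Point) × G) :
    transport η b (transport η (Edge.opposite b) s) = s := by
  by_cases h : Simplex.IsDegenerate b
  · rw [transport, if_pos h, transport, if_pos ((Edge.isDegenerate_opposite b).2 h)]
  · rw [transport, if_neg h, transport, if_neg (mt (Edge.isDegenerate_opposite b).1 h),
      Edge.face_opposite_one, Edge.face_opposite_zero]
    refine transportStep_transportStep (mt (Edge.face_zero_eq_face_one_iff b).1 h) (fun a => ?_) s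
    rw [hη.opposite, mul_inv_cancel]

/-- The transport along an edge, as a permutation. -/
def transportPerm (b : Edge) : Equiv.Perm (Option (Point × Point) × G) where
  toFun := transport η b
  invFun := transport η (Edge.opposite b)
  left_inv s := by
    have := hη.transport_transport (Edge.opposite b) s
    rwa [Edge.opposite_opposite] at this
  right_inv := hη.transport_transport b

/-- The transport, as an action of the group of edges. -/
def transportHom : EdgeGroup →* Equiv.Perm (Option (Point × Point) × G) :=
  edgeLift hη.transportPerm (fun b => Equiv.ext (hη.transport_transport b))
    (fun _ h => Equiv.ext fun _ => if_pos h)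

lemma transportHom_wordClass_cons (b : Edge) (w : List Edge) (s : Option (Point × Point) × G) :
    hη.transportHom (wordClass (b :: w)) s = transport η b (hη.transportHom (wordClass w) s) := by
  rw [transportHom, edgeLift_wordClass_cons]
  rfl

open Classical in
-- A path revisiting its base point a is reset to `none` there and reopened by the next edge. No
-- factor is lost, because η a is 1 on edges that start or end at a.
lemma transportHom_path {a z : Point} (g : G) {p : List Edge} (h : IsPath p a z) :
    hη.transportHom (wordClass p) (none, g) =
      (if z = a then none else some (a, z), (p.map (η a)).prod * g) := by
  induction p generalizing z with
  | nil =>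
    have h : a = z := h
    subst h
    rw [wordClass_nil, map_one, if_pos rfl]
    simp
  | cons b p ih =>
    obtain ⟨rfl, hp⟩ := h
    rw [transportHom_wordClass_cons, ih hp, List.map_cons, List.prod_cons]
    by_cases hb : Simplex.IsDegenerate b
    · rw [transport, if_pos hb, (Edge.face_zero_eq_face_one_iff b).2 hb, hη.degenerate a b hb,
        one_mul]
    · have hne : Simplex.face 0 b ≠ Simplex.face 1 b := mt (Edge.face_zero_eq_face_one_iff b).1 hb
      rw [transport, if_neg hb]
      by_cases h1 : Simplex.face 1 b = a
      · have h2 : Simplex.face 0 b ≠ a := fun e => hne (e.trans h1.symm)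
        have h3 := hη.source b
        rw [h1] at h3
        rw [if_pos h1, if_neg h2, h3, one_mul, transportStep, h1]
      · rw [if_neg h1]
        by_cases h2 : Simplex.face 0 b = a
        · have h3 := hη.target b
          rw [h2] at h3
          simp [transportStep, h2, h3]
        · simp [transportStep, h2, Ne.symm h1, Ne.symm h2, mul_assoc]

lemma transportHom_loop {a : Point} (g : G) {p : List Edge} (h : IsPath p a a) :
    hη.transportHom (wordClass p) (none, g) = (none, (p.map (η a)).prod * g) := by
  rw [hη.transportHom_path g h, if_pos rfl]

/-- Elements of the group of loops fix the closed state and multiply the accumulated factor from the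
left, which is why reading off that factor is multiplicative. -/
lemma transportHom_of_mem {g : EdgeGroup} (hg : g ∈ loopGroup) (u : G) :
    hη.transportHom g (none, u) = (none, (hη.transportHom g (none, 1)).2 * u) := by
  refine loopGroup_induction (motive := fun g =>
    hη.transportHom g (none, u) = (none, (hη.transportHom g (none, 1)).2 * u) ∧
      (hη.transportHom g (none, 1)).1 = none) hg (by rw [map_one]; simp) (fun a p hp g hg => ?_) |>.1
  have h1 : hη.transportHom g (none, 1) = (none, (hη.transportHom g (none, 1)).2) :=
    Prod.ext hg.2 rfl
  rw [map_mul, Equiv.Perm.mul_apply, Equiv.Perm.mul_apply, hg.1, h1,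
    hη.transportHom_loop _ hp, hη.transportHom_loop _ hp]
  simp [mul_assoc]

/-- The homomorphism of the group of loops which sends a loop `bₙ ⋯ b₁` over `a` to
`η a bₙ ⋯ η a b₁`. -/
def loopHom : loopGroup →* G where
  toFun g := (hη.transportHom g (none, 1)).2
  map_one' := by rw [OneMemClass.coe_one, map_one]; rfl
  map_mul' g h := by
    rw [Subgroup.coe_mul, map_mul, Equiv.Perm.mul_apply, hη.transportHom_of_mem h.2 1,
      hη.transportHom_of_mem g.2]

lemma loopHom_wordClass {a : Point} {p : List Edge} (h : IsPath p a a) :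
    hη.loopHom ⟨wordClass p, wordClass_mem_loopGroup h⟩ = (p.map (η a)).prod := by
  change (hη.transportHom (wordClass p) (none, 1)).2 = _
  rw [hη.transportHom_loop _ h, mul_one]

/-- The value at an element of the group of loops lies in every subgroup which contains the values
at the loops formed by the letters of its reduced word. -/
lemma loopHom_mem (K : Subgroup G) (g : loopGroup) (hK : ∀ w, IsReduced w → wordClass w = g →
    ∀ a p, IsPath p a a → p ≠ [] → (∀ b ∈ p, b ∈ w) → (p.map (η a)).prod ∈ K) :
    hη.loopHom g ∈ K := by
  -- Among the reduced words for g, one that splits into loops is used; its value is the product of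
  -- the holonomies of these loops.
  obtain ⟨w, hr, hw, hl⟩ := exists_isLoopProduct g.2
  have hK := hK w hr hw
  have key : ∀ w', IsLoopProduct w' → (∀ b ∈ w', b ∈ w) →
      wordClass w' ∈ loopGroup ∧ (hη.transportHom (wordClass w') (none, 1)).2 ∈ K := by
    intro w' hl
    induction hl with
    | nil =>
      intro _
      rw [wordClass_nil, map_one]
      exact ⟨one_mem _, one_mem _⟩
    | @append a p v hp hne _ ih =>
      intro hb
      obtain ⟨h1, h2⟩ := ih fun b hb' => hb b (List.mem_append_right _ hb')
      rw [wordClass_append]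
      refine ⟨mul_mem (wordClass_mem_loopGroup hp) h1, ?_⟩
      rw [map_mul, Equiv.Perm.mul_apply, hη.transportHom_of_mem h1, hη.transportHom_loop _ hp,
        mul_one]
      exact mul_mem (hK a p hp hne fun b hb' => hb b (List.mem_append_left _ hb')) h2
  have := (key w hl fun b hb => hb).2
  rwa [hw] at this

end IsHolonomy

/-! ### Double cones -/

lemma convex_forwardCone : Convex ℝ forwardCone := by
  have hsum : ∀ x y, x ∈ forwardCone → y ∈ forwardCone → x + y ∈ forwardCone := by
    rintro x y ⟨hx, hx0⟩ ⟨hy, hy0⟩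
    refine ⟨?_, add_pos hx0 hy0⟩
    simp only [mink] at hx hy
    have hcs : (x 1 * y 1 + x 2 * y 2 + x 3 * y 3) ^ 2 ≤
        (x 1 ^ 2 + x 2 ^ 2 + x 3 ^ 2) * (y 1 ^ 2 + y 2 ^ 2 + y 3 ^ 2) := by
      nlinarith [sq_nonneg (x 1 * y 2 - x 2 * y 1), sq_nonneg (x 1 * y 3 - x 3 * y 1),
        sq_nonneg (x 2 * y 3 - x 3 * y 2)]
    have hmul : (x 1 ^ 2 + x 2 ^ 2 + x 3 ^ 2) * (y 1 ^ 2 + y 2 ^ 2 + y 3 ^ 2) ≤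
        x 0 ^ 2 * y 0 ^ 2 := by
      refine mul_le_mul (by nlinarith) (by nlinarith) (by positivity) (by positivity)
    have h := abs_le_of_sq_le_sq' (a := x 1 * y 1 + x 2 * y 2 + x 3 * y 3) (b := x 0 * y 0)
      (by nlinarith) (by positivity)
    simp only [mink, Pi.add_apply]
    nlinarith [h.2]
  have hsmul : ∀ (r : ℝ) x, 0 < r → x ∈ forwardCone → r • x ∈ forwardCone := by
    rintro r x hr ⟨hx, hx0⟩
    refine ⟨?_, mul_pos hr hx0⟩
    have e : mink (r • x) (r • x) = r ^ 2 * mink x x := by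
      simp only [mink, Pi.smul_apply, smul_eq_mul]; ring
    rw [e]
    positivity
  intro x hx y hy a b ha hb hab
  rcases ha.eq_or_lt with rfl | ha
  · rw [zero_add] at hab
    simpa [hab] using hy
  rcases hb.eq_or_lt with rfl | hb
  · rw [add_zero] at hab
    simpa [hab] using hx
  exact hsum _ _ (hsmul a x ha hx) (hsmul b y hb hy)

lemma IsDoubleCone.convex {o : Set Spacetime} (ho : IsDoubleCone o) : Convex ℝ o := by
  obtain ⟨p, q, -, rfl⟩ := ho
  intro x hx y hy a b ha hb hab
  have e : ∀ z : Spacetime, z = a • z + b • z := fun z => by rw [← add_smul, hab, one_smul]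
  have e1 : a • x + b • y - p = a • (x - p) + b • (y - p) := by
    nth_rewrite 1 [e p]; module
  have e2 : q - (a • x + b • y) = a • (q - x) + b • (q - y) := by
    nth_rewrite 1 [e q]; module
  exact ⟨by rw [e1]; exact convex_forwardCone hx.1 hy.1 ha hb hab,
    by rw [e2]; exact convex_forwardCone hx.2 hy.2 ha hb hab⟩

lemma IsDoubleCone.isBounded {o : Set Spacetime} (ho : IsDoubleCone o) : Bornology.IsBounded o := by
  obtain ⟨p, q, -, rfl⟩ := ho
  refine (Metric.isBounded_closedBall (x := p) (r := |q 0 - p 0|)).subset ?_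
  rintro x ⟨⟨h1, h2⟩, -, h3⟩
  simp only [mink, Pi.sub_apply] at h1 h2 h3
  have h4 : |x 0 - p 0| ≤ |q 0 - p 0| := by
    rw [abs_of_pos h2, abs_of_pos (by linarith)]; linarith
  rw [Metric.mem_closedBall, dist_pi_le_iff (abs_nonneg _)]
  intro i
  rw [Real.dist_eq]
  refine le_trans (sq_le_sq.1 ?_) h4
  fin_cases i
  · exact le_refl _
  · change (x 1 - p 1) ^ 2 ≤ _
    nlinarith [sq_nonneg (x 2 - p 2), sq_nonneg (x 3 - p 3)]
  · change (x 2 - p 2) ^ 2 ≤ _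
    nlinarith [sq_nonneg (x 1 - p 1), sq_nonneg (x 3 - p 3)]
  · change (x 3 - p 3) ^ 2 ≤ _
    nlinarith [sq_nonneg (x 2 - p 2), sq_nonneg (x 1 - p 1)]

/-! ### Supports of smeared edges and triangles -/

open Filter Topology

/-- The values of a Schwartz function along an arithmetic progression tend to zero. -/
lemma tendsto_schwartz_progression (f : TestFunction) (x : Spacetime) {v : Spacetime} (hv : v ≠ 0) :
    Tendsto (fun k : ℕ => f (x + (k : ℝ) • v)) atTop (𝓝 0) := by
  refine (zero_at_infty f).comp ?_
  rw [← Metric.cobounded_eq_cocompact, ← tendsto_norm_atTop_iff_cobounded]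
  have h1 : Tendsto (fun k : ℕ => (k : ℝ) * ‖v‖ - ‖x‖) atTop atTop :=
    tendsto_atTop_add_const_right _ _
      (tendsto_natCast_atTop_atTop.atTop_mul_const (norm_pos_iff.2 hv))
  refine tendsto_atTop_mono (fun k => ?_) h1
  have h2 := norm_sub_le (x + (k : ℝ) • v) x
  rw [add_sub_cancel_left, norm_smul, Real.norm_natCast] at h2
  linarith

/-- A function which is constant along an arithmetic progression and vanishes at infinity is zero
there. -/
lemma exists_ne_of_ne_zero (f : TestFunction) {x v : Spacetime} (hv : v ≠ 0) (hx : f x ≠ 0) :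
    ∃ k : ℕ, f (x + (k : ℝ) • v) ≠ f (x + (k : ℝ) • v + v) := by
  by_contra! h
  have hc : ∀ k : ℕ, f (x + (k : ℝ) • v) = f x := by
    intro k
    induction k with
    | zero => simp
    | succ k ih =>
      rw [← ih, h k]
      congr 1
      push_cast
      module
  have h1 := tendsto_schwartz_progression f x hv
  simp only [hc] at h1
  exact hx (tendsto_nhds_unique tendsto_const_nhds h1)

/-- Differentiating along the edge undoes the integration over it, so the difference of the two
translates of f can be nonzero only on the support of the smeared edge. -/
lemma Edge.lineDeriv_smear (b : Edge) (x : Spacetime) :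
    LineDeriv.lineDerivOp (Simplex.edgeVec b 0) (Simplex.smear b) x
      = b.smearing (x - b.vertex 0) - b.smearing (x - b.vertex 1) := by
  have hu : standardSimplex 0 = Set.univ := by
    ext t
    simp [standardSimplex]
  rw [Simplex.lineDeriv_edgeVec_smear, hu, setIntegral_univ, setIntegral_univ, integral_unique,
    integral_unique]
  have hvol : (volume : Measure (Fin 0 → ℝ)).real Set.univ = 1 := by
    simp [Measure.real, volume_pi]
  have h1 : ∀ r : ℝ, Simplex.param b (Fin.insertNth 0 r (default : Fin 0 → ℝ))
      = b.vertex 0 + r • (b.vertex 1 - b.vertex 0) := fun r => by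
    simp [Simplex.param]
  rw [hvol, one_smul, one_smul, Fintype.sum_empty, sub_zero]
  change b.smearing (x - Simplex.param b (Fin.insertNth 0 0 (default : Fin 0 → ℝ)))
    - b.smearing (x - Simplex.param b (Fin.insertNth 0 1 (default : Fin 0 → ℝ))) = _
  rw [h1, h1]
  simp

lemma Edge.tsupport_smear_subset (b : Edge) (hb : ¬ Simplex.IsDegenerate b) :
    tsupport (Simplex.smear b) ⊆ Simplex.support b := by
  obtain ⟨α, hα⟩ := (Edge.exists_jacobian_ne_zero b).2 (mt (Edge.isDegenerate_iff b).2 hb)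
  exact closure_mono fun x hx => ⟨α, mul_ne_zero hα hx⟩

/-- If the smeared edge `b` is supported in a double cone, then so are the translates of its smearing
function to the vertices of `b`. -/
lemma Edge.add_vertex_mem {b : Edge} (hb : ¬ Simplex.IsDegenerate b) {o : Set Spacetime}
    (ho : IsDoubleCone o) (hbo : Simplex.support b ⊆ o) {x : Spacetime}
    (hx : x ∈ tsupport b.smearing) (i : Fin 2) : x + b.vertex i ∈ o := by
  set S := tsupport (Simplex.smear b)
  have hSo : S ⊆ o := (Edge.tsupport_smear_subset b hb).trans hbo
  have hS : IsCompact S :=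
    Metric.isCompact_of_isClosed_isBounded (isClosed_tsupport _) (ho.isBounded.subset hSo)
  set v := Simplex.edgeVec b 0 with hv
  have hve : v = b.vertex 1 - b.vertex 0 := rfl
  have hv0 : v ≠ 0 := by
    rw [hve, sub_ne_zero]
    exact fun e => hb ((Edge.isDegenerate_iff b).2 e.symm)
  have hmem : ∀ y, b.smearing (y - b.vertex 0) ≠ b.smearing (y - b.vertex 1) → y ∈ S := by
    intro y hy
    by_contra hyS
    have h := Edge.lineDeriv_smear b y
    rw [SchwartzMap.lineDerivOp_apply_eq_fderiv] at h
    have h0 : fderiv ℝ (Simplex.smear b) y = 0 := by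
      by_contra hne
      exact hyS (support_fderiv_subset ℝ hne)
    rw [h0] at h
    exact hy (sub_eq_zero.1 h.symm)
  -- C is the union of the segments joining points of S. Convexity puts it inside o and compactness
  -- of S makes it closed, so that it also absorbs limit points of {f ≠ 0}; the open set o would
  -- not.
  set C := (fun p : (Spacetime × Spacetime) × ℝ => p.2 • p.1.1 + (1 - p.2) • p.1.2) ''
    ((S ×ˢ S) ×ˢ Set.Icc 0 1) with hC
  have hCo : C ⊆ o := by
    rintro _ ⟨⟨⟨y, y'⟩, r⟩, ⟨⟨hy, hy'⟩, hr⟩, rfl⟩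
    exact ho.convex (hSo hy) (hSo hy') hr.1 (sub_nonneg.2 hr.2) (add_sub_cancel _ _)
  have key : ∀ z, b.smearing z ≠ 0 → z + b.vertex i ∈ C := by
    intro z hz
    -- Since f decays, it cannot be constant along z + kv in either direction. A jump ahead and a
    -- jump behind give two points of S on the line through z + b₀ with direction v, at positions k
    -- + 1 and −l.
    obtain ⟨k, hk⟩ := exists_ne_of_ne_zero b.smearing hv0 hz
    obtain ⟨l, hl⟩ := exists_ne_of_ne_zero b.smearing (neg_ne_zero.2 hv0) hz
    have h1 : z + b.vertex 0 + ((k : ℝ) + 1) • v ∈ S := by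
      refine hmem _ ?_
      have e1 : z + b.vertex 0 + ((k : ℝ) + 1) • v - b.vertex 0 = z + (k : ℝ) • v + v := by module
      have e2 : z + b.vertex 0 + ((k : ℝ) + 1) • v - b.vertex 1 = z + (k : ℝ) • v := by
        rw [hve]; module
      rw [e1, e2]
      exact hk.symm
    have h2 : z + b.vertex 0 + (-(l : ℝ)) • v ∈ S := by
      refine hmem _ ?_
      have e1 : z + b.vertex 0 + (-(l : ℝ)) • v - b.vertex 0 = z + (l : ℝ) • (-v) := by module
      have e2 : z + b.vertex 0 + (-(l : ℝ)) • v - b.vertex 1 = z + (l : ℝ) • (-v) + -v := by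
        rw [hve]; module
      rw [e1, e2]
      exact hl
    have h3 : ∀ r : ℝ, 0 ≤ r → r ≤ 1 → z + b.vertex 0 + r • v ∈ C := by
      intro r hr0 hr1
      have hd : (0 : ℝ) < k + l + 1 := by positivity
      -- The position r ∈ [0, 1] lies in [−l, k + 1], an interval of length k + l + 1; the weight is
      -- its barycentric coordinate there.
      have e : ((l + r) / (k + l + 1) : ℝ) • (z + b.vertex 0 + ((k : ℝ) + 1) • v)
          + (1 - (l + r) / (k + l + 1) : ℝ) • (z + b.vertex 0 + (-(l : ℝ)) • v)
          = z + b.vertex 0 + r • v := by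
        match_scalars <;> field_simp <;> ring
      exact ⟨⟨⟨_, _⟩, _⟩, ⟨⟨h1, h2⟩, by positivity, (div_le_one hd).2 (by
        linarith [(Nat.cast_nonneg k : (0 : ℝ) ≤ k)])⟩, e⟩
    fin_cases i
    · simpa using h3 0 le_rfl zero_le_one
    · have := h3 1 zero_le_one le_rfl
      rw [one_smul, hve] at this
      convert this using 1
      change z + b.vertex 1 = _
      abel
  have hcl : IsClosed C :=
    (((hS.prod hS).prod isCompact_Icc).image (by fun_prop)).isClosed
  exact hCo (closure_minimal (t := (fun z => z + b.vertex i) ⁻¹' C) (fun z hz => key z hz)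
    (hcl.preimage (by fun_prop)) hx)

/-- A smeared simplex is supported in each double cone which contains the translates of the support of
its smearing function to its vertices. -/
lemma Simplex.support_subset {n : ℕ} {s : Simplex n} {o : Set Spacetime} (ho : IsDoubleCone o)
    (h : ∀ x ∈ tsupport s.smearing, ∀ i, x + s.vertex i ∈ o) : s.support ⊆ o := by
  have hcomp : IsCompact (tsupport s.smearing) := by
    refine Metric.isCompact_of_isClosed_isBounded (isClosed_tsupport _) ?_
    refine ((Bornology.IsBounded.vadd ho.isBounded (-s.vertex 0))).subset fun x hx => ?_
    exact ⟨x + s.vertex 0, h x hx 0, by simp⟩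
  set K := (fun p : Spacetime × (Fin n → ℝ) => p.1 + s.param p.2) ''
    (tsupport s.smearing ×ˢ standardSimplex n)
  have hp := s.continuous_param
  have hK : IsClosed K :=
    ((hcomp.prod (isCompact_standardSimplex n)).image (by fun_prop)).isClosed
  have hKo : K ⊆ o := by
    rintro _ ⟨⟨x, t⟩, ⟨hx, ht⟩, rfl⟩
    have e : x + s.param t = (1 - ∑ i, t i) • (x + s.vertex 0) + ∑ i, t i • (x + s.vertex i.succ) := by
      simp only [Simplex.param, smul_sub, smul_add, Finset.sum_sub_distrib, Finset.sum_add_distrib,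
        ← Finset.sum_smul]
      module
    have hc := ho.convex.sum_mem (t := Finset.univ)
      (w := (Fin.cons (1 - ∑ i, t i) t : Fin (n + 1) → ℝ)) (z := fun i => x + s.vertex i)
      (fun i _ => by
        refine Fin.cases ?_ (fun j => ?_) i
        · simpa using ht.2
        · simpa using ht.1 j)
      (by simp [Fin.sum_univ_succ]) (fun i _ => h x hx i)
    rw [Fin.sum_univ_succ] at hc
    simp only [Fin.cons_zero, Fin.cons_succ] at hc
    change x + s.param t ∈ o
    rwa [e]
  refine (closure_minimal ?_ hK).trans hKo
  rintro x ⟨α, hα⟩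
  have hα' : s.jacobian α * s.smear x ≠ 0 := hα
  have hs : s.smear x ≠ 0 := right_ne_zero_of_mul hα'
  by_contra hx
  refine hs ?_
  rw [smear_apply]
  refine setIntegral_eq_zero_of_forall_eq_zero fun t ht => ?_
  by_contra hne
  exact hx ⟨(x - s.param t, t), ⟨subset_tsupport _ hne, ht⟩, by simp⟩

/-! ### Homomorphisms out of a group C*-algebra -/

namespace GroupCStar

variable {G : Type*} [Group G] {B : Type*} [CStarAlgebra B]

lemma lift_of (u : G →* unitary B) (g : G) : lift u (of g) = u g := by
  change (Completion.extension (liftRing u) : GroupCStar G → B) (incl (GroupRing.single g 1)) = _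
  rw [extension_incl, liftRing_single, one_smul]

/-- Continuous linear maps on a group C*-algebra are determined by their values on the group. -/
lemma funext_of {f f' : GroupCStar G → B} (hc : Continuous f) (hc' : Continuous f')
    (hl : IsLinearMap ℂ f) (hl' : IsLinearMap ℂ f') (h : ∀ g, f (of g) = f' (of g))
    (x : GroupCStar G) : f x = f' x := by
  induction x using induction_on with
  | hp => exact isClosed_eq hc hc'
  | ih x =>
    induction x using GroupRing.induction_linear with
    | zero => rw [map_zero, hl.map_zero, hl'.map_zero]
    | add x y hx hy => rw [map_add, hl.map_add, hl'.map_add, hx, hy]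
    | single g a =>
      have e : incl (GroupRing.single g a) = a • of g := by
        rw [of, smul_incl, GroupRing.smul_single, mul_one]
      rw [e, hl.map_smul, hl'.map_smul, h]

lemma continuous_starAlgHom (π : GroupCStar G →⋆ₐ[ℂ] B) : Continuous π :=
  AddMonoidHomClass.continuous_of_bound π 1 fun x => by
    simpa using NonUnitalStarAlgHom.norm_apply_le π x

lemma isLinearMap_starAlgHom (π : GroupCStar G →⋆ₐ[ℂ] B) : IsLinearMap ℂ π :=
  ⟨map_add π, map_smul π⟩

lemma starAlgHom_ext {π π' : GroupCStar G →⋆ₐ[ℂ] B} (h : ∀ g, π (of g) = π' (of g)) : π = π' :=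
  StarAlgHom.ext (funext_of (continuous_starAlgHom π) (continuous_starAlgHom π')
    (isLinearMap_starAlgHom π) (isLinearMap_starAlgHom π') h)

lemma of_one : of (1 : G) = 1 := map_one incl

lemma of_mul (g h : G) : of (g * h) = of g * of h :=
  congrArg Subtype.val (map_mul ofHom g h)

lemma map_of {G' : Type*} [Group G'] (φ : G →* G') (g : G) : map φ (of g) = of (φ g) :=
  lift_of _ g

end GroupCStar

/-! ### Elements of the group of causal loops -/

lemma CausalLoopGroup.induction {motive : CausalLoopGroup → Prop} (one : motive 1)
    (loop_mul : ∀ (a : Point) (p : List Edge) (hp : IsPath p a a) (g : CausalLoopGroup),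
      motive g → motive (loopClass hp * g)) (g : CausalLoopGroup) : motive g := by
  induction g using QuotientGroup.induction_on with
  | H g =>
  obtain ⟨g, hg⟩ := g
  have key : ∃ h : g ∈ loopGroup, motive (QuotientGroup.mk ⟨g, h⟩) := by
    refine loopGroup_induction (motive := fun g =>
      ∃ h : g ∈ loopGroup, motive (QuotientGroup.mk ⟨g, h⟩)) hg ⟨one_mem _, one⟩ ?_
    rintro a p hp g ⟨hg, h⟩
    exact ⟨mul_mem (wordClass_mem_loopGroup hp) hg, loop_mul a p hp _ h⟩
  exact key.2

lemma causalLoopAction_loopClass (P : Poincare) {a : Point} {p : List Edge} (hp : IsPath p a a) :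
    causalLoopAction P (loopClass hp) = loopClass (hp.smul P) :=
  congrArg QuotientGroup.mk (Subtype.ext (edgeAction_wordClass P p))

lemma IsPath.smearing : ∀ {p : List Edge} {a a' : Point}, IsPath p a a' →
    a'.smearing = a.smearing ∧ ∀ b ∈ p, b.smearing = a.smearing
  | [], a, a', h => ⟨congrArg _ (show a = a' from h).symm, by simp⟩
  | b :: p, a, a', ⟨h1, h2⟩ => by
    have ih := IsPath.smearing h2
    have hb : b.smearing = a.smearing := ih.1
    refine ⟨by rw [← h1]; exact hb, ?_⟩
    intro b' hb'
    rcases List.mem_cons.1 hb' with rfl | hb'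
    · exact hb
    · exact ih.2 b' hb'

/-- It places the apex of the cones among the vertices of the loop's own edges, so that localizing
the edges localizes the apex as well. -/
lemma IsPath.exists_mem_face_one : ∀ {p : List Edge} {a a' : Point}, IsPath p a a' → p ≠ [] →
    ∃ b ∈ p, Simplex.face 1 b = a
  | [], _, _, _, h => (h rfl).elim
  | [b], _, _, h, _ => ⟨b, by simp, h.2.symm⟩
  | b :: b' :: p, _, _, h, _ => by
    obtain ⟨d, hd, e⟩ := IsPath.exists_mem_face_one h.2 (List.cons_ne_nil _ _)
    exact ⟨d, List.mem_cons_of_mem _ hd, e⟩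

/-- If the edges of a loop are supported in a double cone, then so are the cones over them. -/
lemma IsPath.support_cone_subset {a : Point} {p : List Edge} (hp : IsPath p a a)
    {o : Set Spacetime} (ho : IsDoubleCone o) (hd : ∀ b ∈ p, ¬ Simplex.IsDegenerate b)
    (hpo : ∀ b ∈ p, Simplex.support b ⊆ o) {b : Edge} (hb : b ∈ p) :
    (Simplex.cone a b).support ⊆ o := by
  obtain ⟨d, hdp, e⟩ := hp.exists_mem_face_one (List.ne_nil_of_mem hb)
  refine Simplex.support_subset ho fun x hx i => ?_
  have hx : x ∈ tsupport b.smearing := hx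
  refine Fin.cases ?_ (fun j => ?_) i
  · have hx' : x ∈ tsupport d.smearing := by
      rwa [hp.smearing.2 d hdp, ← hp.smearing.2 b hb]
    have h := Edge.add_vertex_mem (hd d hdp) ho (hpo d hdp) hx' 0
    rw [← e]
    exact h
  · exact Edge.add_vertex_mem (hd b hb) ho (hpo b hb) hx j

/-! ### The representation given by the electromagnetic cochain -/

namespace QuantumEMField

variable {H : Type*} [NormedAddCommGroup H] [InnerProductSpace ℂ H] [CompleteSpace H]
  (Q : QuantumEMField H)

/-- Reversing an edge reverses the cone over it, and the cone is degenerate if the edge is, or if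
the apex is one of its end points. -/
lemma isHolonomy_emCochain : IsHolonomy fun a b => Q.emCochain (Simplex.cone a b) where
  opposite a b := by
    rw [← Unitary.star_eq_inv, star_emCochain]
    congr 1
  degenerate a b hb := Q.emCochain_of_isDegenerate _ fun h =>
    hb fun i j hij => Fin.succ_injective _ (h (by simpa [Simplex.cone] using hij))
  source b := Q.emCochain_of_isDegenerate _ fun h =>
    absurd (@h 0 1 rfl) (by decide)
  target b := Q.emCochain_of_isDegenerate _ fun h =>
    absurd (@h 0 2 rfl) (by decide)

lemma commute_loopHom {o₁ o₂ : Set Spacetime} (h₁ : IsDoubleCone o₁) (h₂ : IsDoubleCone o₂)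
    (h : CausallyDisjoint o₁ o₂) {g₁ g₂ : loopGroup} (hg₁ : g₁ ∈ localLoops o₁)
    (hg₂ : g₂ ∈ localLoops o₂) :
    Commute (Q.isHolonomy_emCochain.loopHom g₁) (Q.isHolonomy_emCochain.loopHom g₂) := by
  have hsupp : ∀ {o : Set Spacetime} {g : loopGroup}, g ∈ localLoops o → ∀ w, IsReduced w →
      wordClass w = g → ∀ b ∈ w, Simplex.support b ⊆ o :=
    fun hg w hw hwg b hb x hx => hg ⟨w, hw, hwg, b, hb, hx⟩
  have hcone : ∀ {a₁ a₂ : Point} {p₁ p₂ : List Edge}, (∀ b ∈ p₁, (Simplex.cone a₁ b).support ⊆ o₁) →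
      (∀ b ∈ p₂, (Simplex.cone a₂ b).support ⊆ o₂) →
      Commute (p₁.map fun b => Q.emCochain (Simplex.cone a₁ b)).prod
        (p₂.map fun b => Q.emCochain (Simplex.cone a₂ b)).prod := by
    intro a₁ a₂ p₁ p₂ hp₁ hp₂
    refine Commute.list_prod_left _ _ fun u hu => Commute.list_prod_right _ _ fun v hv => ?_
    obtain ⟨b₁, hb₁, rfl⟩ := List.mem_map.1 hu
    obtain ⟨b₂, hb₂, rfl⟩ := List.mem_map.1 hv
    exact Q.commute_emCochain _ _ (h.mono (hp₁ b₁ hb₁) (hp₂ b₂ hb₂))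
  -- Centralizers are subgroups, so `loopHom_mem` reduces g₁, and then g₂, to single loops made of
  -- letters of their reduced words. The cones over these letters lie in o₁ and o₂.
  refine Subgroup.mem_centralizer_singleton_iff.1
    (Q.isHolonomy_emCochain.loopHom_mem (Subgroup.centralizer {_}) g₁ ?_)
  intro w₁ hw₁ hwg₁ a₁ p₁ hp₁ _ hpw₁
  refine Subgroup.mem_centralizer_singleton_iff.2 (Commute.symm (Subgroup.mem_centralizer_singleton_iff.1
    (Q.isHolonomy_emCochain.loopHom_mem (Subgroup.centralizer {_}) g₂ ?_)))
  intro w₂ hw₂ hwg₂ a₂ p₂ hp₂ _ hpw₂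
  refine Subgroup.mem_centralizer_singleton_iff.2 (Commute.symm (hcone
    (fun b hb => hp₁.support_cone_subset h₁ (fun b hb => hw₁.1 b (hpw₁ b hb))
      (fun b hb => hsupp hg₁ w₁ hw₁ hwg₁ b (hpw₁ b hb)) hb)
    (fun b hb => hp₂.support_cone_subset h₂ (fun b hb => hw₂.1 b (hpw₂ b hb))
      (fun b hb => hsupp hg₂ w₂ hw₂ hwg₂ b (hpw₂ b hb)) hb)))

/-- The unitary representation of the group of causal loops given by the electromagnetic cochain. -/
def causalLoopHom : CausalLoopGroup →* unitary (H →L[ℂ] H) :=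
  QuotientGroup.lift _ Q.isHolonomy_emCochain.loopHom (by
    refine Subgroup.normalClosure_le_normal ?_
    rintro _ ⟨o₁, o₂, h₁, h₂, h, g₁, hg₁, g₂, hg₂, rfl⟩
    change Q.isHolonomy_emCochain.loopHom _ = 1
    rw [map_mul, map_mul, map_mul, map_inv, map_inv, (Q.commute_loopHom h₁ h₂ h hg₁ hg₂).eq,
      mul_inv_cancel_right, mul_inv_cancel])

lemma causalLoopHom_loopClass {a : Point} {p : List Edge} (hp : IsPath p a a) :
    Q.causalLoopHom (loopClass hp) = (p.map fun b => Q.emCochain (Simplex.cone a b)).prod :=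
  Q.isHolonomy_emCochain.loopHom_wordClass hp

lemma cone_smul {n : ℕ} (P : Poincare) (a : Point) (s : Simplex n) :
    P • Simplex.cone a s = Simplex.cone (P • a) (P • s) := by
  ext1
  · funext i; refine Fin.cases rfl (fun _ => rfl) i
  · rfl

lemma causalLoopHom_causalLoopAction (P : Poincare) (g : CausalLoopGroup) :
    Q.causalLoopHom (causalLoopAction P g) = Q.U P * Q.causalLoopHom g * star (Q.U P) := by
  rw [Unitary.star_eq_inv, ← MulAut.conj_apply]
  induction g using CausalLoopGroup.induction with
  | one => simp only [map_one]
  | loop_mul a p hp g ih =>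
    simp only [map_mul, ih]
    congr 1
    rw [causalLoopAction_loopClass, causalLoopHom_loopClass, causalLoopHom_loopClass,
      map_list_prod, List.map_map, List.map_map]
    congr 1
    refine List.map_congr_left fun b _ => ?_
    change Q.emCochain (Simplex.cone (P • a) (P • b)) = MulAut.conj (Q.U P) _
    rw [MulAut.conj_apply, ← Unitary.star_eq_inv, Q.covariant_emCochain, cone_smul]

/-- The representation of the net of causal loops given by the electromagnetic cochain. -/
def representation : LoopAlgebra →⋆ₐ[ℂ] (H →L[ℂ] H) := GroupCStar.lift Q.causalLoopHom

lemma representation_loopClass {a : Point} {p : List Edge} (hp : IsPath p a a) :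
    Q.representation (GroupCStar.of (loopClass hp)) =
      ((p.map fun b => Q.emCochain (Simplex.cone a b)).prod : unitary (H →L[ℂ] H)) := by
  rw [representation, GroupCStar.lift_of, causalLoopHom_loopClass]

lemma isCovariantRepresentation_representation : IsCovariantRepresentation Q.representation Q.U := by
  intro P A
  refine GroupCStar.funext_of
    (f := fun A => (Q.U P : H →L[ℂ] H) * Q.representation A * star (Q.U P : H →L[ℂ] H))
    (f' := fun A => Q.representation (loopAlgebraAction P A))
    ((continuous_const.mul (GroupCStar.continuous_starAlgHom _)).mul continuous_const)
    ((GroupCStar.continuous_starAlgHom _).comp (GroupCStar.continuous_starAlgHom _))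
    ⟨fun x y => by rw [map_add, mul_add, add_mul],
      fun c x => by rw [map_smul, mul_smul_comm, smul_mul_assoc]⟩
    ⟨fun x y => by rw [map_add, map_add], fun c x => by rw [map_smul, map_smul]⟩ (fun g => ?_) A
  simp only [loopAlgebraAction, GroupCStar.map_of, representation, GroupCStar.lift_of,
    causalLoopHom_causalLoopAction]
  rfl

/-! ### The form of the cone over the boundary of a triangle -/

/-- The face of h^a(c) opposite the apex is c; its other faces are the cones over the faces of c,
with the signs reversed. -/
lemma form_cone_boundary (a : Point) (c : Triangle) (μ ν : Fin 4) :
    (c.boundary.cone a).form ![μ, ν] =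
      c.form ![μ, ν] - (Simplex.cone a c).boundary.form ![μ, ν] := by
  have h1 : c.boundary.cone a =
      ∑ i : Fin 3, Finsupp.single (Simplex.cone a (c.face i)) ((-1) ^ (i : ℕ) : ℤ) := by
    rw [Chain.cone, Simplex.boundary, Finsupp.mapDomain_finsetSum]
    simp only [Finsupp.mapDomain_single]
  have h0 : (Simplex.cone a c).face 0 = c := by
    ext1
    · funext i; rfl
    · rfl
  have hs : ∀ i : Fin 3, (Simplex.cone a c).face i.succ = Simplex.cone a (c.face i) := by
    intro i
    ext1
    · funext j
      refine Fin.cases ?_ (fun k => ?_) j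
      · change (Simplex.cone a c).vertex (i.succ.succAbove 0) = _
        rw [Fin.succ_succAbove_zero]; rfl
      · change (Simplex.cone a c).vertex (i.succ.succAbove k.succ) = _
        rw [Fin.succ_succAbove_succ]; rfl
    · rfl
  have h2 : (Simplex.cone a c).boundary.form ![μ, ν] = c.form ![μ, ν]
      - ∑ i : Fin 3, ((-1) ^ (i : ℕ) : ℤ) • (Simplex.cone a (c.face i)).form ![μ, ν] := by
    rw [Simplex.boundary, Chain.form_sum, Fin.sum_univ_succ, Chain.form_single, h0, sub_eq_add_neg,
      ← Finset.sum_neg_distrib]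
    congr 1
    · simp
    · refine Finset.sum_congr rfl fun i _ => ?_
      rw [Chain.form_single, hs, Fin.val_succ, pow_succ, mul_neg_one, neg_smul]
  rw [h1, h2, Chain.form_sum, sub_sub_cancel]
  simp only [Chain.form_single]

/-- The surfaces c and h^a(∂c) differ by a boundary, on which the field vanishes; the flux through c
is thus localized where the form of h^a(∂c) is. -/
lemma surfaceIntegral_eq_cone_boundary (a : Point) (c : Triangle) :
    Q.surfaceIntegral c =
      Q.contraction fun μ ν => (1 / 2 : ℝ) • (c.boundary.cone a).form ![μ, ν] := by
  have h : Q.surfaceIntegral c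
      - Q.contraction (fun μ ν => (1 / 2 : ℝ) • (c.boundary.cone a).form ![μ, ν])
      = Q.contraction fun μ ν => (1 / 2 : ℝ) • (Simplex.cone a c).boundary.form ![μ, ν] := by
    simp only [surfaceIntegral_eq, contraction, ← fieldMap_apply, form_cone_boundary, smul_sub,
      map_sub, Finset.sum_sub_distrib, sub_sub_cancel]
  rw [contraction_smul _ _ fun μ ν => (Simplex.cone a c).boundary.form ![μ, ν],
    contraction_boundary, smul_zero] at h
  exact sub_eq_zero.1 h

/-- Cochains over loops with causally disjoint cones commute. -/
lemma commute_emCochain_of_cone_boundary (a a' : Point) (c c' : Triangle)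
    (h : CausallyDisjoint (c.boundary.cone a).support (c'.boundary.cone a').support) :
    Commute (Q.emCochain c) (Q.emCochain c') := by
  rw [emCochain, emCochain, Q.surfaceIntegral_eq_cone_boundary a,
    Q.surfaceIntegral_eq_cone_boundary a']
  refine Q.commute_contraction fun μ ν α β => h.mono ?_ ?_
  · exact (tsupport_smul_subset_right (fun _ => (1 / 2 : ℝ)) _).trans
      (Chain.tsupport_form_subset _ _)
  · exact (tsupport_smul_subset_right (fun _ => (1 / 2 : ℝ)) _).trans
      (Chain.tsupport_form_subset _ _)

end QuantumEMField

end

end CausalLoops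

/-! ### The theorem -/

open CausalLoops
theorem theorem4p6 {H : Type*} [NormedAddCommGroup H] [InnerProductSpace ℂ H] [CompleteSpace H]
    (Q : QuantumEMField H) :
    (∀ c : Triangle, IsEssentiallySelfAdjoint (unbounded (Q.surfaceIntegral c)) ∧
      IsExpI (unbounded (Q.surfaceIntegral c)).closure (Q.emCochain c)) ∧
    IsCausalCovariantCochain Q.emCochain Q.U ∧
    (∃! π : LoopAlgebra →⋆ₐ[ℂ] (H →L[ℂ] H),
      IsCovariantRepresentation π Q.U ∧
      ∀ (a : Point) (p : List Edge) (hp : IsPath p a a),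
        π (GroupCStar.of (loopClass hp)) =
          ((p.map fun b => Q.emCochain (Simplex.cone a b)).prod : unitary (H →L[ℂ] H))) ∧
    (∀ (a a' : Point) (c c' : Triangle),
      c.smearing = a.smearing → c'.smearing = a'.smearing →
      CausallyDisjoint (c.boundary.cone a).support (c'.boundary.cone a').support →
      Commute (Q.emCochain c) (Q.emCochain c')) := by
  refine ⟨fun c => ⟨Q.isEssentiallySelfAdjoint_surfaceIntegral c,
      (Q.isEssentiallySelfAdjoint_surfaceIntegral c).isExpI⟩,
    Q.isCausalCovariantCochain_emCochain,
    ⟨Q.representation, ⟨Q.isCovariantRepresentation_representation,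
      fun a p hp => Q.representation_loopClass hp⟩, ?_⟩,
    fun a a' c c' _ _ h => Q.commute_emCochain_of_cone_boundary a a' c c' h⟩
  rintro π ⟨-, hπ⟩
  -- A *-homomorphism is contractive, so it is determined by its values on the group, and the group
  -- of causal loops is generated by the loops on which π is prescribed.
  refine GroupCStar.starAlgHom_ext fun g => ?_
  induction g using CausalLoopGroup.induction with
  | one => rw [GroupCStar.of_one, map_one, map_one]
  | loop_mul a p hp g ih =>
    rw [GroupCStar.of_mul, map_mul, map_mul, ih, hπ, Q.representation_loopClass]
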